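/- Let $\mathcal N(z\mid b_1,b_2)$ be a two-sender multiple access channel (MAC) with input alphabets of sizes $d_1\ge 2$ and $d_2=2$ and output alphabet of size $d_o\ge 2$. All logarithms are to base $2$. For input distributions $p,q$ let $I(p,q)=I(B_1,B_2;Z)$ be the mutual information between the inputs $B_1\sim p$, $B_2\sim q$ (independent) and the output $Z$; let $I^*(s)=\max_p I(p,(s,1-s))$ for $s\in[0,1]$, and let $S(\mathcal N)=\max_{p,q}I(p,q)$ be the sum capacity. Put $H^{\max}_{\mathcal N}=\max_{b_1,b_2}H(\mathcal N(\cdot\mid b_1,b_2))$ and $$\beta_I(x)=\Big(\tfrac12\log(d_o-1)+H^{\max}_{\mathcal N}\Big)x+\overline h(x/2),$$ where $\overline h(x)=-x\log x-(1-x)\log(1-x)$ for $0\le x\le\frac12$ and $\overline h(x)=1$ for $x\ge\frac12$. The modified Piyavskii–Shubert algorithm with threshold $\epsilon>0$ starts with $s^{(0)}=0$, $s^{(1)}=s^*=1$, $F(s)=I^*(0)+\beta_I(2|s|)$. While $F(s^*)-I^*(s^*)>\epsilon$, it sorts the points found so far, $x_0\le\dots\le x_k$, puts $F_i(s)=I^*(x_i)+\beta_I(2|s-x_i|)$,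 finds for each $i<k$ a root $\bar s_i\in[x_i,x_{i+1}]$ of $F_i-F_{i+1}$, picks $m$ maximizing $F_i(\bar s_i)$, sets $s^*=\bar s_m$, $F=F_m$, and adds $s^*$ to the points. When the loop ends it returns $I^*(s^*)$. Let $\mu=3\log d_o$ and $$K(\epsilon,d_o)=\left\lceil\frac{2(\mu^2+4)}{(\epsilon\mu+4)-\sqrt{16+8\epsilon\mu-4\epsilon^2}}\right\rceil .$$ 1. If $0<\epsilon\le 3\log d_o$, then, with exact evaluation of $I^*$ and exact roots, for every choice of the roots and of the maximizing indices, the algorithm never gets stuck, its while loop makes at most $K(\epsilon,d_o)$ iterations, and the returned value differs from $S(\mathcal N)$ by at most $\epsilon$. 2. For a precision $0<\epsilon\le3$ chosen independently of $d_o$, this bound is $O(\log(d_o)/\epsilon)$ when $\log d_o\gg1$: there is an absolute constant $C$ such that for every $\epsilon\in(0,3]$ we have $K(\epsilon,d_o)\le C\log(d_o)/\epsilon$ for all $d_o$ larger than some number depending on $\epsilon$. 3. The total cost of computing $S(\mathcal N)$ to a precision $\epsilon>0$, including the intermediate steps (the convex problems that define $I^*$, sorting, root finding), is at most polynomial in $d_1$,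 $d_o$ and $1/\epsilon$. Precisely: there are a polynomial $P$ and a single program for a random access machine with integer variables, real variables and real arrays, which has exact real arithmetic, logarithm and comparison, integer addition and truncated subtraction, unit cost for each operation, and no real constants other than natural numbers, such that for all $d_1,d_o\ge2$, every $\mathcal N$ as above and every $\epsilon>0$, the program on input $(d_1,d_o,\epsilon,\mathcal N)$ halts at cost at most $P(d_1,d_o,1/\epsilon)$ and outputs a number within $\epsilon$ of $S(\mathcal N)$. Moreover, it outputs the iterates, the number of iterations and the computed values of the objective, and these are those of a completed execution of the algorithm above with threshold $\epsilon/2$, in which $I^*$ is replaced by a numerical approximation with error at most $\tau$, and the root conditions by $|F_i(\bar s_i)-F_{i+1}(\bar s_i)|\le\eta$, for some $\tau,\eta\ge0$ with $\tau+\eta\le\epsilon/2$. -/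

import Mathlib

/-! ### Entropy, mutual information and the sum capacity (all logarithms to base 2) -/

/-- Shannon entropy, in bits, of a probability vector (with `0 log 0 = 0`). -/
noncomputable def shannonEntropy {α : Type} [Fintype α] (p : α → ℝ) : ℝ :=
  -∑ a, p a * Real.logb 2 (p a)

/-- `I(X; Y) = H(X) + H(Y) - H(X, Y)` for a pair with joint distribution `P`. -/
noncomputable def mutualInformation {α β : Type} [Fintype α] [Fintype β] (P : α × β → ℝ) : ℝ :=
  shannonEntropy (fun a => ∑ b, P (a, b)) + shannonEntropy (fun b => ∑ a, P (a, b))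
    - shannonEntropy P

/-- A two-sender multiple access channel: `prob b₁ b₂ z` is `𝒩(z | b₁, b₂)`. -/
structure MAC (B₁ B₂ Z : Type) [Fintype Z] where
  prob : B₁ → B₂ → Z → ℝ
  prob_nonneg : ∀ b₁ b₂ z, 0 ≤ prob b₁ b₂ z
  sum_prob : ∀ b₁ b₂, ∑ z, prob b₁ b₂ z = 1

namespace MAC

variable {B₁ B₂ Z : Type} [Fintype B₁] [Fintype B₂] [Fintype Z]

/-- `I(p, q) = I(B₁, B₂; Z)` for independent inputs `B₁ ∼ p`, `B₂ ∼ q`. -/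
noncomputable def info (N : MAC B₁ B₂ Z) (p : B₁ → ℝ) (q : B₂ → ℝ) : ℝ :=
  mutualInformation (fun x : (B₁ × B₂) × Z => p x.1.1 * q x.1.2 * N.prob x.1.1 x.1.2 x.2)

/-- `S(𝒩)`, the maximum of `I(B₁, B₂; Z)` over all product input distributions. -/
noncomputable def sumCapacity (N : MAC B₁ B₂ Z) : ℝ :=
  sSup {r | ∃ p ∈ stdSimplex ℝ B₁, ∃ q ∈ stdSimplex ℝ B₂, r = N.info p q}

/-- `I*(q)`, the maximum over `p` of `I(p, q)`. -/
noncomputable def infoMax (N : MAC B₁ B₂ Z) (q : B₂ → ℝ) : ℝ :=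
  sSup ((fun p => N.info p q) '' stdSimplex ℝ B₁)

/-- `I*(s) = I*(q_s)` with `q_s = (s, 1 - s)`, when the second input alphabet has size 2. -/
noncomputable def objective (N : MAC B₁ (Fin 2) Z) (s : ℝ) : ℝ :=
  N.infoMax ![s, 1 - s]

/-- The largest output entropy `H_𝒩^max` over all pairs of input letters. -/
noncomputable def maxOutputEntropy (N : MAC B₁ B₂ Z) : ℝ :=
  ⨆ b : B₁ × B₂, shannonEntropy (N.prob b.1 b.2)

end MAC

/-- The modified binary entropy, in bits: `h(x)` for `x ≤ 1/2`, and `1` beyond. -/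
noncomputable def modifiedBinaryEntropy (x : ℝ) : ℝ :=
  if x ≤ 1 / 2 then -x * Real.logb 2 x - (1 - x) * Real.logb 2 (1 - x) else Real.logb 2 2

/-- `β_I(x) = (log(dₒ - 1) / 2 + H_𝒩^max) x + h̄(x / 2)`. -/
noncomputable def MAC.modulus {B₁ B₂ Z : Type} [Fintype B₁] [Fintype B₂] [Fintype Z]
    (N : MAC B₁ B₂ Z) (x : ℝ) : ℝ :=
  (1 / 2 * Real.logb 2 ((Fintype.card Z : ℝ) - 1) + N.maxOutputEntropy) * x
    + modifiedBinaryEntropy (x / 2)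

/-! ### The modified Piyavskii–Shubert algorithm on `[0, 1]`

`f` is the objective that the algorithm queries, `β` its modulus of continuity, `η` the tolerance
of root finding (`η = 0`: exact roots) and `ε` the threshold in the test of the while loop. -/

/-- The bounding function `s ↦ f(x) + β(2 |s - x|)` of the iterate `x`. -/
noncomputable def boundingFn (f β : ℝ → ℝ) (x s : ℝ) : ℝ :=
  f x + β (2 * |s - x|)

/-- The variables of the algorithm: the iterates `s⁽⁰⁾, …, s⁽ᵏ⁾` in the order in which they were
generated, the current bounding function `F`, and the current point `s*`. -/
structure PSState where
  pts : List ℝ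
  bound : ℝ → ℝ
  cur : ℝ

/-- The state before the while loop: `s⁽⁰⁾ = 0`, `s⁽¹⁾ = s* = 1`, `F = F₀`. -/
noncomputable def PSState.init (f β : ℝ → ℝ) : PSState where
  pts := [0, 1]
  bound := boundingFn f β 0
  cur := 1

/-- The test `F(s*) - f(s*) > ε` of the while loop. -/
def PSState.Running (f : ℝ → ℝ) (ε : ℝ) (st : PSState) : Prop :=
  st.bound st.cur - f st.cur > ε

/-- One pass through the body of the while loop. The list `x` holds the iterates in ascending
order, `root i` is a point of `[x i, x (i + 1)]` at which `F_i - F_{i+1}` vanishes (up to `η`),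
and `m` is an index at which `F_i (root i)` is largest. Every choice of roots and of the maximizing
index is allowed. -/
def PSStep (f β : ℝ → ℝ) (η ε : ℝ) (st st' : PSState) : Prop :=
  st.Running f ε ∧
  ∃ (x : List ℝ) (root : ℕ → ℝ) (m : ℕ) (hm : m + 1 < x.length),
    x.Perm st.pts ∧ x.Pairwise (· ≤ ·) ∧
    (∀ (i : ℕ) (hi : i + 1 < x.length),
      root i ∈ Set.Icc x[i] x[i + 1] ∧
      |boundingFn f β x[i] (root i) - boundingFn f β x[i + 1] (root i)| ≤ η) ∧
    (∀ (i : ℕ) (hi : i + 1 < x.length),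
      boundingFn f β x[i] (root i) ≤ boundingFn f β x[m] (root m)) ∧
    st' = { pts := st.pts ++ [root m], bound := boundingFn f β x[m], cur := root m }

/-- `PSReaches f β η ε n st`: some execution is in state `st` after `n` iterations of the while
loop. -/
inductive PSReaches (f β : ℝ → ℝ) (η ε : ℝ) : ℕ → PSState → Prop
  | init : PSReaches f β η ε 0 (PSState.init f β)
  | step {n : ℕ} {st st' : PSState} :
      PSReaches f β η ε n st → PSStep f β η ε st st' → PSReaches f β η ε (n + 1) st'

/-- The bound `⌈2(μ² + 4) / ((εμ + 4) - √(16 + 8εμ - 4ε²))⌉` with `μ = 3 log₂ dₒ`. -/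
noncomputable def iterationBound (ε : ℝ) (dₒ : ℕ) : ℕ :=
  let μ : ℝ := 3 * Real.logb 2 dₒ
  ⌈2 * (μ ^ 2 + 4) / ((ε * μ + 4) - Real.sqrt (16 + 8 * ε * μ - 4 * ε ^ 2))⌉₊

/-! ### A real random access machine with unit costs

Programs work on integer variables, real variables and real arrays that are indexed by integers.
Integers are natural numbers with addition and truncated subtraction only. Reals have exact
arithmetic, natural logarithm and comparison; there is no rounding of reals to integers, and no
real constants except natural numbers. Each node of an expression and each command costs one unit.
Division by zero and the logarithm of a nonpositive number are undefined: execution gets stuck. -/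

namespace RAM

structure Store where
  int : ℕ → ℕ
  real : ℕ → ℝ
  arr : ℕ → ℕ → ℝ

inductive IntExp
  | const (n : ℕ)
  | var (x : ℕ)
  | plus (u v : IntExp)
  | minus (u v : IntExp)

inductive RealExp
  | ofInt (u : IntExp)
  | var (x : ℕ)
  | elem (a : ℕ) (u : IntExp)
  | plus (u v : RealExp)
  | minus (u v : RealExp)
  | times (u v : RealExp)
  | quot (u v : RealExp)
  | log (u : RealExp)

inductive Test
  | intLe (u v : IntExp)
  | realLe (u v : RealExp)
  | neg (b : Test)
  | both (b c : Test)

inductive Cmd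
  | skip
  | setInt (x : ℕ) (u : IntExp)
  | setReal (x : ℕ) (u : RealExp)
  | setElem (a : ℕ) (i : IntExp) (u : RealExp)
  | seq (c c' : Cmd)
  | ite (b : Test) (c c' : Cmd)
  | loop (b : Test) (c : Cmd)

def IntExp.val (σ : Store) : IntExp → ℕ
  | const n => n
  | var x => σ.int x
  | plus u v => u.val σ + v.val σ
  | minus u v => u.val σ - v.val σ

def IntExp.cost : IntExp → ℕ
  | const _ => 1
  | var _ => 1
  | plus u v => u.cost + v.cost + 1
  | minus u v => u.cost + v.cost + 1

noncomputable def RealExp.val (σ : Store) : RealExp → ℝ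
  | ofInt u => (u.val σ : ℝ)
  | var x => σ.real x
  | elem a u => σ.arr a (u.val σ)
  | plus u v => u.val σ + v.val σ
  | minus u v => u.val σ - v.val σ
  | times u v => u.val σ * v.val σ
  | quot u v => u.val σ / v.val σ
  | log u => Real.log (u.val σ)

/-- The expression can be evaluated. -/
def RealExp.Defined (σ : Store) : RealExp → Prop
  | ofInt _ => True
  | var _ => True
  | elem _ _ => True
  | plus u v => u.Defined σ ∧ v.Defined σ
  | minus u v => u.Defined σ ∧ v.Defined σ
  | times u v => u.Defined σ ∧ v.Defined σ
  | quot u v => u.Defined σ ∧ v.Defined σ ∧ v.val σ ≠ 0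
  | log u => u.Defined σ ∧ 0 < u.val σ

def RealExp.cost : RealExp → ℕ
  | ofInt u => u.cost + 1
  | var _ => 1
  | elem _ u => u.cost + 1
  | plus u v => u.cost + v.cost + 1
  | minus u v => u.cost + v.cost + 1
  | times u v => u.cost + v.cost + 1
  | quot u v => u.cost + v.cost + 1
  | log u => u.cost + 1

def Test.Holds (σ : Store) : Test → Prop
  | intLe u v => u.val σ ≤ v.val σ
  | realLe u v => u.val σ ≤ v.val σ
  | neg b => ¬ b.Holds σ
  | both b c => b.Holds σ ∧ c.Holds σ

def Test.Defined (σ : Store) : Test → Prop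
  | intLe _ _ => True
  | realLe u v => u.Defined σ ∧ v.Defined σ
  | neg b => b.Defined σ
  | both b c => b.Defined σ ∧ c.Defined σ

def Test.cost : Test → ℕ
  | intLe u v => u.cost + v.cost + 1
  | realLe u v => u.cost + v.cost + 1
  | neg b => b.cost + 1
  | both b c => b.cost + c.cost + 1

def Store.setInt (σ : Store) (x n : ℕ) : Store :=
  { σ with int := Function.update σ.int x n }

noncomputable def Store.setReal (σ : Store) (x : ℕ) (r : ℝ) : Store :=
  { σ with real := Function.update σ.real x r }

noncomputable def Store.setElem (σ : Store) (a i : ℕ) (r : ℝ) : Store :=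
  { σ with arr := Function.update σ.arr a (Function.update (σ.arr a) i r) }

/-- `Exec c σ t σ'`: started in `σ`, the command `c` halts in `σ'` at total cost `t`. -/
inductive Exec : Cmd → Store → ℕ → Store → Prop
  | skip (σ : Store) : Exec Cmd.skip σ 1 σ
  | setInt (σ : Store) (x : ℕ) (u : IntExp) :
      Exec (Cmd.setInt x u) σ (u.cost + 1) (σ.setInt x (u.val σ))
  | setReal (σ : Store) (x : ℕ) (u : RealExp) :
      u.Defined σ → Exec (Cmd.setReal x u) σ (u.cost + 1) (σ.setReal x (u.val σ))
  | setElem (σ : Store) (a : ℕ) (i : IntExp) (u : RealExp) :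
      u.Defined σ →
      Exec (Cmd.setElem a i u) σ (i.cost + u.cost + 1) (σ.setElem a (i.val σ) (u.val σ))
  | seq {c c' : Cmd} {σ σ' σ'' : Store} {t t' : ℕ} :
      Exec c σ t σ' → Exec c' σ' t' σ'' → Exec (Cmd.seq c c') σ (t + t') σ''
  | ite_true {b : Test} {c c' : Cmd} {σ σ' : Store} {t : ℕ} :
      b.Defined σ → b.Holds σ → Exec c σ t σ' → Exec (Cmd.ite b c c') σ (b.cost + t + 1) σ'
  | ite_false {b : Test} {c c' : Cmd} {σ σ' : Store} {t : ℕ} :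
      b.Defined σ → ¬ b.Holds σ → Exec c' σ t σ' → Exec (Cmd.ite b c c') σ (b.cost + t + 1) σ'
  | loop_true {b : Test} {c : Cmd} {σ σ' σ'' : Store} {t t' : ℕ} :
      b.Defined σ → b.Holds σ → Exec c σ t σ' → Exec (Cmd.loop b c) σ' t' σ'' →
      Exec (Cmd.loop b c) σ (b.cost + t + t' + 1) σ''
  | loop_false {b : Test} {c : Cmd} {σ : Store} :
      b.Defined σ → ¬ b.Holds σ → Exec (Cmd.loop b c) σ (b.cost + 1) σ

/-- The input convention: integer variables 0 and 1 hold `d₁` and `dₒ`, real variable 0 holds the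
precision `ε`, and entry `b₁ dₒ + z` of array `b₂` holds `𝒩(z | b₁, b₂)`. All other memory is
arbitrary. -/
def Encodes {d₁ dₒ : ℕ} (N : MAC (Fin d₁) (Fin 2) (Fin dₒ)) (ε : ℝ) (σ : Store) : Prop :=
  σ.int 0 = d₁ ∧ σ.int 1 = dₒ ∧ σ.real 0 = ε ∧
  ∀ (b₁ : Fin d₁) (b₂ : Fin 2) (z : Fin dₒ), σ.arr b₂ (b₁ * dₒ + z) = N.prob b₁ b₂ z

/-- The output convention: integer variable 2 holds the number of iterations of the while loop that
were made, arrays 2 and 3 hold the iterates, in the order in which they were generated, and the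
values of the objective computed there, and real variable 1 holds the value returned. They have to
come from a completed execution of the modified Piyavskii–Shubert algorithm with threshold `ε / 2`,
where the objective `I*` is replaced by numerical values `f` with error at most `τ`, and roots are
found up to a residual `η`; the two errors use up at most the other half of `ε`. -/
def OutputsRun {d₁ dₒ : ℕ} (N : MAC (Fin d₁) (Fin 2) (Fin dₒ)) (ε : ℝ) (σ : Store) : Prop :=
  ∃ (f : ℝ → ℝ) (τ η : ℝ) (st : PSState),
    0 ≤ τ ∧ 0 ≤ η ∧ τ + η ≤ ε / 2 ∧
    (∀ s ∈ Set.Icc (0 : ℝ) 1, |f s - N.objective s| ≤ τ) ∧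
    PSReaches f N.modulus η (ε / 2) (σ.int 2) st ∧
    ¬ st.Running f (ε / 2) ∧
    (∀ (i : ℕ) (hi : i < st.pts.length), σ.arr 2 i = st.pts[i] ∧ σ.arr 3 i = f st.pts[i]) ∧
    σ.real 1 = f st.cur

end RAM

/-! ### Shannon entropy in terms of `Real.negMulLog` -/

/-! The first claim rests on the continuity estimate I*(s) ≤ I*(t) + β_I(2|s - t|) on [0, 1]
(`MAC.objective_le_add_modulus`). For fixed p the information is an output entropy minus a
conditional entropy that is affine in s. The affine term moves by at most |s - t| times the maximal
output entropy. The two output distributions share mass 1 - |s - t|, so they have a coupling whose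
coordinates differ with probability at most |s - t|, and Fano's inequality bounds the change of
entropy (`sum_negMulLog_sub_le`).

Each bounding function therefore dominates I* and increases away from its base point, so the largest
intersection value dominates the maximum; stopping with a gap of at most ε is correct up to ε.
Conversely, F_i(s) - I*(s) ≤ 2 β_I(2|s - x_i|). If 2 β_I(2δ) ≤ ε, a new point with gap above ε is
farther than δ from both neighbours, and the unit interval has room for at most 1/δ + 1 such points
(`PSReaches.invariant`, `List.mul_le_one_of_separated`). With h(x) ≤ 2√(x(1 - x)) and slope at most
μ/2, one may take for δ the solution of μδ + 2√(δ(1 - δ)) = ε/2, and then 1/δ is the fraction inside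
the ceiling of K (`iterationBound_aux`). Rationalizing its denominator gives the asymptotic claim
(`iterationBound_le`).

The analysis of the loop tolerates an error τ in the objective and η in the roots, so it also covers
the program. There I* is computed by the Frank–Wolfe method over input letters. Every output
distribution is first mixed with a little of the uniform one; this costs little by the same
continuity estimate and bounds the curvature of the entropy (`frankWolfe_gap`,
`MAC.abs_approxObjective_sub_le`). Roots are found by scanning a grid: since the modulus is
subadditive, F_i - F_{i+1} cannot jump over the tolerance band (`rootBlock_spec`). The cost is
controlled syntactically: if each execution of each loop makes at most W iterations, a fixed program
costs at most a polynomial in W (`Cmd.exists_costBound_le`), and a W polynomial in d₁, dₒ and 1/ε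
suffices. -/

theorem shannonEntropy_eq_div {α : Type} [Fintype α] (p : α → ℝ) :
    shannonEntropy p = (∑ a, Real.negMulLog (p a)) / Real.log 2 := by
  unfold shannonEntropy Real.negMulLog Real.logb
  rw [Finset.sum_div, ← Finset.sum_neg_distrib]
  exact Finset.sum_congr rfl fun a _ => by ring

/-- Gibbs' inequality. -/
theorem sum_negMulLog_le_cross {α : Type*} [Fintype α] (p q : α → ℝ) (hp : ∀ a, 0 ≤ p a)
    (hq : ∀ a, 0 ≤ q a) (hpq : ∀ a, q a = 0 → p a = 0) (h : ∑ a, q a ≤ ∑ a, p a) :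
    ∑ a, Real.negMulLog (p a) ≤ -∑ a, p a * Real.log (q a) := by
  have key : ∀ a, Real.negMulLog (p a) + p a * Real.log (q a) ≤ q a - p a := by
    intro a
    rcases (hp a).eq_or_lt with h0 | h0
    · simpa [← h0] using hq a
    · have hq0 : 0 < q a := lt_of_le_of_ne (hq a) fun h => h0.ne' (hpq a h.symm)
      have h1 := Real.log_le_sub_one_of_pos (div_pos hq0 h0)
      rw [Real.log_div hq0.ne' h0.ne'] at h1
      have h2 := mul_le_mul_of_nonneg_left h1 h0.le
      have h3 : p a * (q a / p a - 1) = q a - p a := by field_simp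
      unfold Real.negMulLog
      linarith
  have h1 := Finset.sum_le_sum fun a (_ : a ∈ Finset.univ) => key a
  rw [Finset.sum_add_distrib, Finset.sum_sub_distrib] at h1
  linarith

theorem sum_negMulLog_le_log_card {α : Type*} [Fintype α] [Nonempty α] (p : α → ℝ)
    (hp : ∀ a, 0 ≤ p a) (h1 : ∑ a, p a = 1) :
    ∑ a, Real.negMulLog (p a) ≤ Real.log (Fintype.card α) := by
  have hc : (0 : ℝ) < Fintype.card α := by exact_mod_cast Fintype.card_pos
  have := sum_negMulLog_le_cross p (fun _ => (Fintype.card α : ℝ)⁻¹) hp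
    (fun _ => (inv_pos.2 hc).le) (fun _ h => absurd h (inv_pos.2 hc).ne')
    (by rw [h1]; simp [hc.ne'])
  rw [← Finset.sum_mul, h1, Real.log_inv] at this
  linarith

theorem sum_negMulLog_nonneg {α : Type*} [Fintype α] (p : α → ℝ)
    (hp : ∀ a, 0 ≤ p a) (h1 : ∑ a, p a = 1) : 0 ≤ ∑ a, Real.negMulLog (p a) :=
  Finset.sum_nonneg fun a _ => Real.negMulLog_nonneg (hp a)
    (h1 ▸ Finset.single_le_sum (fun b _ => hp b) (Finset.mem_univ a))

theorem shannonEntropy_nonneg {α : Type} [Fintype α] (p : α → ℝ)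
    (hp : ∀ a, 0 ≤ p a) (h1 : ∑ a, p a = 1) : 0 ≤ shannonEntropy p := by
  rw [shannonEntropy_eq_div]
  exact div_nonneg (sum_negMulLog_nonneg p hp h1) (Real.log_nonneg one_le_two)

theorem shannonEntropy_le_logb {α : Type} [Fintype α] [Nonempty α] (p : α → ℝ)
    (hp : ∀ a, 0 ≤ p a) (h1 : ∑ a, p a = 1) :
    shannonEntropy p ≤ Real.logb 2 (Fintype.card α) := by
  rw [shannonEntropy_eq_div, Real.logb]
  exact div_le_div_of_nonneg_right (sum_negMulLog_le_log_card p hp h1)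
    (Real.log_nonneg one_le_two)

/-- Merging outcomes does not increase entropy. -/
theorem negMulLog_sum_le {α : Type*} [Fintype α] (w : α → ℝ) (hw : ∀ a, 0 ≤ w a) :
    Real.negMulLog (∑ a, w a) ≤ ∑ a, Real.negMulLog (w a) := by
  unfold Real.negMulLog
  rw [← Finset.sum_neg_distrib, Finset.sum_mul]
  refine Finset.sum_le_sum fun a _ => ?_
  rcases (hw a).eq_or_lt with h0 | h0
  · simp [← h0]
  · have := Real.log_le_log h0 (Finset.single_le_sum (fun b _ => hw b) (Finset.mem_univ a))
    nlinarith

/-! ### The modified binary entropy -/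

theorem modifiedBinaryEntropy_eq (x : ℝ) : modifiedBinaryEntropy x =
    if x ≤ 1 / 2 then Real.binEntropy x / Real.log 2 else 1 := by
  unfold modifiedBinaryEntropy
  split_ifs
  · rw [Real.binEntropy_eq_negMulLog_add_negMulLog_one_sub]
    unfold Real.negMulLog Real.logb
    ring
  · exact Real.logb_self_eq_one one_lt_two

theorem modifiedBinaryEntropy_zero : modifiedBinaryEntropy 0 = 0 := by
  simp [modifiedBinaryEntropy]

/-- Since h(1/2) = 1, freezing the value beyond 1/2 is the same as truncating the argument.
Continuity and monotonicity are then inherited from `Real.binEntropy`. -/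
theorem modifiedBinaryEntropy_eq_min (x : ℝ) :
    modifiedBinaryEntropy x = Real.binEntropy (min x 2⁻¹) / Real.log 2 := by
  have : Real.log 2 ≠ 0 := (Real.log_pos one_lt_two).ne'
  rw [modifiedBinaryEntropy_eq]
  split_ifs with h
  · rw [min_eq_left (by norm_num at h ⊢; exact h)]
  · rw [min_eq_right (by norm_num at h ⊢; exact h.le), Real.binEntropy_two_inv, div_self this]

theorem continuous_modifiedBinaryEntropy : Continuous modifiedBinaryEntropy := by
  have : modifiedBinaryEntropy = fun x => Real.binEntropy (min x 2⁻¹) / Real.log 2 :=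
    funext modifiedBinaryEntropy_eq_min
  rw [this]
  exact (Real.binEntropy_continuous.comp (continuous_id.min continuous_const)).div_const _

theorem modifiedBinaryEntropy_monotoneOn : MonotoneOn modifiedBinaryEntropy (Set.Ici 0) := by
  intro x hx y hy hxy
  rw [modifiedBinaryEntropy_eq_min, modifiedBinaryEntropy_eq_min]
  refine div_le_div_of_nonneg_right ?_ (Real.log_nonneg one_le_two)
  refine Real.binEntropy_strictMonoOn.monotoneOn ⟨?_, min_le_right _ _⟩ ⟨?_, min_le_right _ _⟩
    (min_le_min_right _ hxy)
  · exact le_min hx (by norm_num)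
  · exact le_min hy (by norm_num)

/-- The difference of the two sides is concave on [0, 1/2], with second derivative -1/y + 1/(1 - y)
≤ 0, and vanishes at both ends. This sign makes the ratio in `binEntropy_sq_le` monotone. -/
theorem negMulLog_one_sub_le {x : ℝ} (h0 : 0 ≤ x) (h1 : x ≤ 1 / 2) :
    Real.negMulLog (1 - x) ≤ Real.negMulLog x := by
  set g : ℝ → ℝ := fun x => Real.negMulLog x - Real.negMulLog (1 - x) with hg
  have hd : ∀ y ∈ Set.Ioo (0 : ℝ) (1 / 2),
      HasDerivAt g (-Real.log y - 1 - Real.log (1 - y) - 1) y := by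
    intro y hy
    have h2 := hy.1.ne'
    have h3 : 1 - y ≠ 0 := by linarith [hy.2]
    have h4 : HasDerivAt g (-Real.log y - 1 - (-Real.log (1 - y) - 1) * -1) y :=
      (Real.hasDerivAt_negMulLog h2).sub ((Real.hasDerivAt_negMulLog h3).comp y
        ((hasDerivAt_id y).const_sub 1))
    exact h4.congr_deriv (by ring)
  have hd2 : ∀ y ∈ Set.Ioo (0 : ℝ) (1 / 2), HasDerivAt (deriv g) (-y⁻¹ + (1 - y)⁻¹) y := by
    intro y hy
    have h2 := hy.1.ne'
    have h3 : 1 - y ≠ 0 := by linarith [hy.2]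
    have h4 : HasDerivAt (fun y => -Real.log y - 1 - Real.log (1 - y) - 1)
        (-y⁻¹ - (1 - y)⁻¹ * -1) y :=
      ((((Real.hasDerivAt_log h2).neg.sub_const 1).sub
        ((Real.hasDerivAt_log h3).comp y ((hasDerivAt_id y).const_sub 1))).sub_const 1)
    refine (h4.congr_deriv (by ring)).congr_of_eventuallyEq ?_
    filter_upwards [isOpen_Ioo.mem_nhds hy] with z hz using (hd z hz).deriv
  have hconc : ConcaveOn ℝ (Set.Icc 0 (1 / 2)) g := by
    refine concaveOn_of_deriv2_nonpos (convex_Icc _ _) ?_ ?_ ?_ ?_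
    · exact (Real.continuous_negMulLog.sub
        (Real.continuous_negMulLog.comp (continuous_const.sub continuous_id))).continuousOn
    all_goals rw [interior_Icc]
    · exact fun y hy => (hd y hy).differentiableAt.differentiableWithinAt
    · exact fun y hy => (hd2 y hy).differentiableAt.differentiableWithinAt
    · intro y hy
      simp only [Function.iterate_succ, Function.iterate_zero, Function.comp, id]
      rw [(hd2 y hy).deriv]
      have : (1 - y)⁻¹ ≤ y⁻¹ := inv_anti₀ hy.1 (by linarith [hy.2])
      linarith
  have e0 : g 0 = 0 := by simp [hg]
  have e1 : g (1 / 2) = 0 := by simp only [hg]; norm_num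
  have h2 := hconc.2 (Set.left_mem_Icc.2 (by norm_num)) (Set.right_mem_Icc.2 (by norm_num))
    (by linarith : 0 ≤ 1 - 2 * x) (by linarith : 0 ≤ 2 * x) (by ring)
-- linarith) (by linarith) (by ring)
  rw [e0, e1] at h2
  simp only [smul_eq_mul, mul_zero, zero_add, add_zero] at h2
  have : 2 * x * (1 / 2) = x := by ring
  rw [this] at h2
  simp only [hg] at h2
  linarith

/-- The ratio h(y)² / (y(1 - y)) increases up to y = 1/2, where it equals 4 log² 2: the numerator of
its derivative collapses to h(y) (`negMulLog` y - `negMulLog` (1 - y)). Working on [x, 1/2] avoids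
the singularity at 0. -/
theorem binEntropy_sq_le {x : ℝ} (h0 : 0 ≤ x) (h1 : x ≤ 1 / 2) :
    Real.binEntropy x ^ 2 ≤ 4 * Real.log 2 ^ 2 * (x * (1 - x)) := by
  rcases h0.eq_or_lt with rfl | hpos
  · simp
  set g : ℝ → ℝ := fun y => Real.binEntropy y ^ 2 / (y * (1 - y)) with hg
  have hmono : MonotoneOn g (Set.Icc x (1 / 2)) := by
    have hder : ∀ y ∈ Set.Icc x (1 / 2), HasDerivAt g
        ((2 * Real.binEntropy y * (Real.log (1 - y) - Real.log y) * (y * (1 - y))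
          - Real.binEntropy y ^ 2 * (1 - 2 * y)) / (y * (1 - y)) ^ 2) y := by
      intro y hy
      have hy0 : y ≠ 0 := (hpos.trans_le hy.1).ne'
      have hy1 : 1 - y ≠ 0 := by linarith [hy.2]
      have h2 := ((Real.hasDerivAt_binEntropy hy0 (by intro h; apply hy1; linarith)).pow 2).div
        ((hasDerivAt_id y).mul ((hasDerivAt_id y).const_sub 1)) (mul_ne_zero hy0 hy1)
      refine HasDerivAt.congr_deriv (f := g) h2 ?_
      simp only [id, Pi.mul_apply, Pi.pow_apply]
      congr 1
      push_cast
      ring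
    refine monotoneOn_of_deriv_nonneg (convex_Icc _ _)
      (fun y hy => (hder y hy).continuousAt.continuousWithinAt)
      (fun y hy => (hder y (interior_subset hy)).differentiableAt.differentiableWithinAt) ?_
    intro y hy
    have hy := interior_subset hy
    rw [(hder y hy).deriv]
    refine div_nonneg ?_ (sq_nonneg _)
    have hy0 : 0 < y := hpos.trans_le hy.1
    have hb : 0 ≤ Real.binEntropy y := Real.binEntropy_nonneg hy0.le (by linarith [hy.2])
    have hn := negMulLog_one_sub_le hy0.le hy.2
    have : 2 * Real.binEntropy y * (Real.log (1 - y) - Real.log y) * (y * (1 - y))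
        - Real.binEntropy y ^ 2 * (1 - 2 * y)
        = Real.binEntropy y * (Real.negMulLog y - Real.negMulLog (1 - y)) := by
      have e := Real.binEntropy_eq_negMulLog_add_negMulLog_one_sub y
      rw [pow_two, mul_assoc 2, mul_assoc 2, mul_assoc (Real.binEntropy y),
        mul_assoc (Real.binEntropy y), mul_left_comm, ← mul_sub]
      congr 1
      rw [e]
      unfold Real.negMulLog
      ring
    rw [this]
    exact mul_nonneg hb (by linarith)
  have h2 := hmono (Set.left_mem_Icc.2 h1) (Set.right_mem_Icc.2 h1) h1
  have e1 : g (1 / 2) = 4 * Real.log 2 ^ 2 := by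
    have : Real.binEntropy (1 / 2) = Real.log 2 := by
      rw [one_div]; exact Real.binEntropy_two_inv
    simp only [hg, this]
    ring
  rw [e1] at h2
  have hx : 0 < x * (1 - x) := mul_pos hpos (by linarith)
  exact (div_le_iff₀ hx).1 h2

theorem modifiedBinaryEntropy_le_two_sqrt {x : ℝ} (h0 : 0 ≤ x) (h1 : x ≤ 1 / 2) :
    modifiedBinaryEntropy x ≤ 2 * √(x * (1 - x)) := by
  have hl : 0 < Real.log 2 := Real.log_pos one_lt_two
  rw [modifiedBinaryEntropy_eq, if_pos h1, div_le_iff₀ hl]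
  have hx : 0 ≤ x * (1 - x) := mul_nonneg h0 (by linarith)
  refine abs_le_of_sq_le_sq' ?_ (by positivity) |>.2
  have := binEntropy_sq_le h0 h1
  rw [mul_pow, mul_pow, Real.sq_sqrt hx]
  linarith

theorem modifiedBinaryEntropy_le_sqrt {x : ℝ} (h0 : 0 ≤ x) (h1 : x ≤ 1 / 2) :
    modifiedBinaryEntropy x ≤ 2 * √x := by
  refine (modifiedBinaryEntropy_le_two_sqrt h0 h1).trans ?_
  have : √(x * (1 - x)) ≤ √x := Real.sqrt_le_sqrt (by nlinarith)
  linarith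

/-! ### The continuity bound for the entropy -/

/-- Fano's inequality for a coupling: H(P) - H(Q) ≤ H(W) - H(Q), which is the entropy of the first
coordinate given the second, and that is small because the coordinates rarely differ. The common
part R never has to be moved. -/
theorem sum_negMulLog_sub_le {Z : Type*} [Fintype Z] (hZ : 2 ≤ Fintype.card Z)
    (R A B : Z → ℝ) (δ : ℝ) (hδ0 : 0 ≤ δ) (hδ1 : δ ≤ 1) (hR : ∀ z, 0 ≤ R z) (hA : ∀ z, 0 ≤ A z)
    (hB : ∀ z, 0 ≤ B z) (hR1 : ∑ z, R z = 1 - δ) (hA1 : ∑ z, A z = 1) (hB1 : ∑ z, B z = 1) :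
    ∑ z, Real.negMulLog (R z + δ * A z) - ∑ z, Real.negMulLog (R z + δ * B z)
      ≤ δ * Real.log ((Fintype.card Z : ℝ) - 1) + Real.log 2 * modifiedBinaryEntropy δ := by
  classical
  have hl2 : 0 < Real.log 2 := Real.log_pos one_lt_two
  have hd : (1 : ℝ) ≤ (Fintype.card Z : ℝ) - 1 := by
    have : (2 : ℝ) ≤ Fintype.card Z := by exact_mod_cast hZ
    linarith
  have hd0 : (0 : ℝ) < (Fintype.card Z : ℝ) - 1 := by linarith
  have hld : 0 ≤ Real.log ((Fintype.card Z : ℝ) - 1) := Real.log_nonneg hd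
  rcases hδ0.eq_or_lt with rfl | hpos
  · simp [modifiedBinaryEntropy_zero]
  set Q : Z → ℝ := fun z => R z + δ * B z with hQ
  have hQ0 : ∀ z, 0 ≤ Q z := fun z => add_nonneg (hR z) (mul_nonneg hδ0 (hB z))
  have hQ1 : ∑ z, Q z = 1 := by
    simp only [hQ, Finset.sum_add_distrib, ← Finset.mul_sum, hR1, hB1]; ring
  -- The coupling keeps the shared mass R on the diagonal and couples the remaining mass δ
  -- independently. Its marginals are R + δA and Q = R + δB, and its off-diagonal mass e is at most
  -- δ.
  set W : Z × Z → ℝ := fun x => (if x.1 = x.2 then R x.1 else 0) + δ * (A x.1 * B x.2) with hW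
  have hW0 : ∀ x, 0 ≤ W x := fun x => add_nonneg (by split_ifs; exacts [hR _, le_rfl])
    (mul_nonneg hδ0 (mul_nonneg (hA _) (hB _)))
  have hW1 : ∀ z, ∑ y, W (z, y) = R z + δ * A z := by
    intro z
    simp [hW, Finset.sum_add_distrib, ← Finset.mul_sum, hB1]
  have hW2 : ∀ y, ∑ z, W (z, y) = Q y := by
    intro y
    simp [hW, hQ, Finset.sum_add_distrib, ← Finset.mul_sum, ← Finset.sum_mul, hA1]
  have hWtot : ∑ x, W x = 1 := by
    rw [Fintype.sum_prod_type_right]; simp only [hW2, hQ1]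
  set e : ℝ := ∑ x : Z × Z, if x.1 = x.2 then 0 else W x with he
  have heδ : e ≤ δ := by
    have : ∀ x : Z × Z, (if x.1 = x.2 then 0 else W x) ≤ δ * (A x.1 * B x.2) := by
      intro x
      split_ifs with h
      · exact mul_nonneg hδ0 (mul_nonneg (hA _) (hB _))
      · simp [hW, h]
    refine (Finset.sum_le_sum fun x _ => this x).trans ?_
    rw [← Finset.mul_sum, Fintype.sum_prod_type]
    simp [← Finset.mul_sum, hA1, hB1]
  have hee : ∑ x : Z × Z, (if x.1 = x.2 then W x else 0) = 1 - e := by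
    rw [← hWtot, he, ← Finset.sum_sub_distrib]
    exact Finset.sum_congr rfl fun x _ => by split_ifs <;> ring
  have he0 : 0 ≤ e := Finset.sum_nonneg fun x _ => by split_ifs; exacts [le_rfl, hW0 x]
  have key : ∀ θ : ℝ, 0 < θ → θ < 1 →
      ∑ z, Real.negMulLog (R z + δ * A z) - ∑ z, Real.negMulLog (Q z) ≤
        -((1 - e) * Real.log (1 - θ)) - e * Real.log θ
          + e * Real.log ((Fintype.card Z : ℝ) - 1) := by
    intro θ h0 h1
    have h1' : 0 < 1 - θ := by linarith
    -- Guess for the conditional law of the first coordinate: it equals the second with probability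
    -- 1 - θ and is otherwise uniform on the other letters. Gibbs' inequality against Q·V yields
    -- Fano's bound with a free parameter θ.
    set V : Z × Z → ℝ := fun x => if x.1 = x.2 then 1 - θ else θ / ((Fintype.card Z : ℝ) - 1)
      with hV
    have hV0 : ∀ x, 0 < V x := fun x => by simp only [hV]; split_ifs; exacts [h1', div_pos h0 hd0]
    have hV1 : ∀ y, ∑ z, V (z, y) = 1 := by
      intro y
      have : ∀ z, V (z, y) = (if z = y then 1 - θ - θ / ((Fintype.card Z : ℝ) - 1) else 0)
          + θ / ((Fintype.card Z : ℝ) - 1) := by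
        intro z; simp only [hV]; split_ifs <;> ring
      simp only [this, Finset.sum_add_distrib, Finset.sum_ite_eq', Finset.mem_univ, if_true,
        Finset.sum_const, Finset.card_univ, nsmul_eq_mul]
      field_simp
      ring
    have hg := sum_negMulLog_le_cross W (fun x => Q x.2 * V x) hW0
      (fun x => mul_nonneg (hQ0 _) (hV0 x).le)
      (fun x hx => by
        rcases mul_eq_zero.1 hx with h | h
        · rw [← hW2 x.2] at h
          exact (Finset.sum_eq_zero_iff_of_nonneg fun z _ => hW0 (z, x.2)).1 h x.1
            (Finset.mem_univ _)
        · exact absurd h (hV0 x).ne')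
      (by
        rw [hWtot, Fintype.sum_prod_type_right]
        simp only [← Finset.mul_sum, hV1, mul_one, hQ1, le_refl])
    have hP : ∑ z, Real.negMulLog (R z + δ * A z) ≤ ∑ x, Real.negMulLog (W x) := by
      rw [Fintype.sum_prod_type]
      refine Finset.sum_le_sum fun z _ => ?_
      rw [← hW1 z]
      exact negMulLog_sum_le _ fun y => hW0 _
    have hsplit : ∀ x, W x * Real.log (Q x.2 * V x)
        = W x * Real.log (Q x.2) + W x * Real.log (V x) := by
      intro x
      rcases (hQ0 x.2).eq_or_lt with h | h
      · have : W x = 0 := by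
          rw [← hW2 x.2] at h
          exact (Finset.sum_eq_zero_iff_of_nonneg fun z _ => hW0 (z, x.2)).1 h.symm x.1
            (Finset.mem_univ _)
        simp [this]
      · rw [Real.log_mul h.ne' (hV0 x).ne', mul_add]
    have hQs : ∑ x, W x * Real.log (Q x.2) = -∑ z, Real.negMulLog (Q z) := by
      rw [Fintype.sum_prod_type_right, ← Finset.sum_neg_distrib]
      refine Finset.sum_congr rfl fun y _ => ?_
      have := Finset.sum_mul Finset.univ (fun z => W (z, y)) (Real.log (Q y))
      rw [hW2] at this
      rw [← this]
      unfold Real.negMulLog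
      ring
    have hVs : ∑ x, W x * Real.log (V x) = (1 - e) * Real.log (1 - θ)
        + e * (Real.log θ - Real.log ((Fintype.card Z : ℝ) - 1)) := by
      rw [← hee, he, Finset.sum_mul, Finset.sum_mul, ← Finset.sum_add_distrib,
        ← Real.log_div h0.ne' hd0.ne']
      refine Finset.sum_congr rfl fun x _ => ?_
      simp only [hV]
      split_ifs <;> ring
    simp only [hsplit, Finset.sum_add_distrib, hQs, hVs] at hg
    linarith
  have h3 : e * Real.log ((Fintype.card Z : ℝ) - 1) ≤ δ * Real.log ((Fintype.card Z : ℝ) - 1) :=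
    mul_le_mul_of_nonneg_right heδ hld
  rw [modifiedBinaryEntropy_eq]
  split_ifs with hh
  -- For θ = δ ≤ 1/2 the bound is affine in e with slope at least log(1 - θ) - log θ ≥ 0, so e may
  -- be replaced by the larger δ.
  · have h1 := key δ hpos (by linarith)
    have h4 : Real.log δ ≤ Real.log (1 - δ) := Real.log_le_log hpos (by linarith)
    have h5 : Real.log 2 * (Real.binEntropy δ / Real.log 2)
        = -(δ * Real.log δ) - (1 - δ) * Real.log (1 - δ) := by
      rw [mul_div_cancel₀ _ hl2.ne', Real.binEntropy_eq_negMulLog_add_negMulLog_one_sub]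
      unfold Real.negMulLog
      ring
    rw [h5]
    nlinarith
  -- Beyond 1/2 the choice θ = 1/2 makes the binary part exactly log 2, whatever e is.
  · have h1 := key (1 / 2) (by norm_num) (by norm_num)
    have h5 : Real.log (1 / 2) = -Real.log 2 := by rw [one_div, Real.log_inv]
    have h6 : (1 : ℝ) - 1 / 2 = 1 / 2 := by norm_num
    rw [h6, h5] at h1
    linarith

/-! ### Mutual information of a channel with a binary second input -/

namespace MAC

/-- The output distribution for the first input `b` and the second input distribution
`(s, 1 - s)`. -/
def mixedOutput {B₁ Z : Type} [Fintype Z] (N : MAC B₁ (Fin 2) Z) (s : ℝ) (b : B₁) (z : Z) : ℝ :=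
  s * N.prob b 0 z + (1 - s) * N.prob b 1 z

/-- The average entropy of the channel for the first input `b` and the second input distribution
`(s, 1 - s)`. -/
noncomputable def mixedEntropy {B₁ Z : Type} [Fintype Z] (N : MAC B₁ (Fin 2) Z) (s : ℝ) (b : B₁) :
    ℝ :=
  s * shannonEntropy (N.prob b 0) + (1 - s) * shannonEntropy (N.prob b 1)

/-- The slope of the linear part of the modulus. -/
noncomputable def slope {B₁ B₂ Z : Type} [Fintype B₁] [Fintype B₂] [Fintype Z]
    (N : MAC B₁ B₂ Z) : ℝ :=
  1 / 2 * Real.logb 2 ((Fintype.card Z : ℝ) - 1) + N.maxOutputEntropy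

theorem mixedOutput_nonneg {B₁ Z : Type} [Fintype Z] (N : MAC B₁ (Fin 2) Z) {s : ℝ}
    (hs : s ∈ Set.Icc (0 : ℝ) 1) (b : B₁) (z : Z) : 0 ≤ N.mixedOutput s b z :=
  add_nonneg (mul_nonneg hs.1 (N.prob_nonneg _ _ _))
    (mul_nonneg (sub_nonneg.2 hs.2) (N.prob_nonneg _ _ _))

theorem sum_mixedOutput {B₁ Z : Type} [Fintype Z] (N : MAC B₁ (Fin 2) Z) (s : ℝ) (b : B₁) :
    ∑ z, N.mixedOutput s b z = 1 := by
  simp only [mixedOutput, Finset.sum_add_distrib, ← Finset.mul_sum, N.sum_prob]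
  ring

theorem nonempty_output {B₁ B₂ Z : Type} [Fintype Z] (N : MAC B₁ B₂ Z) (b₁ : B₁) (b₂ : B₂) :
    Nonempty Z := by
  by_contra h
  rw [not_nonempty_iff] at h
  simpa using N.sum_prob b₁ b₂

theorem entropy_nonneg {B₁ B₂ Z : Type} [Fintype Z] (N : MAC B₁ B₂ Z) (b₁ : B₁) (b₂ : B₂) :
    0 ≤ shannonEntropy (N.prob b₁ b₂) :=
  shannonEntropy_nonneg _ (N.prob_nonneg _ _) (N.sum_prob _ _)

theorem mixedEntropy_nonneg {B₁ Z : Type} [Fintype Z] (N : MAC B₁ (Fin 2) Z) {s : ℝ}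
    (hs : s ∈ Set.Icc (0 : ℝ) 1) (b : B₁) : 0 ≤ N.mixedEntropy s b :=
  add_nonneg (mul_nonneg hs.1 (N.entropy_nonneg _ _))
    (mul_nonneg (sub_nonneg.2 hs.2) (N.entropy_nonneg _ _))

variable {B₁ B₂ Z : Type} [Fintype B₁] [Fintype B₂] [Fintype Z]

/-- The chain rule H(B₁, B₂, Z) = H(B₁, B₂) + H(Z | B₁, B₂). The product rule for `Real.negMulLog`
also holds at zero factors, so nothing is assumed of p and q. -/
theorem info_eq_entropy_sub (N : MAC B₁ B₂ Z) (p : B₁ → ℝ) (q : B₂ → ℝ) :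
    N.info p q = shannonEntropy (fun z => ∑ x : B₁ × B₂, p x.1 * q x.2 * N.prob x.1 x.2 z)
      - ∑ x : B₁ × B₂, p x.1 * q x.2 * shannonEntropy (N.prob x.1 x.2) := by
  unfold info mutualInformation
  simp only [shannonEntropy_eq_div]
  have h1 : ∀ x : B₁ × B₂, ∑ z, p x.1 * q x.2 * N.prob x.1 x.2 z = p x.1 * q x.2 := by
    intro x
    rw [← Finset.mul_sum, N.sum_prob, mul_one]
  have h2 : ∑ y : (B₁ × B₂) × Z, Real.negMulLog (p y.1.1 * q y.1.2 * N.prob y.1.1 y.1.2 y.2)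
      = ∑ x : B₁ × B₂, Real.negMulLog (p x.1 * q x.2)
        + ∑ x : B₁ × B₂, p x.1 * q x.2 * ∑ z, Real.negMulLog (N.prob x.1 x.2 z) := by
    rw [Fintype.sum_prod_type, ← Finset.sum_add_distrib]
    refine Finset.sum_congr rfl fun x _ => ?_
    simp only [Real.negMulLog_mul (p x.1 * q x.2)]
    rw [Finset.sum_add_distrib, ← Finset.sum_mul, ← Finset.mul_sum, N.sum_prob, one_mul]
  simp only [h1, h2]
  simp only [← mul_div_assoc, ← Finset.sum_div]
  ring

theorem info_eq (N : MAC B₁ (Fin 2) Z) (p : B₁ → ℝ) (s : ℝ) :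
    N.info p ![s, 1 - s] = shannonEntropy (fun z => ∑ b, p b * N.mixedOutput s b z)
      - ∑ b, p b * N.mixedEntropy s b := by
  rw [info_eq_entropy_sub]
  simp only [Fintype.sum_prod_type, Fin.sum_univ_two, mixedOutput, mixedEntropy]
  congr 1
  · congr 1
    ext z
    refine Finset.sum_congr rfl fun b _ => ?_
    simp
    ring
  · refine Finset.sum_congr rfl fun b _ => ?_
    simp
    ring

/-! ### The objective and the sum capacity as suprema -/

theorem entropy_le_max (N : MAC B₁ B₂ Z) (b₁ : B₁) (b₂ : B₂) :
    shannonEntropy (N.prob b₁ b₂) ≤ N.maxOutputEntropy :=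
  le_ciSup (f := fun b : B₁ × B₂ => shannonEntropy (N.prob b.1 b.2)) (Set.finite_range _).bddAbove
    (b₁, b₂)

theorem info_le (N : MAC B₁ (Fin 2) Z) {s : ℝ} (hs : s ∈ Set.Icc (0 : ℝ) 1) {p : B₁ → ℝ}
    (hp : p ∈ stdSimplex ℝ B₁) : N.info p ![s, 1 - s] ≤ Real.logb 2 (Fintype.card Z) := by
  obtain ⟨b, -, -⟩ : ∃ b ∈ Finset.univ, p b ≠ 0 :=
    Finset.exists_ne_zero_of_sum_ne_zero (by rw [hp.2]; exact one_ne_zero)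
  have := N.nonempty_output b 0
  rw [info_eq]
  have h1 : 0 ≤ ∑ b, p b * N.mixedEntropy s b :=
    Finset.sum_nonneg fun b _ => mul_nonneg (hp.1 b) (N.mixedEntropy_nonneg hs b)
  have h2 := shannonEntropy_le_logb (fun z => ∑ b, p b * N.mixedOutput s b z)
    (fun z => Finset.sum_nonneg fun b _ => mul_nonneg (hp.1 b) (N.mixedOutput_nonneg hs b z))
    (by rw [Finset.sum_comm]; simp only [← Finset.mul_sum, sum_mixedOutput, mul_one, hp.2])
  linarith

/-- The bound by log of the output size is supplied because `sSup` of an unbounded set of reals is a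
default value; with it the objective is a genuine supremum. -/
theorem info_le_objective (N : MAC B₁ (Fin 2) Z) {s : ℝ} (hs : s ∈ Set.Icc (0 : ℝ) 1)
    {p : B₁ → ℝ} (hp : p ∈ stdSimplex ℝ B₁) : N.info p ![s, 1 - s] ≤ N.objective s :=
  le_csSup ⟨Real.logb 2 (Fintype.card Z), by
    rintro _ ⟨p, hp, rfl⟩
    exact N.info_le hs hp⟩ (Set.mem_image_of_mem _ hp)

theorem objective_le [Nonempty B₁] (N : MAC B₁ (Fin 2) Z) {s a : ℝ}
    (h : ∀ p ∈ stdSimplex ℝ B₁, N.info p ![s, 1 - s] ≤ a) : N.objective s ≤ a := by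
  classical
  refine csSup_le ((Set.nonempty_of_mem (single_mem_stdSimplex ℝ (Classical.arbitrary B₁))).image _)
    ?_
  rintro _ ⟨p, hp, rfl⟩
  exact h p hp

theorem objective_le_sumCapacity [Nonempty B₁] (N : MAC B₁ (Fin 2) Z) {s : ℝ}
    (hs : s ∈ Set.Icc (0 : ℝ) 1) : N.objective s ≤ N.sumCapacity := by
  refine N.objective_le fun p hp => le_csSup ⟨Real.logb 2 (Fintype.card Z), ?_⟩
    ⟨p, hp, ![s, 1 - s], ⟨?_, by simp⟩, rfl⟩
  · rintro _ ⟨p, hp, q, hq, rfl⟩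
    have h1 := hq.2
    rw [Fin.sum_univ_two] at h1
    have : q = ![q 0, 1 - q 0] := by
      ext i
      fin_cases i
      · rfl
      · simp; linarith
    rw [this]
    exact N.info_le ⟨hq.1 0, by linarith [hq.1 1]⟩ hp
  · intro i
    fin_cases i
    · exact hs.1
    · simpa using hs.2

/-- A distribution on two letters is (s, 1 - s) for some s in [0, 1]. With
`objective_le_sumCapacity` this identifies the capacity as the supremum of the objective; attainment
is never needed. -/
theorem sumCapacity_le [Nonempty B₁] (N : MAC B₁ (Fin 2) Z) {a : ℝ}
    (h : ∀ s ∈ Set.Icc (0 : ℝ) 1, N.objective s ≤ a) : N.sumCapacity ≤ a := by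
  classical
  refine csSup_le ⟨_, _, single_mem_stdSimplex ℝ (Classical.arbitrary B₁), _,
    single_mem_stdSimplex ℝ (0 : Fin 2), rfl⟩ ?_
  rintro _ ⟨p, hp, q, hq, rfl⟩
  have h1 := hq.2
  rw [Fin.sum_univ_two] at h1
  have h2 : q = ![q 0, 1 - q 0] := by
    ext i
    fin_cases i
    · rfl
    · simp; linarith
  have hs : q 0 ∈ Set.Icc (0 : ℝ) 1 := ⟨hq.1 0, by linarith [hq.1 1]⟩
  rw [h2]
  exact (N.info_le_objective hs hp).trans (h _ hs)

/-! ### The modulus of continuity -/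

theorem modulus_eq (N : MAC B₁ B₂ Z) (x : ℝ) :
    N.modulus x = N.slope * x + modifiedBinaryEntropy (x / 2) := rfl

theorem maxOutputEntropy_nonneg [Nonempty B₁] [Nonempty B₂] (N : MAC B₁ B₂ Z) :
    0 ≤ N.maxOutputEntropy :=
  (N.entropy_nonneg (Classical.arbitrary B₁) (Classical.arbitrary B₂)).trans (N.entropy_le_max _ _)

theorem slope_nonneg [Nonempty B₁] [Nonempty B₂] (N : MAC B₁ B₂ Z) (hZ : 2 ≤ Fintype.card Z) :
    0 ≤ N.slope := by
  have : (2 : ℝ) ≤ Fintype.card Z := by exact_mod_cast hZ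
  have h := Real.logb_nonneg one_lt_two (by linarith : (1 : ℝ) ≤ (Fintype.card Z : ℝ) - 1)
  have := N.maxOutputEntropy_nonneg
  unfold slope
  linarith

/-- Origin of μ: both log(dₒ - 1) and the maximal output entropy are at most log dₒ, and the modulus
is always evaluated at twice a distance. -/
theorem slope_le [Nonempty B₁] [Nonempty B₂] (N : MAC B₁ B₂ Z) (hZ : 2 ≤ Fintype.card Z) :
    N.slope ≤ 3 / 2 * Real.logb 2 (Fintype.card Z) := by
  have h2 : (2 : ℝ) ≤ Fintype.card Z := by exact_mod_cast hZ
  have h := Real.logb_le_logb_of_le one_lt_two (by linarith : (0 : ℝ) < (Fintype.card Z : ℝ) - 1)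
    (by linarith : (Fintype.card Z : ℝ) - 1 ≤ Fintype.card Z)
  have h3 : N.maxOutputEntropy ≤ Real.logb 2 (Fintype.card Z) := by
    refine ciSup_le fun b => ?_
    have := N.nonempty_output b.1 b.2
    exact shannonEntropy_le_logb _ (N.prob_nonneg _ _) (N.sum_prob _ _)
  unfold slope
  linarith

theorem modulus_monotoneOn [Nonempty B₁] [Nonempty B₂] (N : MAC B₁ B₂ Z)
    (hZ : 2 ≤ Fintype.card Z) : MonotoneOn N.modulus (Set.Ici 0) := by
  intro x hx y hy hxy
  have hx' : (0 : ℝ) ≤ x := hx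
  have hy' : (0 : ℝ) ≤ y := hy
  have h1 := mul_le_mul_of_nonneg_left hxy (N.slope_nonneg hZ)
  have h2 := modifiedBinaryEntropy_monotoneOn (Set.mem_Ici.2 (by positivity : 0 ≤ x / 2))
    (Set.mem_Ici.2 (by positivity : 0 ≤ y / 2)) (by linarith)
  rw [modulus_eq, modulus_eq]
  linarith

theorem continuous_modulus (N : MAC B₁ B₂ Z) : Continuous N.modulus :=
  (continuous_const.mul continuous_id).add
    (continuous_modifiedBinaryEntropy.comp (continuous_id.div_const 2))

theorem modulus_zero (N : MAC B₁ B₂ Z) : N.modulus 0 = 0 := by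
  rw [modulus_eq, zero_div, modifiedBinaryEntropy_zero, mul_zero, add_zero]

/-- If t ≤ s, the two mixtures share t times the first output law and 1 - s times the second; the
remaining mass s - t sits on the first law for s and on the second for t. The case s ≤ t swaps the
letters. -/
theorem entropy_mixedOutput_sub_le [Nonempty B₁] (N : MAC B₁ (Fin 2) Z)
    (hZ : 2 ≤ Fintype.card Z) {s t : ℝ} (hs : s ∈ Set.Icc (0 : ℝ) 1) (ht : t ∈ Set.Icc (0 : ℝ) 1)
    {p : B₁ → ℝ} (hp : p ∈ stdSimplex ℝ B₁) :
    shannonEntropy (fun z => ∑ b, p b * N.mixedOutput s b z)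
      - shannonEntropy (fun z => ∑ b, p b * N.mixedOutput t b z)
      ≤ |s - t| * Real.logb 2 ((Fintype.card Z : ℝ) - 1) + modifiedBinaryEntropy |s - t| := by
  have hl : 0 < Real.log 2 := Real.log_pos one_lt_two
  have hA : ∀ (i : Fin 2) z, 0 ≤ ∑ b, p b * N.prob b i z := fun i z =>
    Finset.sum_nonneg fun b _ => mul_nonneg (hp.1 b) (N.prob_nonneg _ _ _)
  have hA1 : ∀ i : Fin 2, ∑ z, ∑ b, p b * N.prob b i z = 1 := fun i => by
    rw [Finset.sum_comm]; simp only [← Finset.mul_sum, N.sum_prob, mul_one, hp.2]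
  have hmix : ∀ (s : ℝ) z, ∑ b, p b * N.mixedOutput s b z
      = s * ∑ b, p b * N.prob b 0 z + (1 - s) * ∑ b, p b * N.prob b 1 z := fun s z => by
    rw [Finset.mul_sum, Finset.mul_sum, ← Finset.sum_add_distrib]
    exact Finset.sum_congr rfl fun b _ => by unfold mixedOutput; ring
  have key : ∀ (i j : Fin 2) (a c : ℝ), 0 ≤ a → 0 ≤ c → a + c = 1 - |s - t| →
      (∀ z, ∑ b, p b * N.mixedOutput s b z = a * ∑ b, p b * N.prob b i z
        + c * ∑ b, p b * N.prob b j z + |s - t| * ∑ b, p b * N.prob b i z) →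
      (∀ z, ∑ b, p b * N.mixedOutput t b z = a * ∑ b, p b * N.prob b i z
        + c * ∑ b, p b * N.prob b j z + |s - t| * ∑ b, p b * N.prob b j z) →
      shannonEntropy (fun z => ∑ b, p b * N.mixedOutput s b z)
      - shannonEntropy (fun z => ∑ b, p b * N.mixedOutput t b z)
      ≤ |s - t| * Real.logb 2 ((Fintype.card Z : ℝ) - 1) + modifiedBinaryEntropy |s - t| := by
    intro i j a c ha hc hac h1 h2
    have h := sum_negMulLog_sub_le hZ (fun z => a * ∑ b, p b * N.prob b i z
      + c * ∑ b, p b * N.prob b j z) (fun z => ∑ b, p b * N.prob b i z)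
      (fun z => ∑ b, p b * N.prob b j z) |s - t| (abs_nonneg _) (by linarith)
      (fun z => add_nonneg (mul_nonneg ha (hA _ _)) (mul_nonneg hc (hA _ _))) (hA i) (hA j)
      (by rw [Finset.sum_add_distrib, ← Finset.mul_sum, ← Finset.mul_sum, hA1, hA1]; linarith)
      (hA1 i) (hA1 j)
    simp only [h1, h2, shannonEntropy_eq_div]
    rw [← sub_div, div_le_iff₀ hl, Real.logb]
    refine h.trans (le_of_eq ?_)
    field_simp
  rcases le_total t s with h | h
  · have habs : |s - t| = s - t := abs_of_nonneg (by linarith)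
    refine key 0 1 t (1 - s) ht.1 (by linarith [hs.2]) (by rw [habs]; ring)
      (fun z => ?_) (fun z => ?_) <;> rw [hmix, habs] <;> ring
  · have habs : |s - t| = t - s := by rw [abs_sub_comm]; exact abs_of_nonneg (by linarith)
    refine key 1 0 (1 - t) s (by linarith [ht.2]) hs.1 (by rw [habs]; ring)
      (fun z => ?_) (fun z => ?_) <;> rw [hmix, habs] <;> ring

/-- For fixed p the output entropy obeys `entropy_mixedOutput_sub_le`, and the conditional entropy
has slope in s at most the maximal output entropy, because the letter entropies lie between 0 and
that maximum. The estimate is uniform in p, so it passes to the supremum. -/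
theorem objective_le_add_modulus [Nonempty B₁] (N : MAC B₁ (Fin 2) Z)
    (hZ : 2 ≤ Fintype.card Z) {s t : ℝ} (hs : s ∈ Set.Icc (0 : ℝ) 1)
    (ht : t ∈ Set.Icc (0 : ℝ) 1) :
    N.objective s ≤ N.objective t + N.modulus (2 * |s - t|) := by
  refine N.objective_le fun p hp => ?_
  have h1 := N.info_le_objective ht hp
  have h2 := N.entropy_mixedOutput_sub_le hZ hs ht hp
  have h3 : ∑ b, p b * N.mixedEntropy t b - ∑ b, p b * N.mixedEntropy s b
      ≤ |s - t| * N.maxOutputEntropy := by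
    rw [← Finset.sum_sub_distrib]
    have : ∀ b, p b * N.mixedEntropy t b - p b * N.mixedEntropy s b
        ≤ p b * (|s - t| * N.maxOutputEntropy) := by
      intro b
      rw [← mul_sub]
      refine mul_le_mul_of_nonneg_left ?_ (hp.1 b)
      have e : N.mixedEntropy t b - N.mixedEntropy s b
          = (s - t) * (shannonEntropy (N.prob b 1) - shannonEntropy (N.prob b 0)) := by
        unfold mixedEntropy; ring
      rw [e]
      refine (le_abs_self _).trans ?_
      rw [abs_mul]
      refine mul_le_mul_of_nonneg_left (abs_le.2 ⟨?_, ?_⟩) (abs_nonneg _) <;>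
      linarith [N.entropy_nonneg b 0, N.entropy_nonneg b 1, N.entropy_le_max b 0,
        N.entropy_le_max b 1]
    refine (Finset.sum_le_sum fun b _ => this b).trans ?_
    rw [← Finset.sum_mul, hp.2, one_mul]
  rw [info_eq] at h1 ⊢
  -- The modulus contains 2|s - t| times the maximal entropy, twice what the estimate needs; this
  -- nonnegative surplus is discarded.
  have h4 : 0 ≤ |s - t| * N.maxOutputEntropy := mul_nonneg (abs_nonneg _) N.maxOutputEntropy_nonneg
  rw [modulus_eq, mul_div_cancel_left₀ _ (two_ne_zero' ℝ), slope]
  nlinarith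

end MAC

/-! ### The modified Piyavskii–Shubert algorithm -/

theorem exists_mem_consecutive_Icc {X : ℕ → ℝ} {s : ℝ} {k : ℕ} (h0 : X 0 ≤ s)
    (h1 : s ≤ X (k + 1)) : ∃ i ≤ k, X i ≤ s ∧ s ≤ X (i + 1) := by
  induction k with
  | zero => exact ⟨0, le_rfl, h0, h1⟩
  | succ k ih =>
    rcases le_total s (X (k + 1)) with h | h
    · obtain ⟨i, hi, h⟩ := ih h
      exact ⟨i, hi.trans k.le_succ, h⟩
    · exact ⟨k + 1, le_rfl, h, h1⟩

theorem List.mul_length_le_of_separated {δ B : ℝ} (a : ℝ) (l : List ℝ)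
    (hl : (a :: l).Pairwise fun x y => x + δ ≤ y) (hB : ∀ x ∈ a :: l, x ≤ B) :
    a + l.length * δ ≤ B := by
  induction l generalizing a with
  | nil => simpa using hB a (by simp)
  | cons b l ih =>
    have h1 := ih b (List.pairwise_cons.1 hl).2 fun x hx => hB x (List.mem_cons_of_mem _ hx)
    have h2 := (List.pairwise_cons.1 hl).1 b (by simp)
    simp only [List.length_cons]
    push_cast
    linarith

/-- At most `1 / δ + 1` points of the unit interval have pairwise distances at least `δ`. -/
theorem List.mul_le_one_of_separated {δ : ℝ} {n : ℕ} (l : List ℝ) (hn : l.length = n + 1)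
    (hl : l.Pairwise fun x y => δ < |x - y|) (h01 : ∀ x ∈ l, x ∈ Set.Icc (0 : ℝ) 1) :
    n * δ ≤ 1 := by
  have hp := List.perm_insertionSort (· ≤ ·) l
  have hs := List.pairwise_insertionSort (· ≤ ·) l
  have hsep : (l.insertionSort (· ≤ ·)).Pairwise fun x y => δ < |x - y| :=
    (hp.pairwise_iff fun {x y} h => by rwa [abs_sub_comm]).2 hl
  have hlen : (l.insertionSort (· ≤ ·)).length = n + 1 := by rw [hp.length_eq, hn]
  have hmem : ∀ x ∈ l.insertionSort (· ≤ ·), x ∈ Set.Icc (0 : ℝ) 1 :=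
    fun x hx => h01 x (hp.mem_iff.1 hx)
  revert hs hsep hlen hmem
  generalize l.insertionSort (· ≤ ·) = l'
  intro hs hsep hlen hmem
  cases l' with
  | nil => simp at hlen
  | cons a t =>
    have h := List.mul_length_le_of_separated (δ := δ) (B := 1) a t
      ((hs.and hsep).imp fun {x y} h => by
        have h2 := h.2
        rw [abs_sub_comm, abs_of_nonneg (sub_nonneg.2 h.1)] at h2
        linarith) fun x hx => (hmem x hx).2
    have h0 := (hmem a (by simp)).1
    have : t.length = n := by simpa using hlen
    rw [this] at h
    linarith

section PiyavskiiShubert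

variable {f g β : ℝ → ℝ} {τ η ε δ : ℝ}

/-- Close to a point where the approximate objective has been evaluated, the bounding function
exceeds the approximate objective by a small amount. -/
theorem boundingFn_sub_le (hβ : MonotoneOn β (Set.Ici 0))
    (hfg : ∀ s ∈ Set.Icc (0 : ℝ) 1, |f s - g s| ≤ τ)
    (hg : ∀ s ∈ Set.Icc (0 : ℝ) 1, ∀ t ∈ Set.Icc (0 : ℝ) 1, g s ≤ g t + β (2 * |s - t|))
    (hδ : 2 * β (2 * δ) + 2 * τ + η ≤ ε) {x r : ℝ} (hx : x ∈ Set.Icc (0 : ℝ) 1)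
    (hr : r ∈ Set.Icc (0 : ℝ) 1) (h : |x - r| ≤ δ) : boundingFn f β x r - f r ≤ ε - η := by
  have h1 := (abs_le.1 (hfg x hx)).2
  have h2 := (abs_le.1 (hfg r hr)).1
  have h3 := hg x hx r hr
  have h4 : β (2 * |x - r|) ≤ β (2 * δ) := hβ (Set.mem_Ici.2 (by positivity))
    (Set.mem_Ici.2 (by linarith [abs_nonneg (x - r)])) (by linarith)
  unfold boundingFn
  rw [abs_sub_comm r x]
  linarith

/-- A point whose gap exceeds the threshold cannot be δ-close to its neighbours. The newest point is
known to be separated only if the test of the loop succeeds there, so the list l omits it and has n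
+ 1 of the n + 2 points. The last clause says that the current bound dominates the true objective up
to τ + η, which makes stopping sound. -/
theorem PSReaches.invariant (hβ : MonotoneOn β (Set.Ici 0))
    (hfg : ∀ s ∈ Set.Icc (0 : ℝ) 1, |f s - g s| ≤ τ)
    (hg : ∀ s ∈ Set.Icc (0 : ℝ) 1, ∀ t ∈ Set.Icc (0 : ℝ) 1, g s ≤ g t + β (2 * |s - t|))
    (hη : 0 ≤ η) (hδ : 2 * β (2 * δ) + 2 * τ + η ≤ ε) {n : ℕ} {st : PSState}
    (h : PSReaches f β η ε n st) :
    (∃ l : List ℝ, st.pts = l ++ [st.cur] ∧ l.length = n + 1 ∧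
      l.Pairwise (fun x y => δ < |x - y|) ∧ (st.Running f ε → ∀ y ∈ l, δ < |y - st.cur|)) ∧
    (∀ x ∈ st.pts, x ∈ Set.Icc (0 : ℝ) 1) ∧ 0 ∈ st.pts ∧ 1 ∈ st.pts ∧
    ∀ s ∈ Set.Icc (0 : ℝ) 1, g s ≤ st.bound st.cur + τ + η := by
  induction h with
  | init =>
    refine ⟨⟨[0], rfl, rfl, by simp, ?_⟩, ?_, by simp [PSState.init], by simp [PSState.init], ?_⟩
    · intro hrun y hy
      obtain rfl : y = 0 := by simpa using hy
      by_contra! hle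
      have := boundingFn_sub_le hβ hfg hg hδ (x := 0) (r := 1) (by simp) (by simp) hle
      have h2 : boundingFn f β 0 1 - f 1 > ε := hrun
      linarith
    · intro x hx
      have : x = 0 ∨ x = 1 := by simpa [PSState.init] using hx
      rcases this with rfl | rfl <;> simp
    · intro s hs
      have h1 := hg s hs 0 (by simp)
      have h2 := (abs_le.1 (hfg 0 (by simp))).1
      have h3 : β (2 * |s - 0|) ≤ β (2 * |1 - 0|) := hβ (Set.mem_Ici.2 (by positivity))
        (Set.mem_Ici.2 (by positivity)) (by rw [sub_zero, abs_of_nonneg hs.1]; simp [hs.2])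
      simp only [PSState.init, boundingFn]
      linarith
  | @step n st st' hreach hstep ih =>
    obtain ⟨⟨l, hpts, hlen, hsep, hcur⟩, h01, hm0, hm1, -⟩ := ih
    obtain ⟨hrun, x, root, m, hm, hperm, hsort, hroot, hmax, rfl⟩ := hstep
    have hx01 : ∀ (i : ℕ) (hi : i < x.length), x[i] ∈ Set.Icc (0 : ℝ) 1 := fun i hi =>
      h01 _ (hperm.mem_iff.1 (List.getElem_mem hi))
    have hr01 : ∀ (i : ℕ) (hi : i + 1 < x.length), root i ∈ Set.Icc (0 : ℝ) 1 := fun i hi =>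
      ⟨(hx01 i (by omega)).1.trans (hroot i hi).1.1, (hroot i hi).1.2.trans (hx01 (i + 1) hi).2⟩
    have hsorted : ∀ (i j : ℕ) (hj : j < x.length) (hij : i ≤ j),
        x[i]'(hij.trans_lt hj) ≤ x[j] := by
      intro i j hj hij
      rcases hij.eq_or_lt with rfl | hij
      · exact le_rfl
      · exact List.pairwise_iff_getElem.1 hsort i j _ _ hij
    refine ⟨⟨st.pts, rfl, by simp [hpts, hlen], ?_, ?_⟩, ?_, by simp [hm0], by simp [hm1], ?_⟩
    -- The former current point joins the separated list: the test just passed was exactly the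
    -- condition for its separation.
    · rw [hpts, List.pairwise_append]
      exact ⟨hsep, by simp, fun a ha b hb => by
        obtain rfl : b = st.cur := by simpa using hb
        exact hcur hrun a ha⟩
    · intro hrun' y hy
      have hrun' : boundingFn f β x[m] (root m) - f (root m) > ε := hrun'
      have hleft : δ < root m - x[m] := by
        by_contra! hle
        have := boundingFn_sub_le hβ hfg hg hδ (hx01 m (by omega)) (hr01 m hm)
          (by rw [abs_sub_comm, abs_of_nonneg (by linarith [(hroot m hm).1.1])]; exact hle)
        linarith
      -- At the right neighbour the small gap is known for F_{m+1}, while the test uses F_m. The two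
      -- differ by up to η at an approximate root, which is why `boundingFn_sub_le` reserves a
      -- margin η.
      have hright : δ < x[m + 1] - root m := by
        by_contra! hle
        have h1 := boundingFn_sub_le hβ hfg hg hδ (hx01 (m + 1) hm) (hr01 m hm)
          (by rw [abs_of_nonneg (by linarith [(hroot m hm).1.2])]; exact hle)
        have h2 := (abs_le.1 (hroot m hm).2).2
        linarith
      obtain ⟨j, hj, rfl⟩ := List.mem_iff_getElem.1 (hperm.mem_iff.2 hy)
      simp only
      rcases Nat.lt_or_ge m j with h | h
      · have := hsorted (m + 1) j hj h
        exact lt_of_lt_of_le (by linarith) (le_abs_self _)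
      · have := hsorted j m (by omega) h
        exact lt_of_lt_of_le (by linarith) (neg_le_abs _)
    · intro y hy
      rcases List.mem_append.1 hy with hy | hy
      · exact h01 y hy
      · obtain rfl : y = root m := by simpa using hy
        exact hr01 m hm
    · intro s hs
      simp only
      obtain ⟨k, hk⟩ : ∃ k, x.length = k + 2 := ⟨x.length - 2, by omega⟩
      -- The end points 0 and 1 remain among the iterates, so the consecutive intervals cover [0,
      -- 1].
      obtain ⟨i0, hi0, e0⟩ := List.mem_iff_getElem.1 (hperm.mem_iff.2 hm0)
      obtain ⟨i1, hi1, e1⟩ := List.mem_iff_getElem.1 (hperm.mem_iff.2 hm1)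
      have hX : ∀ (i : ℕ) (hi : i < x.length), x.getD i 0 = x[i] := fun i hi => by
        simp [List.getD_eq_getElem?_getD, hi]
      obtain ⟨i, hi, hs1, hs2⟩ := exists_mem_consecutive_Icc (X := fun i => x.getD i 0)
        (s := s) (k := k)
        (by
          rw [hX 0 (by omega)]
          exact ((hsorted 0 i0 hi0 (Nat.zero_le _)).trans e0.le).trans hs.1)
        (by
          rw [hX (k + 1) (by omega)]
          exact hs.2.trans (e1.ge.trans (hsorted i1 (k + 1) (by omega) (by omega))))
      have hi' : i + 1 < x.length := by omega
      rw [hX i (by omega)] at hs1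
      rw [hX (i + 1) hi'] at hs2
      have hmi := hmax i hi'
      have hri := hroot i hi'
      have hres := abs_le.1 hri.2
      -- Left of the root, g(s) is bounded through F_i, which increases up to the root; right of it
      -- through F_{i+1}, which decreases from the root on, at the price of the residual η.
      rcases le_total s (root i) with h | h
      · have h1 := hg s hs _ (hx01 i (by omega))
        have h2 := (abs_le.1 (hfg _ (hx01 i (by omega)))).1
        have h3 : β (2 * |s - x[i]|) ≤ β (2 * |root i - x[i]|) := by
          refine hβ (Set.mem_Ici.2 (by positivity)) (Set.mem_Ici.2 (by positivity)) ?_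
          rw [abs_of_nonneg (by linarith), abs_of_nonneg (by linarith)]
          linarith
        unfold boundingFn at hmi ⊢
        linarith
      · have h1 := hg s hs _ (hx01 (i + 1) hi')
        have h2 := (abs_le.1 (hfg _ (hx01 (i + 1) hi'))).1
        have h3 : β (2 * |s - x[i + 1]|) ≤ β (2 * |root i - x[i + 1]|) := by
          refine hβ (Set.mem_Ici.2 (by positivity)) (Set.mem_Ici.2 (by positivity)) ?_
          rw [abs_of_nonpos (by linarith), abs_of_nonpos (by linarith)]
          linarith
        unfold boundingFn at hmi hres ⊢
        linarith

theorem PSReaches.mul_le_one (hβ : MonotoneOn β (Set.Ici 0))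
    (hfg : ∀ s ∈ Set.Icc (0 : ℝ) 1, |f s - g s| ≤ τ)
    (hg : ∀ s ∈ Set.Icc (0 : ℝ) 1, ∀ t ∈ Set.Icc (0 : ℝ) 1, g s ≤ g t + β (2 * |s - t|))
    (hη : 0 ≤ η) (hδ : 2 * β (2 * δ) + 2 * τ + η ≤ ε) {n : ℕ} {st : PSState}
    (h : PSReaches f β η ε n st) : n * δ ≤ 1 := by
  obtain ⟨⟨l, hpts, hlen, hsep, -⟩, h01, -⟩ := h.invariant hβ hfg hg hη hδ
  exact List.mul_le_one_of_separated l hlen hsep fun x hx => h01 x (by simp [hpts, hx])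

/-- When every pair of consecutive points has an admissible root, the loop body can be executed. -/
theorem exists_PSStep {st : PSState} {n : ℕ} (hlen : st.pts.length = n + 2)
    (hrun : st.Running f ε)
    (hroot : ∀ a ∈ st.pts, ∀ b ∈ st.pts, a ≤ b → ∃ r ∈ Set.Icc a b,
      |boundingFn f β a r - boundingFn f β b r| ≤ η) : ∃ st', PSStep f β η ε st st' := by
  have hp := List.perm_insertionSort (· ≤ ·) st.pts
  have hs := List.pairwise_insertionSort (· ≤ ·) st.pts
  set x := st.pts.insertionSort (· ≤ ·) with hx
  have hxl : x.length = n + 2 := by rw [hp.length_eq, hlen]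
  have key : ∀ i : ℕ, ∃ r : ℝ, ∀ hi : i + 1 < x.length, r ∈ Set.Icc x[i] x[i + 1] ∧
      |boundingFn f β x[i] r - boundingFn f β x[i + 1] r| ≤ η := by
    intro i
    by_cases hi : i + 1 < x.length
    · obtain ⟨r, hr⟩ := hroot x[i] (hp.mem_iff.1 (List.getElem_mem _)) x[i + 1]
        (hp.mem_iff.1 (List.getElem_mem _))
        (List.pairwise_iff_getElem.1 hs i (i + 1) _ _ (Nat.lt_succ_self i))
      exact ⟨r, fun _ => hr⟩
    · exact ⟨0, fun h => absurd h hi⟩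
  choose root hroots using key
  obtain ⟨m, hm, hmax⟩ := Finset.exists_max_image (Finset.range (n + 1))
    (fun i => boundingFn f β (x.getD i 0) (root i)) ⟨0, by simp⟩
  have hX : ∀ (i : ℕ) (hi : i < x.length), x.getD i 0 = x[i] := fun i hi => by
    simp [List.getD_eq_getElem?_getD, hi]
  have hm' : m < n + 1 := Finset.mem_range.1 hm
  refine ⟨_, hrun, x, root, m, by omega, hp, hs, fun i hi => hroots i hi, fun i hi => ?_, rfl⟩
  have := hmax i (Finset.mem_range.2 (by omega))
  rwa [hX i (by omega), hX m (by omega)] at this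

end PiyavskiiShubert

/-- What the algorithm returns is close to the sum capacity. -/
theorem MAC.abs_sub_sumCapacity_le {B₁ Z : Type} [Fintype B₁] [Nonempty B₁] [Fintype Z]
    (N : MAC B₁ (Fin 2) Z) (hZ : 2 ≤ Fintype.card Z) {f : ℝ → ℝ} {τ η ε : ℝ}
    (hfg : ∀ s ∈ Set.Icc (0 : ℝ) 1, |f s - N.objective s| ≤ τ) (hη : 0 ≤ η)
    (hε : 2 * τ + η ≤ ε) {n : ℕ} {st : PSState} (h : PSReaches f N.modulus η ε n st)
    (hrun : ¬ st.Running f ε) : |f st.cur - N.sumCapacity| ≤ ε + (τ + η) := by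
  obtain ⟨⟨l, hpts, -⟩, h01, -, -, hS⟩ := h.invariant (δ := 0) (N.modulus_monotoneOn hZ) hfg
    (fun s hs t ht => N.objective_le_add_modulus hZ hs ht) hη
    (by rw [mul_zero, N.modulus_zero]; linarith)
  have hc := h01 st.cur (by simp [hpts])
  have h1 := N.sumCapacity_le hS
  have h2 := N.objective_le_sumCapacity hc
  have h3 := abs_le.1 (hfg _ hc)
  unfold PSState.Running at hrun
  push Not at hrun
  have hτ : 0 ≤ τ := (abs_nonneg _).trans (hfg 0 (by simp))
  rw [abs_le]
  constructor <;> linarith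

/-- Consecutive bounding functions of the exact objective intersect. -/
theorem MAC.exists_boundingFn_eq {B₁ Z : Type} [Fintype B₁] [Nonempty B₁] [Fintype Z]
    (N : MAC B₁ (Fin 2) Z) (hZ : 2 ≤ Fintype.card Z) {a b : ℝ} (ha : a ∈ Set.Icc (0 : ℝ) 1)
    (hb : b ∈ Set.Icc (0 : ℝ) 1) (hab : a ≤ b) : ∃ r ∈ Set.Icc a b,
      |boundingFn N.objective N.modulus a r - boundingFn N.objective N.modulus b r| ≤ 0 := by
  have hcont : ∀ x, Continuous (boundingFn N.objective N.modulus x) := fun x =>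
    continuous_const.add (N.continuous_modulus.comp
      (continuous_const.mul (continuous_id.sub continuous_const).abs))
  have h1 := N.objective_le_add_modulus hZ ha hb
  have h2 := N.objective_le_add_modulus hZ hb ha
  obtain ⟨r, hr, h⟩ := intermediate_value_Icc hab ((hcont a).sub (hcont b)).continuousOn
    (show (0 : ℝ) ∈ Set.Icc _ _ from by
      simp only [Pi.sub_apply, boundingFn, sub_self, abs_zero, mul_zero, N.modulus_zero]
      constructor <;> linarith)
  exact ⟨r, hr, by simp only [Pi.sub_apply] at h; simp [h]⟩

/-! ### The bound on the number of iterations -/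

/-- Squaring ε/2 - μδ = 2√(δ(1 - δ)) gives (μ² + 4)δ² - (εμ + 4)δ + ε²/4 = 0. The δ here is its
smaller root, the one for which squaring can be undone. -/
theorem iterationBound_aux {ε μ : ℝ} (hε : 0 < ε) (h : ε ≤ μ) :
    let δ := ((ε * μ + 4) - √(16 + 8 * ε * μ - 4 * ε ^ 2)) / (2 * (μ ^ 2 + 4))
    0 < δ ∧ δ ≤ 1 / 2 ∧ μ * δ + 2 * √(δ * (1 - δ)) = ε / 2 := by
  intro δ
  have hμ : 0 < μ := hε.trans_le h
  -- The only use of ε ≤ μ besides δ ≤ 1/2 and μ > 0: the square root is real and at least 4.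
  have hB : 16 ≤ 16 + 8 * ε * μ - 4 * ε ^ 2 := by nlinarith
  set r := √(16 + 8 * ε * μ - 4 * ε ^ 2) with hr
  have hr2 : r ^ 2 = 16 + 8 * ε * μ - 4 * ε ^ 2 := Real.sq_sqrt (by linarith)
  have hr4 : 4 ≤ r := Real.le_sqrt_of_sq_le (by linarith)
  have hD : 0 < 2 * (μ ^ 2 + 4) := by positivity
  have hδ : δ * (2 * (μ ^ 2 + 4)) = (ε * μ + 4) - r := div_mul_cancel₀ _ hD.ne'
  have hrlt : r < ε * μ + 4 := by
    refine lt_of_pow_lt_pow_left₀ 2 (by positivity) ?_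
    rw [hr2]
    have : 0 < ε ^ 2 * (μ ^ 2 + 4) := by positivity
    nlinarith
  have hδ0 : 0 < δ := div_pos (by linarith) hD
  have hδ1 : δ ≤ 1 / 2 := (div_le_iff₀ hD).2 (by nlinarith)
  -- This fixes the sign when the square root of (ε/2 - μδ)² is taken.
  have hμδ : μ * δ ≤ ε / 2 := by
    have : μ * (δ * (2 * (μ ^ 2 + 4))) ≤ ε * (μ ^ 2 + 4) := by
      rw [hδ]; nlinarith
    have h2 : 0 < μ ^ 2 + 4 := by positivity
    by_contra! hc
    nlinarith
  have hq : (ε / 2 - μ * δ) ^ 2 = 4 * (δ * (1 - δ)) := by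
    have h1 : (ε * μ + 4 - δ * (2 * (μ ^ 2 + 4))) ^ 2 = 16 + 8 * ε * μ - 4 * ε ^ 2 := by
      rw [hδ, ← hr2]; ring
    have h2 : (μ ^ 2 + 4) * ((ε / 2 - μ * δ) ^ 2 - 4 * (δ * (1 - δ))) = 0 := by linarith
    have h3 : μ ^ 2 + 4 ≠ 0 := by positivity
    linarith [(mul_eq_zero.1 h2).resolve_left h3]
  refine ⟨hδ0, hδ1, ?_⟩
  have hs : √(δ * (1 - δ)) = (ε / 2 - μ * δ) / 2 := by
    rw [show δ * (1 - δ) = ((ε / 2 - μ * δ) / 2) ^ 2 by linarith]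
    exact Real.sqrt_sq (by linarith)
  rw [hs]
  ring

theorem MAC.modulus_le_of_le {B₁ B₂ Z : Type} [Fintype B₁] [Nonempty B₁] [Fintype B₂]
    [Nonempty B₂] [Fintype Z] (N : MAC B₁ B₂ Z) (hZ : 2 ≤ Fintype.card Z) {δ : ℝ} (h0 : 0 ≤ δ)
    (h1 : δ ≤ 1 / 2) :
    N.modulus (2 * δ) ≤ 3 * Real.logb 2 (Fintype.card Z) * δ + 2 * √(δ * (1 - δ)) := by
  have h2 := modifiedBinaryEntropy_le_two_sqrt h0 h1
  have h3 := mul_le_mul_of_nonneg_right (N.slope_le hZ) h0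
  rw [MAC.modulus_eq, mul_div_cancel_left₀ _ (two_ne_zero' ℝ)]
  linarith

/-! ### The exact algorithm, and the growth of its iteration bound -/

theorem exact_algorithm_correct (d₁ dₒ : ℕ) (hd₁ : 2 ≤ d₁) (hdₒ : 2 ≤ dₒ)
    (N : MAC (Fin d₁) (Fin 2) (Fin dₒ)) (ε : ℝ) (hε : 0 < ε) (hε' : ε ≤ 3 * Real.logb 2 dₒ)
    (n : ℕ) (st : PSState) (h : PSReaches N.objective N.modulus 0 ε n st) :
    n ≤ iterationBound ε dₒ ∧
    (st.Running N.objective ε → ∃ st' : PSState, PSStep N.objective N.modulus 0 ε st st') ∧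
    (¬ st.Running N.objective ε → |N.objective st.cur - N.sumCapacity| ≤ ε) := by
  have : Nonempty (Fin d₁) := ⟨⟨0, by omega⟩⟩
  have hZ : 2 ≤ Fintype.card (Fin dₒ) := by simpa using hdₒ
  have hfg : ∀ s ∈ Set.Icc (0 : ℝ) 1, |N.objective s - N.objective s| ≤ 0 := by simp
  have hmod := fun s hs t ht => N.objective_le_add_modulus hZ (s := s) (t := t) hs ht
  refine ⟨?_, fun hrun => ?_, fun hrun => ?_⟩
  · obtain ⟨hδ0, hδ1, heq⟩ := iterationBound_aux hε hε'
    set δ := ((ε * (3 * Real.logb 2 dₒ) + 4)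
      - √(16 + 8 * ε * (3 * Real.logb 2 dₒ) - 4 * ε ^ 2))
        / (2 * ((3 * Real.logb 2 dₒ) ^ 2 + 4)) with hδ
    have h1 := N.modulus_le_of_le hZ hδ0.le hδ1
    rw [Fintype.card_fin, heq] at h1
    have h2 := h.mul_le_one (N.modulus_monotoneOn hZ) hfg hmod le_rfl (δ := δ) (by linarith)
    unfold iterationBound
    refine Nat.cast_le.1 (le_trans ?_ (Nat.le_ceil _))
    -- The quantity under the ceiling is exactly 1/δ.
    rw [← inv_div, ← hδ, ← one_div]
    exact (le_div_iff₀ hδ0).2 h2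
  -- Only the number and the location of the points matter here, so the invariant is used with δ =
  -- 0, where its condition on the modulus is trivial.
  · obtain ⟨⟨l, hpts, hlen, -⟩, h01, -⟩ := h.invariant (N.modulus_monotoneOn hZ) hfg hmod le_rfl
      (δ := 0) (by rw [mul_zero, N.modulus_zero]; linarith)
    exact exists_PSStep (n := n) (by simp [hpts, hlen]) hrun
      fun a ha b hb hab => N.exists_boundingFn_eq hZ (h01 a ha) (h01 b hb) hab
  · simpa using N.abs_sub_sumCapacity_le hZ hfg le_rfl (by linarith) h hrun

/-- Since (εμ + 4)² - r² = ε²(μ² + 4), the fraction equals 2(εμ + 4 + r)/ε². For εμ ≥ 4 it is at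
most 8μ/ε, because r ≤ εμ + 4. The ceiling adds at most 1 ≤ μ/ε, and 9μ = 27 log dₒ. -/
theorem iterationBound_le : ∃ C : ℝ, ∀ ε : ℝ, 0 < ε → ε ≤ 3 → ∃ D : ℕ, ∀ dₒ : ℕ, D ≤ dₒ →
    (iterationBound ε dₒ : ℝ) ≤ C * (Real.logb 2 dₒ / ε) := by
  refine ⟨27, fun ε hε hε3 => ?_⟩
  have htend : Filter.Tendsto (fun n : ℕ => Real.logb 2 n) Filter.atTop Filter.atTop :=
    (Real.tendsto_logb_atTop one_lt_two).comp tendsto_natCast_atTop_atTop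
  -- The summand 4/(3ε) ensures εμ ≥ 4, and the summand 1 ensures μ ≥ 3 ≥ ε.
  obtain ⟨D, hD⟩ := Filter.eventually_atTop.1 (htend.eventually_ge_atTop (4 / (3 * ε) + 1))
  refine ⟨D, fun dₒ hd => ?_⟩
  have hL := hD dₒ hd
  set μ := 3 * Real.logb 2 dₒ with hμ
  have hμ3 : 3 ≤ μ := by
    have : 0 < 4 / (3 * ε) := by positivity
    linarith
  have hεμ : 4 ≤ ε * μ := by
    have h1 : 4 / (3 * ε) ≤ Real.logb 2 dₒ := by linarith
    rw [div_le_iff₀ (by positivity)] at h1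
    linarith
  obtain ⟨hδ0, -, -⟩ := iterationBound_aux hε (hε3.trans hμ3)
  set r := √(16 + 8 * ε * μ - 4 * ε ^ 2) with hr
  have hμ0 : 0 < μ := by linarith
  have hr2 : r ^ 2 = 16 + 8 * ε * μ - 4 * ε ^ 2 := Real.sq_sqrt (by nlinarith)
  have hpos : 0 < ε * μ + 4 - r := by
    by_contra! hc
    exact absurd hδ0 (not_lt.2 (div_nonpos_of_nonpos_of_nonneg hc (by positivity)))
  have hval : 2 * (μ ^ 2 + 4) / (ε * μ + 4 - r) = 2 * (ε * μ + 4 + r) / ε ^ 2 := by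
    rw [div_eq_div_iff hpos.ne' (by positivity)]
    nlinarith
  have hle : 2 * (μ ^ 2 + 4) / (ε * μ + 4 - r) ≤ 8 * (μ / ε) := by
    rw [hval, div_le_iff₀ (by positivity)]
    have : 8 * (μ / ε) * ε ^ 2 = 8 * (ε * μ) := by field_simp
    rw [this]
    linarith
  have hone : 1 ≤ μ / ε := (one_le_div hε).2 (by linarith)
  have hceil : (iterationBound ε dₒ : ℝ) ≤ 2 * (μ ^ 2 + 4) / (ε * μ + 4 - r) + 1 :=
    (Nat.ceil_lt_add_one (div_nonneg (by positivity) hpos.le)).le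
  have : 27 * (Real.logb 2 dₒ / ε) = 9 * (μ / ε) := by rw [hμ]; ring
  rw [this]
  linarith

/-! ### The Frank–Wolfe method for an entropy minus a linear function -/

/-- First-order expansion of the entropy at P towards Q. From log x ≤ x - 1 the second-order loss is
at most γ² (∑ Q²/P - 1), and ∑ Q²/P ≤ 1/κ because P ≥ κ and Q ≤ 1. The lower bound κ is the reason
for smoothing. -/
theorem frankWolfe_step {Z : Type*} [Fintype Z] {P Q : Z → ℝ} {κ γ : ℝ} (hκ : 0 < κ)
    (hP : ∀ z, κ ≤ P z) (hQ : ∀ z, κ ≤ Q z) (hP1 : ∑ z, P z = 1) (hQ1 : ∑ z, Q z = 1)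
    (hγ0 : 0 ≤ γ) (hγ1 : γ ≤ 1) :
    (1 - γ) * ∑ z, Real.negMulLog (P z) + γ * -∑ z, Q z * Real.log (P z) - γ ^ 2 / κ
      ≤ ∑ z, Real.negMulLog ((1 - γ) * P z + γ * Q z) := by
  have key : ∀ z, (1 - γ) * Real.negMulLog (P z) + γ * -(Q z * Real.log (P z))
      - (γ * (Q z - P z) + γ ^ 2 * (Q z / κ - 2 * Q z + P z))
      ≤ Real.negMulLog ((1 - γ) * P z + γ * Q z) := by
    intro z
    have hp := hκ.trans_le (hP z)
    have hq := hκ.trans_le (hQ z)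
    have hq1 : Q z ≤ 1 := hQ1 ▸ Finset.single_le_sum (fun y _ => (hκ.trans_le (hQ y)).le)
      (Finset.mem_univ z)
    set p' := (1 - γ) * P z + γ * Q z with hp'
    have hpos : 0 < p' := by
      have : κ ≤ p' := by
        have := mul_le_mul_of_nonneg_left (hP z) (sub_nonneg.2 hγ1)
        have := mul_le_mul_of_nonneg_left (hQ z) hγ0
        linarith
      linarith
    have h1 := Real.log_le_sub_one_of_pos (div_pos hpos hp)
    rw [Real.log_div hpos.ne' hp.ne'] at h1
    have h2 := mul_le_mul_of_nonneg_left h1 hpos.le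
    have h3 : p' * (p' / P z - 1)
        = γ * (Q z - P z) + γ ^ 2 * (Q z * Q z / P z - 2 * Q z + P z) := by
      rw [hp']; field_simp; ring
    have h4 : Q z * Q z / P z ≤ Q z / κ := by
      rw [div_le_div_iff₀ hp hκ]
      have := mul_le_mul hq1 (hP z) hκ.le one_pos.le
      nlinarith
    have h5 := mul_le_mul_of_nonneg_left h4 (sq_nonneg γ)
    have h6 : p' * Real.log (P z) = (1 - γ) * (P z * Real.log (P z))
        + γ * (Q z * Real.log (P z)) := by rw [hp']; ring
    unfold Real.negMulLog
    nlinarith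
  have h := Finset.sum_le_sum fun z (_ : z ∈ Finset.univ) => key z
  simp only [Finset.sum_add_distrib, Finset.sum_sub_distrib, ← Finset.mul_sum, ← Finset.sum_div,
    Finset.sum_neg_distrib, hP1, hQ1] at h
  have e : γ ^ 2 / κ = γ ^ 2 * (1 / κ) := by ring
  rw [e]
  nlinarith [sq_nonneg γ]

/-- With step size γ = 2/(k + 2) the gap satisfies gap_{k+1} ≤ (1 - γ) gap_k + γ²/κ. The linear
subproblem over the simplex is solved at a vertex, so each iteration only selects a letter. The
representation by some p shows that the value found is attained and not merely an upper bound. -/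
theorem frankWolfe_gap {B Z : Type*} [Fintype B] [Fintype Z] (Q : B → Z → ℝ) (c : B → ℝ) {κ : ℝ}
    (hκ : 0 < κ) (hQ : ∀ b z, κ ≤ Q b z) (hQ1 : ∀ b, ∑ z, Q b z = 1) (P : ℕ → Z → ℝ) (C : ℕ → ℝ)
    (b : ℕ → B) (hP : ∀ z, κ ≤ P 0 z) (hP1 : ∑ z, P 0 z = 1)
    (hPs : ∀ k z, P (k + 1) z = (1 - 2 / ((k : ℝ) + 2)) * P k z + 2 / ((k : ℝ) + 2) * Q (b k) z)
    (hCs : ∀ k, C (k + 1) = (1 - 2 / ((k : ℝ) + 2)) * C k + 2 / ((k : ℝ) + 2) * c (b k))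
    (hb : ∀ k b', -c b' - ∑ z, Q b' z * Real.log (P k z)
      ≤ -c (b k) - ∑ z, Q (b k) z * Real.log (P k z)) (k : ℕ) :
    (∃ p ∈ stdSimplex ℝ B, (∀ z, P (k + 1) z = ∑ b, p b * Q b z) ∧ C (k + 1) = ∑ b, p b * c b) ∧
    ∀ p ∈ stdSimplex ℝ B, ∑ z, Real.negMulLog (∑ b, p b * Q b z) - ∑ b, p b * c b
      ≤ ∑ z, Real.negMulLog (P (k + 1) z) - C (k + 1) + 4 / (κ * (k + 3)) := by
  classical
  have hγ : ∀ k : ℕ, 0 ≤ 2 / ((k : ℝ) + 2) ∧ 2 / ((k : ℝ) + 2) ≤ 1 := fun k =>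
    ⟨by positivity, (div_le_one (by positivity)).2 (by linarith [Nat.cast_nonneg (α := ℝ) k])⟩
  have hpos : ∀ k, (∀ z, κ ≤ P k z) ∧ ∑ z, P k z = 1 := by
    intro k
    induction k with
    | zero => exact ⟨hP, hP1⟩
    | succ k ih =>
      refine ⟨fun z => ?_, ?_⟩
      · rw [hPs]
        have := mul_le_mul_of_nonneg_left (ih.1 z) (sub_nonneg.2 (hγ k).2)
        have := mul_le_mul_of_nonneg_left (hQ (b k) z) (hγ k).1
        linarith
      · simp only [hPs, Finset.sum_add_distrib, ← Finset.mul_sum, ih.2, hQ1]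
        ring
  have hstep : ∀ k, ∀ p ∈ stdSimplex ℝ B,
      ∑ z, Real.negMulLog (∑ b, p b * Q b z) - ∑ b, p b * c b
        - (∑ z, Real.negMulLog (P (k + 1) z) - C (k + 1))
      ≤ (1 - 2 / ((k : ℝ) + 2)) * (∑ z, Real.negMulLog (∑ b, p b * Q b z) - ∑ b, p b * c b
        - (∑ z, Real.negMulLog (P k z) - C k)) + (2 / ((k : ℝ) + 2)) ^ 2 / κ := by
    intro k p hp
    have hPk := hpos k
    have h1 := frankWolfe_step hκ hPk.1 (hQ (b k)) hPk.2 (hQ1 (b k)) (hγ k).1 (hγ k).2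
    simp only [← hPs] at h1
    -- Gibbs' inequality replaces concavity: the linearization at P k lies above the entropy of
    -- every competitor.
    have hcross := sum_negMulLog_le_cross (fun z => ∑ b, p b * Q b z) (P k)
      (fun z => Finset.sum_nonneg fun b _ => mul_nonneg (hp.1 b) (hκ.trans_le (hQ b z)).le)
      (fun z => (hκ.trans_le (hPk.1 z)).le)
      (fun z h => absurd h (hκ.trans_le (hPk.1 z)).ne')
      (by rw [Finset.sum_comm]; simp only [← Finset.mul_sum, hQ1, mul_one, hp.2, hPk.2, le_refl])
    have hlin : -∑ z, (∑ b, p b * Q b z) * Real.log (P k z) - ∑ b, p b * c b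
        ≤ -c (b k) - ∑ z, Q (b k) z * Real.log (P k z) := by
      have e : -∑ z, (∑ b, p b * Q b z) * Real.log (P k z) - ∑ b, p b * c b
          = ∑ b, p b * (-c b - ∑ z, Q b z * Real.log (P k z)) := by
        simp only [Finset.sum_mul, mul_sub, Finset.sum_sub_distrib, mul_neg,
          Finset.sum_neg_distrib, Finset.mul_sum]
        rw [Finset.sum_comm]
        simp only [mul_assoc]
        ring
      rw [e]
      refine (Finset.sum_le_sum fun b' _ => mul_le_mul_of_nonneg_left (hb k b') (hp.1 b')).trans ?_
      rw [← Finset.sum_mul, hp.2, one_mul]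
    have hJ : ∑ z, Real.negMulLog (∑ b, p b * Q b z) - ∑ b, p b * c b
        ≤ -c (b k) - ∑ z, Q (b k) z * Real.log (P k z) := by linarith
    have h2 := mul_le_mul_of_nonneg_left hJ (hγ k).1
    rw [hCs]
    linarith
  -- The first step size is 1, so the starting point, which need not come from any input
  -- distribution, is forgotten. Hence the statement begins at index k + 1.
  have hrep : ∃ p ∈ stdSimplex ℝ B, (∀ z, P (k + 1) z = ∑ b, p b * Q b z) ∧
      C (k + 1) = ∑ b, p b * c b := by
    induction k with
    | zero =>
      refine ⟨Pi.single (b 0) 1, single_mem_stdSimplex ℝ (b 0), fun z => ?_, ?_⟩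
      · rw [hPs]; simp [Pi.single_apply]
      · rw [hCs]; simp [Pi.single_apply]
    | succ k ih =>
      obtain ⟨p, hp, h1, h2⟩ := ih
      refine ⟨(1 - 2 / (((k + 1 : ℕ) : ℝ) + 2)) • p
        + (2 / (((k + 1 : ℕ) : ℝ) + 2)) • Pi.single (b (k + 1)) 1,
        convex_stdSimplex ℝ B hp (single_mem_stdSimplex ℝ (b (k + 1)))
          (sub_nonneg.2 (hγ _).2) (hγ _).1 (by ring), fun z => ?_, ?_⟩
      · rw [hPs, h1]
        simp [add_mul, Finset.sum_add_distrib, Finset.mul_sum, mul_assoc, Pi.single_apply]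
      · rw [hCs, h2]
        simp [add_mul, Finset.sum_add_distrib, Finset.mul_sum, mul_assoc, Pi.single_apply]
  refine ⟨hrep, fun p hp => ?_⟩
  have hgap : ∑ z, Real.negMulLog (∑ b, p b * Q b z) - ∑ b, p b * c b
      - (∑ z, Real.negMulLog (P (k + 1) z) - C (k + 1)) ≤ 4 / (κ * (k + 3)) := by
    clear hrep
    induction k with
    | zero =>
      have := hstep 0 p hp
      norm_num at this ⊢
      have h2 : κ⁻¹ ≤ 4 / (κ * 3) := by
        rw [inv_eq_one_div, div_le_div_iff₀ hκ (by positivity)]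
        linarith
      linarith
    | succ k ih =>
      refine (hstep (k + 1) p hp).trans ?_
      have h1 := mul_le_mul_of_nonneg_left ih (sub_nonneg.2 (hγ (k + 1)).2)
      refine (add_le_add_left h1 _).trans ?_
      push_cast
      have hk : (0 : ℝ) ≤ k := Nat.cast_nonneg k
      have e : (1 - 2 / ((k : ℝ) + 1 + 2)) * (4 / (κ * (k + 3))) + (2 / ((k : ℝ) + 1 + 2)) ^ 2 / κ
          = 4 * (k + 2) / (κ * (k + 3) ^ 2) := by
        have h1 : (k : ℝ) + 1 + 2 = k + 3 := by ring
        rw [h1]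
        field_simp
        ring
      -- The induction closes because (k + 2)(k + 4) ≤ (k + 3)².
      rw [e, div_le_div_iff₀ (by positivity) (by positivity)]
      have : 0 < κ * 4 := by positivity
      nlinarith
  linarith

/-! ### A numerical approximation of the objective -/

/-- The first index below `n` at which `v` is largest. -/
noncomputable def firstArgmax (v : ℕ → ℝ) : ℕ → ℕ
  | 0 => 0
  | n + 1 => if v (firstArgmax v n) < v n then n else firstArgmax v n

theorem firstArgmax_lt (v : ℕ → ℝ) {n : ℕ} (hn : 0 < n) : firstArgmax v n < n := by
  induction n with
  | zero => omega
  | succ n ih =>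
    rw [firstArgmax]
    split_ifs
    · omega
    · rcases Nat.eq_zero_or_pos n with rfl | h
      · simp [firstArgmax]
      · exact (ih h).trans (Nat.lt_succ_self n)

theorem le_firstArgmax (v : ℕ → ℝ) {n k : ℕ} (hk : k < n) : v k ≤ v (firstArgmax v n) := by
  induction n with
  | zero => omega
  | succ n ih =>
    rw [firstArgmax]
    rcases Nat.lt_succ_iff_lt_or_eq.1 hk with h | rfl
    · have := ih h
      split_ifs <;> linarith
    · split_ifs <;> linarith

namespace MAC

variable {d₁ dₒ : ℕ} (N : MAC (Fin d₁) (Fin 2) (Fin dₒ))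

/-- The transition probabilities, indexed by natural numbers. -/
noncomputable def entry (i : Fin 2) (b z : ℕ) : ℝ :=
  if h : b < d₁ ∧ z < dₒ then N.prob ⟨b, h.1⟩ i ⟨z, h.2⟩ else 0

/-- The output entropies, indexed by natural numbers. -/
noncomputable def entropyAt (i : Fin 2) (b : ℕ) : ℝ :=
  if h : b < d₁ then shannonEntropy (N.prob ⟨b, h⟩ i) else 0

theorem entry_fin (i : Fin 2) (b : Fin d₁) (z : Fin dₒ) : N.entry i b z = N.prob b i z := by
  simp [entry]

theorem entropyAt_fin (i : Fin 2) (b : Fin d₁) :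
    N.entropyAt i b = shannonEntropy (N.prob b i) := by
  simp [entropyAt]

theorem entry_nonneg (i : Fin 2) (b z : ℕ) : 0 ≤ N.entry i b z := by
  unfold entry
  split_ifs
  exacts [N.prob_nonneg _ _ _, le_rfl]

/-- The output distribution for the first input `b`, mixed with the uniform distribution. -/
noncomputable def smoothOutput (lam s : ℝ) (b z : ℕ) : ℝ :=
  (1 - lam) * (s * N.entry 0 b z + (1 - s) * N.entry 1 b z) + lam / dₒ

/-- The conditional entropy for the first input `b`. -/
noncomputable def inputCost (s : ℝ) (b : ℕ) : ℝ :=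
  s * N.entropyAt 0 b + (1 - s) * N.entropyAt 1 b

/-- The partial derivative, in the direction of the letter `b`, that steers the method. -/
noncomputable def score (lam s : ℝ) (P : ℕ → ℝ) (b : ℕ) : ℝ :=
  -N.inputCost s b
    - ∑ z ∈ Finset.range dₒ, N.smoothOutput lam s b z * Real.log (P z) / Real.log 2

/-- The output distribution and the conditional entropy after `k` iterations of the Frank–Wolfe
method. -/
noncomputable def frankWolfe (lam s : ℝ) : ℕ → (ℕ → ℝ) × ℝ
  | 0 => (fun _ => 1 / (dₒ : ℝ), 0)
  | k + 1 =>
    let x := frankWolfe lam s k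
    let b := firstArgmax (N.score lam s x.1) d₁
    (fun z => (1 - 2 / ((k : ℝ) + 2)) * x.1 z + 2 / ((k : ℝ) + 2) * N.smoothOutput lam s b z,
      (1 - 2 / ((k : ℝ) + 2)) * x.2 + 2 / ((k : ℝ) + 2) * N.inputCost s b)

/-- The value of the objective found by `T` iterations of the Frank–Wolfe method. -/
noncomputable def approxObjective (lam : ℝ) (T : ℕ) (s : ℝ) : ℝ :=
  -(N.frankWolfe lam s T).2 - ∑ z ∈ Finset.range dₒ,
    (N.frankWolfe lam s T).1 z * Real.log ((N.frankWolfe lam s T).1 z) / Real.log 2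

theorem smoothOutput_fin (lam s : ℝ) (b : Fin d₁) (z : Fin dₒ) :
    N.smoothOutput lam s b z = (1 - lam) * N.mixedOutput s b z + lam / dₒ := by
  simp [smoothOutput, entry_fin, mixedOutput]

theorem inputCost_fin (s : ℝ) (b : Fin d₁) : N.inputCost s b = N.mixedEntropy s b := by
  simp [inputCost, entropyAt_fin, mixedEntropy]

theorem div_le_smoothOutput {lam s : ℝ} (h1 : lam ≤ 1) (hs : s ∈ Set.Icc (0 : ℝ) 1) (b z : ℕ) :
    lam / dₒ ≤ N.smoothOutput lam s b z := by
  have := mul_nonneg (sub_nonneg.2 h1) (add_nonneg (mul_nonneg hs.1 (N.entry_nonneg 0 b z))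
    (mul_nonneg (sub_nonneg.2 hs.2) (N.entry_nonneg 1 b z)))
  unfold smoothOutput
  linarith

theorem div_le_frankWolfe {lam s : ℝ} (h1 : lam ≤ 1)
    (hs : s ∈ Set.Icc (0 : ℝ) 1) (k z : ℕ) : lam / dₒ ≤ (N.frankWolfe lam s k).1 z := by
  induction k with
  | zero => exact div_le_div_of_nonneg_right h1 (Nat.cast_nonneg _)
  | succ k ih =>
    have hγ : 2 / ((k : ℝ) + 2) ≤ 1 :=
      (div_le_one (by positivity)).2 (by linarith [Nat.cast_nonneg (α := ℝ) k])
    have hγ0 : 0 ≤ 2 / ((k : ℝ) + 2) := by positivity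
    have e1 := mul_le_mul_of_nonneg_left ih (sub_nonneg.2 hγ)
    have e2 := mul_le_mul_of_nonneg_left (N.div_le_smoothOutput h1 hs
      (firstArgmax (N.score lam s (N.frankWolfe lam s k).1) d₁) z) hγ0
    simp only [frankWolfe]
    linarith

/-- P and its smoothed version share (1 - lam) P and differ in how the mass lam is spread, so the
continuity bound applies in both directions. -/
theorem abs_entropy_smooth_sub_le (hdₒ : 2 ≤ dₒ) {P : Fin dₒ → ℝ} (hP : ∀ z, 0 ≤ P z)
    (hP1 : ∑ z, P z = 1) {lam : ℝ} (h0 : 0 ≤ lam) (h1 : lam ≤ 1) :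
    |shannonEntropy (fun z => (1 - lam) * P z + lam / dₒ) - shannonEntropy P|
      ≤ lam * Real.logb 2 ((dₒ : ℝ) - 1) + modifiedBinaryEntropy lam := by
  have hl : 0 < Real.log 2 := Real.log_pos one_lt_two
  have hd : (0 : ℝ) < dₒ := by exact_mod_cast (by omega : 0 < dₒ)
  have hZ : 2 ≤ Fintype.card (Fin dₒ) := by simpa using hdₒ
  have hR : ∀ z, 0 ≤ (1 - lam) * P z := fun z => mul_nonneg (sub_nonneg.2 h1) (hP z)
  have hR1 : ∑ z, (1 - lam) * P z = 1 - lam := by rw [← Finset.mul_sum, hP1, mul_one]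
  have hU : ∀ z : Fin dₒ, 0 ≤ 1 / (dₒ : ℝ) := fun _ => by positivity
  have hU1 : ∑ _z : Fin dₒ, 1 / (dₒ : ℝ) = 1 := by simp [hd.ne']
  have a1 := sum_negMulLog_sub_le hZ _ _ P lam h0 h1 hR hU hP hR1 hU1 hP1
  have a2 := sum_negMulLog_sub_le hZ _ P _ lam h0 h1 hR hP hU hR1 hP1 hU1
  have e1 : ∀ z, (1 - lam) * P z + lam * P z = P z := fun z => by ring
  have e2 : ∀ z, (1 - lam) * P z + lam * (1 / (dₒ : ℝ)) = (1 - lam) * P z + lam / dₒ :=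
    fun z => by ring
  simp only [e1, e2, Fintype.card_fin] at a1 a2
  simp only [shannonEntropy_eq_div]
  rw [← sub_div, abs_div, abs_of_pos hl, div_le_iff₀ hl, Real.logb]
  have e3 : (lam * (Real.log ((dₒ : ℝ) - 1) / Real.log 2) + modifiedBinaryEntropy lam) * Real.log 2
      = lam * Real.log ((dₒ : ℝ) - 1) + Real.log 2 * modifiedBinaryEntropy lam := by
    field_simp
  rw [e3, abs_le]
  constructor <;> linarith

/-- The first two terms are the smoothing error. The last is the Frank–Wolfe gap with κ = lam/dₒ, a
lower bound for all smoothed probabilities, converted to bits. -/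
theorem abs_approxObjective_sub_le (hd₁ : 0 < d₁) (hdₒ : 2 ≤ dₒ) {lam s : ℝ} (h0 : 0 < lam)
    (h1 : lam ≤ 1) (hs : s ∈ Set.Icc (0 : ℝ) 1) (k : ℕ) :
    |N.approxObjective lam (k + 1) s - N.objective s|
      ≤ lam * Real.logb 2 ((dₒ : ℝ) - 1) + modifiedBinaryEntropy lam
        + 4 / (lam / dₒ * (k + 3)) / Real.log 2 := by
  have : Nonempty (Fin d₁) := ⟨⟨0, hd₁⟩⟩
  have hl : 0 < Real.log 2 := Real.log_pos one_lt_two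
  have hd : (0 : ℝ) < dₒ := by exact_mod_cast (by omega : 0 < dₒ)
  have hκ : 0 < lam / dₒ := div_pos h0 hd
  set P : ℕ → Fin dₒ → ℝ := fun k z => (N.frankWolfe lam s k).1 z with hP
  set b : ℕ → Fin d₁ := fun k =>
    ⟨firstArgmax (N.score lam s (N.frankWolfe lam s k).1) d₁, firstArgmax_lt _ hd₁⟩ with hb
  -- The scores are in bits and the gap estimate is in nats; a positive factor does not change the
  -- best letter.
  have hscore : ∀ k (b' : Fin d₁), N.score lam s (N.frankWolfe lam s k).1 b' * Real.log 2
      = -(Real.log 2 * N.inputCost s b')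
        - ∑ z : Fin dₒ, N.smoothOutput lam s b' z * Real.log (P k z) := by
    intro k b'
    rw [score, Finset.sum_range (fun z => N.smoothOutput lam s b' z
      * Real.log ((N.frankWolfe lam s k).1 z) / Real.log 2), ← Finset.sum_div]
    field_simp
    ring
  obtain ⟨⟨p, hp, hPp, hCp⟩, hgap⟩ := frankWolfe_gap
    (fun (b : Fin d₁) (z : Fin dₒ) => N.smoothOutput lam s b z)
    (fun b : Fin d₁ => Real.log 2 * N.inputCost s b) hκ
    (fun b z => N.div_le_smoothOutput h1 hs b z)
    (fun b => by
      simp only [smoothOutput_fin, Finset.sum_add_distrib, ← Finset.mul_sum, sum_mixedOutput]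
      simp
      field_simp
      ring) P (fun k => Real.log 2 * (N.frankWolfe lam s k).2) b
    (fun z => N.div_le_frankWolfe h1 hs 0 z)
    (by simp [hP, frankWolfe, hd.ne']) (fun k z => rfl)
    (fun k => by simp only [frankWolfe, hb]; ring)
    (fun k b' => by
      rw [← hscore, ← hscore]
      exact mul_le_mul_of_nonneg_right (le_firstArgmax _ b'.2) hl.le) k
  have hval : N.approxObjective lam (k + 1) s = (∑ z, Real.negMulLog (P (k + 1) z)
      - Real.log 2 * (N.frankWolfe lam s (k + 1)).2) / Real.log 2 := by
    rw [approxObjective, Finset.sum_range (fun z => (N.frankWolfe lam s (k + 1)).1 z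
      * Real.log ((N.frankWolfe lam s (k + 1)).1 z) / Real.log 2), ← Finset.sum_div]
    simp only [Real.negMulLog, neg_mul, Finset.sum_neg_distrib, hP]
    field_simp
    ring
  have hsm : ∀ p ∈ stdSimplex ℝ (Fin d₁),
      |(∑ z : Fin dₒ, Real.negMulLog (∑ b : Fin d₁, p b * N.smoothOutput lam s b z)
        - ∑ b : Fin d₁, p b * (Real.log 2 * N.inputCost s b)) / Real.log 2
        - N.info p ![s, 1 - s]|
      ≤ lam * Real.logb 2 ((dₒ : ℝ) - 1) + modifiedBinaryEntropy lam := by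
    intro p hp
    have h := abs_entropy_smooth_sub_le hdₒ (P := fun z => ∑ b, p b * N.mixedOutput s b z)
      (fun z => Finset.sum_nonneg fun b _ => mul_nonneg (hp.1 b) (N.mixedOutput_nonneg hs b z))
      (by rw [Finset.sum_comm]; simp only [← Finset.mul_sum, sum_mixedOutput, mul_one, hp.2])
      h0.le h1
    have e1 : ∀ z : Fin dₒ, ∑ b : Fin d₁, p b * N.smoothOutput lam s b z
        = (1 - lam) * ∑ b, p b * N.mixedOutput s b z + lam / dₒ := by
      intro z
      simp only [smoothOutput_fin, mul_add, Finset.sum_add_distrib, ← Finset.sum_mul, hp.2,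
        Finset.mul_sum]
      rw [one_mul]
      congr 1
      exact Finset.sum_congr rfl fun b _ => by ring
    have e2 : ∑ b : Fin d₁, p b * (Real.log 2 * N.inputCost s b)
        = Real.log 2 * ∑ b, p b * N.mixedEntropy s b := by
      rw [Finset.mul_sum]
      exact Finset.sum_congr rfl fun b _ => by rw [inputCost_fin]; ring
    rw [info_eq, e2, sub_div, mul_div_cancel_left₀ _ hl.ne']
    simp only [e1]
    rw [shannonEntropy_eq_div (fun z => (1 - lam) * _ + _)] at h
    rw [sub_sub_sub_cancel_right]
    exact h
  have hfw : 0 ≤ 4 / (lam / dₒ * ((k : ℝ) + 3)) / Real.log 2 := by positivity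
  rw [abs_le]
  constructor
  · have : N.objective s ≤ N.approxObjective lam (k + 1) s
        + (lam * Real.logb 2 ((dₒ : ℝ) - 1) + modifiedBinaryEntropy lam
          + 4 / (lam / dₒ * (k + 3)) / Real.log 2) := by
      refine N.objective_le fun p hp => ?_
      have a1 := (abs_le.1 (hsm p hp)).1
      have a2 := div_le_div_of_nonneg_right (hgap p hp) hl.le
      rw [add_div, ← hval] at a2
      linarith
    linarith
  -- The value found belongs to an actual input distribution of the smoothed problem, so it can
  -- exceed the objective only by the smoothing error.
  · have a1 := (abs_le.1 (hsm p hp)).2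
    simp only [← hPp, ← hCp, ← hval] at a1
    have a2 := N.info_le_objective hs hp
    linarith

/-! ### Choice of the numerical parameters -/

theorem _root_.Real.logb_two_le {x : ℝ} (hx : 0 < x) : Real.logb 2 x ≤ 2 * x := by
  have h1 := Real.log_le_sub_one_of_pos hx
  have h2 := Real.log_two_gt_d9
  rw [Real.logb, div_le_iff₀ (by linarith)]
  nlinarith

theorem sqrt_inv_le_of_sq_le {dₒ : ℕ} (hdₒ : 2 ≤ dₒ) {e : ℝ} (he : 0 < e) {M : ℕ}
    (hM : (128 * dₒ / e) ^ 2 ≤ (M : ℝ)) : 0 < (M : ℝ) ∧ √(1 / M) ≤ e / (128 * dₒ) := by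
  have hd : (0 : ℝ) < dₒ := by exact_mod_cast (by omega : 0 < dₒ)
  have hpos : 0 < (128 * dₒ / e) ^ 2 := by positivity
  refine ⟨hpos.trans_le hM, ?_⟩
  rw [Real.sqrt_le_left (by positivity)]
  calc 1 / (M : ℝ) ≤ 1 / (128 * dₒ / e) ^ 2 := one_div_le_one_div_of_le hpos hM
    _ = (e / (128 * dₒ)) ^ 2 := by field_simp

/-- One M serves as reciprocal smoothing weight, as size of the root-finding grid and as bound on
the number of outer iterations. Near 0 the binary entropy is controlled by 2√x, so M must be
quadratic in dₒ/e; the linear terms are then negligible. -/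
theorem modulus_resolution (hd₁ : 0 < d₁) (hdₒ : 2 ≤ dₒ) {e : ℝ} (he : 0 < e) (he1 : e ≤ 1)
    {M : ℕ} (hM : (128 * dₒ / e) ^ 2 ≤ (M : ℝ)) :
    0 < (M : ℝ) ∧ 1 / (M : ℝ) ≤ 1 / 2 ∧ N.modulus (2 * (1 / M)) ≤ e / 8 ∧
    1 / (M : ℝ) * Real.logb 2 ((dₒ : ℝ) - 1) + modifiedBinaryEntropy (1 / M) ≤ e / 32 := by
  have : Nonempty (Fin d₁) := ⟨⟨0, hd₁⟩⟩
  have hd : (2 : ℝ) ≤ dₒ := by exact_mod_cast hdₒ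
  obtain ⟨hM0, hs⟩ := sqrt_inv_le_of_sq_le hdₒ he hM
  have hs0 : 0 ≤ √(1 / (M : ℝ)) := Real.sqrt_nonneg _
  have hsq : √(1 / (M : ℝ)) ^ 2 = 1 / M := Real.sq_sqrt (by positivity)
  have hsd : √(1 / (M : ℝ)) * dₒ ≤ e / 128 := by
    have := mul_le_mul_of_nonneg_right hs (by linarith : (0 : ℝ) ≤ dₒ)
    have e1 : e / (128 * dₒ) * dₒ = e / 128 := by field_simp
    linarith
  have hs2 : √(1 / (M : ℝ)) ≤ e / 256 := by nlinarith
  have hMd : 1 / (M : ℝ) * dₒ ≤ e / 128 * (1 / 256) := by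
    rw [← hsq, pow_two, mul_assoc]
    nlinarith
  have hhalf : 1 / (M : ℝ) ≤ 1 / 2 := by nlinarith
  have hMi : 0 ≤ 1 / (M : ℝ) := by positivity
  have hh := modifiedBinaryEntropy_le_sqrt hMi hhalf
  refine ⟨hM0, hhalf, ?_, ?_⟩
  · have h1 := N.slope_le (by simpa using hdₒ)
    rw [Fintype.card_fin] at h1
    have h2 := Real.logb_two_le (by linarith : (0 : ℝ) < dₒ)
    have h3 := mul_le_mul_of_nonneg_right (h1.trans (by linarith : _ ≤ 3 * (dₒ : ℝ))) hMi
    rw [modulus_eq, mul_div_cancel_left₀ _ (two_ne_zero' ℝ)]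
    linarith
  · have h2 := Real.logb_two_le (by linarith : (0 : ℝ) < (dₒ : ℝ) - 1)
    have h3 := mul_le_mul_of_nonneg_left (h2.trans (by linarith : _ ≤ 2 * (dₒ : ℝ))) hMi
    linarith

theorem abs_approxObjective_sub_le_of_le (hd₁ : 0 < d₁) (hdₒ : 2 ≤ dₒ) {e : ℝ} (he : 0 < e)
    (he1 : e ≤ 1) {M T : ℕ} (hM : (128 * dₒ / e) ^ 2 ≤ (M : ℝ))
    (hT : 256 * dₒ * M / e ≤ (T : ℝ)) {s : ℝ} (hs : s ∈ Set.Icc (0 : ℝ) 1) :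
    |N.approxObjective (1 / M) T s - N.objective s| ≤ e / 16 := by
  obtain ⟨hM0, hhalf, -, hsm⟩ := N.modulus_resolution hd₁ hdₒ he he1 hM
  have hd : (0 : ℝ) < dₒ := by exact_mod_cast (by omega : 0 < dₒ)
  have hT0 : 0 < (T : ℝ) := lt_of_lt_of_le (by positivity) hT
  obtain ⟨k, rfl⟩ := Nat.exists_eq_succ_of_ne_zero (by exact_mod_cast hT0.ne' : T ≠ 0)
  have h := N.abs_approxObjective_sub_le hd₁ hdₒ (lam := 1 / (M : ℝ)) (by positivity)
    (by linarith) hs k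
  have hl := Real.log_two_gt_d9
  -- The size of T makes the gap at most e/64 in nats, and log 2 ≥ 1/2 doubles this at most.
  -- Smoothing takes the other e/32.
  have h2 : 4 / (1 / (M : ℝ) / dₒ * ((k : ℝ) + 3)) / Real.log 2 ≤ e / 32 := by
    push_cast at hT
    rw [div_le_iff₀ he] at hT
    rw [div_div, div_le_div_iff₀ (by positivity) (by norm_num)]
    have e1 : e * (1 / (M : ℝ) / dₒ * ((k : ℝ) + 3) * Real.log 2)
        = (e * ((k : ℝ) + 3) * Real.log 2) / (M * dₒ) := by field_simp
    rw [e1, le_div_iff₀ (by positivity)]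
    have h3 : 256 * (dₒ : ℝ) * M ≤ e * ((k : ℝ) + 3) := by linarith
    nlinarith [mul_le_mul_of_nonneg_right h3 (by linarith : 0 ≤ Real.log 2),
      mul_pos hd hM0]
  calc _ ≤ _ := h
    _ ≤ e / 16 := by linarith

end MAC

/-! ### Total correctness of programs -/

namespace RAM

/-- The command contains an assignment to the given integer variable. -/
def Cmd.writesInt : Cmd → ℕ → Bool
  | skip, _ => false
  | setInt x _, y => x == y
  | setReal _ _, _ => false
  | setElem _ _ _, _ => false
  | seq c c', y => c.writesInt y || c'.writesInt y
  | ite _ c c', y => c.writesInt y || c'.writesInt y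
  | loop _ c, y => c.writesInt y

/-- The command contains an assignment to the given real variable. -/
def Cmd.writesReal : Cmd → ℕ → Bool
  | skip, _ => false
  | setInt _ _, _ => false
  | setReal x _, y => x == y
  | setElem _ _ _, _ => false
  | seq c c', y => c.writesReal y || c'.writesReal y
  | ite _ c c', y => c.writesReal y || c'.writesReal y
  | loop _ c, y => c.writesReal y

/-- The command contains an assignment to an entry of the given array. -/
def Cmd.writesArr : Cmd → ℕ → Bool
  | skip, _ => false
  | setInt _ _, _ => false
  | setReal _ _, _ => false
  | setElem a _ _, b => a == b
  | seq c c', y => c.writesArr y || c'.writesArr y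
  | ite _ c c', y => c.writesArr y || c'.writesArr y
  | loop _ c, y => c.writesArr y

/-- The stores agree on all memory to which the command does not write. -/
structure Agree (c : Cmd) (σ σ' : Store) : Prop where
  int : ∀ x, c.writesInt x = false → σ'.int x = σ.int x
  real : ∀ x, c.writesReal x = false → σ'.real x = σ.real x
  arr : ∀ a, c.writesArr a = false → σ'.arr a = σ.arr a

theorem Agree.refl (c : Cmd) (σ : Store) : Agree c σ σ :=
  ⟨fun _ _ => rfl, fun _ _ => rfl, fun _ _ => rfl⟩

theorem Agree.trans {c : Cmd} {σ σ' σ'' : Store} (h : Agree c σ σ') (h' : Agree c σ' σ'') :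
    Agree c σ σ'' :=
  ⟨fun x hx => (h'.int x hx).trans (h.int x hx), fun x hx => (h'.real x hx).trans (h.real x hx),
    fun x hx => (h'.arr x hx).trans (h.arr x hx)⟩

theorem Agree.seq {c c' : Cmd} {σ σ' σ'' : Store} (h : Agree c σ σ') (h' : Agree c' σ' σ'') :
    Agree (c.seq c') σ σ'' := by
  refine ⟨fun x hx => ?_, fun x hx => ?_, fun x hx => ?_⟩
  · have := Bool.or_eq_false_iff.1 hx
    exact (h'.int x this.2).trans (h.int x this.1)
  · have := Bool.or_eq_false_iff.1 hx
    exact (h'.real x this.2).trans (h.real x this.1)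
  · have := Bool.or_eq_false_iff.1 hx
    exact (h'.arr x this.2).trans (h.arr x this.1)

theorem Agree.ite_left {b : Test} {c c' : Cmd} {σ σ' : Store} (h : Agree c σ σ') :
    Agree (.ite b c c') σ σ' :=
  ⟨fun x hx => h.int x (Bool.or_eq_false_iff.1 hx).1,
    fun x hx => h.real x (Bool.or_eq_false_iff.1 hx).1,
    fun x hx => h.arr x (Bool.or_eq_false_iff.1 hx).1⟩

theorem Agree.ite_right {b : Test} {c c' : Cmd} {σ σ' : Store} (h : Agree c' σ σ') :
    Agree (.ite b c c') σ σ' :=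
  ⟨fun x hx => h.int x (Bool.or_eq_false_iff.1 hx).2,
    fun x hx => h.real x (Bool.or_eq_false_iff.1 hx).2,
    fun x hx => h.arr x (Bool.or_eq_false_iff.1 hx).2⟩

theorem Agree.loop {b : Test} {c : Cmd} {σ σ' : Store} (h : Agree c σ σ') :
    Agree (.loop b c) σ σ' :=
  ⟨h.int, h.real, h.arr⟩

/-- The frame property. Write sets are computed from the syntax, so for concrete blocks the
preservation of a variable is closed by `rfl`. -/
theorem Exec.agree {c : Cmd} {σ σ' : Store} {t : ℕ} (h : Exec c σ t σ') : Agree c σ σ' := by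
  induction h with
  | skip σ => exact Agree.refl _ _
  | setInt σ x u =>
    refine ⟨fun y hy => ?_, fun _ _ => rfl, fun _ _ => rfl⟩
    exact Function.update_of_ne (fun h => by simp [Cmd.writesInt, h] at hy) _ _
  | setReal σ x u _ =>
    refine ⟨fun _ _ => rfl, fun y hy => ?_, fun _ _ => rfl⟩
    exact Function.update_of_ne (fun h => by simp [Cmd.writesReal, h] at hy) _ _
  | setElem σ a i u _ =>
    refine ⟨fun _ _ => rfl, fun _ _ => rfl, fun y hy => ?_⟩
    exact Function.update_of_ne (fun h => by simp [Cmd.writesArr, h] at hy) _ _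
  | seq _ _ ih ih' => exact ih.seq ih'
  | ite_true _ _ _ ih => exact ih.ite_left
  | ite_false _ _ _ ih => exact ih.ite_right
  | loop_true _ _ _ _ ih ih' => exact ih.loop.trans ih'
  | loop_false _ _ => exact Agree.refl _ _

/-- The cost of the command when each of its loops makes at most `W` iterations. -/
def Cmd.costBound (W : ℕ) : Cmd → ℕ
  | skip => 1
  | setInt _ u => u.cost + 1
  | setReal _ u => u.cost + 1
  | setElem _ i u => i.cost + u.cost + 1
  | seq c c' => c.costBound W + c'.costBound W
  | ite b c c' => b.cost + (c.costBound W + c'.costBound W) + 1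
  | loop b c => W * (b.cost + c.costBound W + 1) + (b.cost + 1)

/-- Polynomials (W + 1)^k with nonnegative coefficients are closed under the three constructions:
sequencing and branching may add exponents, and a loop raises the exponent by one. -/
theorem Cmd.exists_costBound_le (c : Cmd) : ∃ A k : ℕ, ∀ W, c.costBound W ≤ A * (W + 1) ^ k := by
  have key : ∀ (A A' k k' W : ℕ),
      A * (W + 1) ^ k + A' * (W + 1) ^ k' ≤ (A + A') * (W + 1) ^ (k + k') := by
    intro A A' k k' W
    have h1 := Nat.pow_le_pow_right (Nat.succ_pos W) (Nat.le_add_right k k')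
    have h2 := Nat.pow_le_pow_right (Nat.succ_pos W) (Nat.le_add_left k' k)
    rw [add_mul]
    exact Nat.add_le_add (Nat.mul_le_mul_left _ h1) (Nat.mul_le_mul_left _ h2)
  induction c with
  | skip => exact ⟨1, 0, fun W => by simp [costBound]⟩
  | setInt x u => exact ⟨u.cost + 1, 0, fun W => by simp [costBound]⟩
  | setReal x u => exact ⟨u.cost + 1, 0, fun W => by simp [costBound]⟩
  | setElem a i u => exact ⟨i.cost + u.cost + 1, 0, fun W => by simp [costBound]⟩
  | seq c c' ih ih' =>
    obtain ⟨A, k, h⟩ := ih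
    obtain ⟨A', k', h'⟩ := ih'
    exact ⟨A + A', k + k', fun W => (Nat.add_le_add (h W) (h' W)).trans (key _ _ _ _ _)⟩
  | ite b c c' ih ih' =>
    obtain ⟨A, k, h⟩ := ih
    obtain ⟨A', k', h'⟩ := ih'
    refine ⟨b.cost + 1 + (A + A'), k + k', fun W => ?_⟩
    have h1 := (Nat.add_le_add (h W) (h' W)).trans (key _ _ _ _ _)
    have h2 := Nat.one_le_pow (k + k') (W + 1) (Nat.succ_pos W)
    simp only [costBound]
    nlinarith
  | loop b c ih =>
    obtain ⟨A, k, h⟩ := ih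
    refine ⟨b.cost + 1 + A, k + 1, fun W => ?_⟩
    have h2 := Nat.one_le_pow k (W + 1) (Nat.succ_pos W)
    have h1 := h W
    have h3 : b.cost + c.costBound W + 1 ≤ (b.cost + 1 + A) * (W + 1) ^ k := by nlinarith
    have h4 : b.cost + 1 ≤ (b.cost + 1 + A) * (W + 1) ^ k := by nlinarith
    simp only [costBound]
    calc _ ≤ W * ((b.cost + 1 + A) * (W + 1) ^ k) + (b.cost + 1 + A) * (W + 1) ^ k :=
          Nat.add_le_add (Nat.mul_le_mul_left _ h3) h4
      _ = _ := by ring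

/-- Started in `σ`, the command halts in a store that satisfies `Q`, at a cost that is explained by
at most `W` iterations for each execution of each loop. -/
def Runs (W : ℕ) (c : Cmd) (σ : Store) (Q : Store → Prop) : Prop :=
  ∃ t σ', Exec c σ t σ' ∧ t ≤ c.costBound W ∧ Q σ'

variable {W : ℕ} {c c' : Cmd} {σ : Store} {Q R : Store → Prop}

theorem Runs.imp (h : Runs W c σ Q) (hQ : ∀ σ', Agree c σ σ' → Q σ' → R σ') : Runs W c σ R := by
  obtain ⟨t, σ', he, ht, hq⟩ := h
  exact ⟨t, σ', he, ht, hQ σ' he.agree hq⟩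

theorem Runs.skip (h : Q σ) : Runs W .skip σ Q := ⟨1, σ, .skip σ, le_rfl, h⟩

theorem Runs.setInt {x : ℕ} {u : IntExp} (h : Q (σ.setInt x (u.val σ))) :
    Runs W (.setInt x u) σ Q := ⟨_, _, .setInt σ x u, le_rfl, h⟩

theorem Runs.setReal {x : ℕ} {u : RealExp} (hu : u.Defined σ) (h : Q (σ.setReal x (u.val σ))) :
    Runs W (.setReal x u) σ Q := ⟨_, _, .setReal σ x u hu, le_rfl, h⟩

theorem Runs.setElem {a : ℕ} {i : IntExp} {u : RealExp} (hu : u.Defined σ)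
    (h : Q (σ.setElem a (i.val σ) (u.val σ))) : Runs W (.setElem a i u) σ Q :=
  ⟨_, _, .setElem σ a i u hu, le_rfl, h⟩

theorem Runs.seq (h : Runs W c σ Q) (h' : ∀ σ', Agree c σ σ' → Q σ' → Runs W c' σ' R) :
    Runs W (.seq c c') σ R := by
  obtain ⟨t, σ', he, ht, hq⟩ := h
  obtain ⟨t', σ'', he', ht', hr⟩ := h' σ' he.agree hq
  exact ⟨_, _, .seq he he', Nat.add_le_add ht ht', hr⟩

theorem Runs.ite {b : Test} (hb : b.Defined σ) (h : b.Holds σ → Runs W c σ Q)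
    (h' : ¬ b.Holds σ → Runs W c' σ Q) : Runs W (.ite b c c') σ Q := by
  by_cases hh : b.Holds σ
  · obtain ⟨t, σ', he, ht, hq⟩ := h hh
    refine ⟨_, _, .ite_true hb hh he, ?_, hq⟩
    simp only [Cmd.costBound]
    omega
  · obtain ⟨t, σ', he, ht, hq⟩ := h' hh
    refine ⟨_, _, .ite_false hb hh he, ?_, hq⟩
    simp only [Cmd.costBound]
    omega

theorem Runs.setInt_seq {x : ℕ} {u : IntExp} (h : Runs W c (σ.setInt x (u.val σ)) Q) :
    Runs W (.seq (.setInt x u) c) σ Q :=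
  (Runs.setInt (Q := fun σ' => σ' = σ.setInt x (u.val σ)) rfl).seq fun _ _ e => e ▸ h

theorem Runs.setReal_seq {x : ℕ} {u : RealExp} (hu : u.Defined σ)
    (h : Runs W c (σ.setReal x (u.val σ)) Q) : Runs W (.seq (.setReal x u) c) σ Q :=
  (Runs.setReal (Q := fun σ' => σ' = σ.setReal x (u.val σ)) hu rfl).seq fun _ _ e => e ▸ h

theorem Runs.setElem_seq {a : ℕ} {i : IntExp} {u : RealExp} (hu : u.Defined σ)
    (h : Runs W c (σ.setElem a (i.val σ) (u.val σ)) Q) : Runs W (.seq (.setElem a i u) c) σ Q :=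
  (Runs.setElem (Q := fun σ' => σ' = σ.setElem a (i.val σ) (u.val σ)) hu rfl).seq
    fun _ _ e => e ▸ h

/-- The invariant is indexed by the number of iterations made. Since the guard may hold only for k <
W, induction on W - k gives termination and the cost bound together. -/
theorem Runs.loop {b : Test} (I : ℕ → Store → Prop) (h0 : I 0 σ)
    (hstep : ∀ k σ', Agree c σ σ' → I k σ' →
      b.Defined σ' ∧ (b.Holds σ' → k < W ∧ Runs W c σ' (I (k + 1))))
    (hQ : ∀ k σ', Agree c σ σ' → I k σ' → ¬ b.Holds σ' → Q σ') : Runs W (.loop b c) σ Q := by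
  have key : ∀ m k σ', k + m = W → Agree c σ σ' → I k σ' → ∃ t σ'', Exec (.loop b c) σ' t σ'' ∧
      t ≤ m * (b.cost + c.costBound W + 1) + (b.cost + 1) ∧ Q σ'' := by
    intro m
    induction m with
    | zero =>
      intro k σ' hk ha hI
      have hh : ¬ b.Holds σ' := fun hh => by
        have := ((hstep k σ' ha hI).2 hh).1
        omega
      exact ⟨_, _, .loop_false (hstep k σ' ha hI).1 hh, by simp, hQ k σ' ha hI hh⟩
    | succ m ih =>
      intro k σ' hk ha hI
      obtain ⟨hd, hr⟩ := hstep k σ' ha hI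
      by_cases hh : b.Holds σ'
      · obtain ⟨-, t, σ₁, he, ht, hI'⟩ := hr hh
        obtain ⟨t', σ₂, he', ht', hq⟩ := ih (k + 1) σ₁ (by omega) (ha.trans he.agree) hI'
        refine ⟨_, _, .loop_true hd hh he he', ?_, hq⟩
        rw [Nat.succ_mul]
        omega
      · exact ⟨_, _, .loop_false hd hh, by omega, hQ k σ' ha hI hh⟩
  obtain ⟨t, σ', he, ht, hq⟩ := key W 0 σ (by simp) (Agree.refl _ _) h0
  exact ⟨t, σ', he, ht, hq⟩

/-- Run the body for all values of the integer variable `i` below that of `n`. -/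
def forLoop (i n : ℕ) (body : Cmd) : Cmd :=
  .seq (.setInt i (.const 0)) (.loop (.neg (.intLe (.var n) (.var i)))
    (.seq body (.setInt i (.plus (.var i) (.const 1)))))

/-- The invariant is asserted with the counter already set to k. As the body writes neither counter
nor limit, the loop runs exactly as often as the initial limit says. The frame relation starts
before the loop, so earlier facts reach the body. -/
theorem Runs.forLoop {i n : ℕ} {body : Cmd} (I : ℕ → Store → Prop) (hW : σ.int n ≤ W)
    (hi : body.writesInt i = false) (hn : body.writesInt n = false) (hin : i ≠ n)
    (h0 : I 0 (σ.setInt i 0))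
    (hstep : ∀ k σ', k < σ.int n → Agree (forLoop i n body) σ σ' → σ'.int i = k → I k σ' →
      Runs W body σ' fun σ'' => I (k + 1) (σ''.setInt i (k + 1)))
    (hQ : ∀ σ', I (σ.int n) σ' → Q σ') : Runs W (forLoop i n body) σ Q := by
  have hn' : (Cmd.seq body (.setInt i (.plus (.var i) (.const 1)))).writesInt n = false := by
    simp [Cmd.writesInt, hn, hin]
  refine Runs.setInt_seq (Runs.loop (fun k σ' => k ≤ σ.int n ∧ σ'.int i = k ∧ I k σ')
    ⟨Nat.zero_le _, by simp [Store.setInt, IntExp.val], h0⟩ ?_ ?_)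
  · rintro k σ' ha ⟨hk, hik, hI⟩
    have hnv : σ'.int n = σ.int n := by
      rw [ha.int n hn']
      simp [Store.setInt, hin.symm]
    refine ⟨trivial, fun hh => ?_⟩
    have hlt : k < σ.int n := by
      simpa [Test.Holds, IntExp.val, hnv, hik] using hh
    refine ⟨hlt.trans_le hW, ?_⟩
    have hag : Agree (RAM.forLoop i n body) σ σ' :=
      Agree.seq (Exec.setInt σ i (.const 0)).agree ha.loop
    refine (hstep k σ' hlt hag hik hI).seq fun σ'' ha'' hI' => Runs.setInt ?_
    have e : σ''.int i = k := (ha''.int i hi).trans hik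
    simp only [IntExp.val, e]
    exact ⟨hlt, by simp [Store.setInt], hI'⟩
  · rintro k σ' ha ⟨hk, hik, hI⟩ hh
    have hnv : σ'.int n = σ.int n := by
      rw [ha.int n hn']
      simp [Store.setInt, hin.symm]
    have hle : σ.int n ≤ k := by
      simpa [Test.Holds, IntExp.val, hnv, hik] using hh
    obtain rfl := le_antisymm hk hle
    exact hQ σ' hI

/-! ### Evaluation of expressions -/

instance : Add IntExp := ⟨.plus⟩
instance : Sub IntExp := ⟨.minus⟩
instance : Add RealExp := ⟨.plus⟩
instance : Sub RealExp := ⟨.minus⟩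
instance : Mul RealExp := ⟨.times⟩
instance : Div RealExp := ⟨.quot⟩

/-- The constant `n`. -/
def lit (n : ℕ) : RealExp := .ofInt (.const n)

section Evaluation

variable (σ : Store)

@[simp] theorem IntExp.val_const (n : ℕ) : (IntExp.const n).val σ = n := rfl
@[simp] theorem IntExp.val_var (x : ℕ) : (IntExp.var x).val σ = σ.int x := rfl
@[simp] theorem IntExp.val_add (u v : IntExp) : (u + v).val σ = u.val σ + v.val σ := rfl
@[simp] theorem IntExp.val_sub (u v : IntExp) : (u - v).val σ = u.val σ - v.val σ := rfl

@[simp] theorem RealExp.val_lit (n : ℕ) : (lit n).val σ = n := rfl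
@[simp] theorem RealExp.val_ofInt (u : IntExp) : (RealExp.ofInt u).val σ = (u.val σ : ℝ) := rfl
@[simp] theorem RealExp.val_var (x : ℕ) : (RealExp.var x).val σ = σ.real x := rfl
@[simp] theorem RealExp.val_elem (a : ℕ) (u : IntExp) :
    (RealExp.elem a u).val σ = σ.arr a (u.val σ) := rfl
@[simp] theorem RealExp.val_add (u v : RealExp) : (u + v).val σ = u.val σ + v.val σ := rfl
@[simp] theorem RealExp.val_sub (u v : RealExp) : (u - v).val σ = u.val σ - v.val σ := rfl
@[simp] theorem RealExp.val_mul (u v : RealExp) : (u * v).val σ = u.val σ * v.val σ := rfl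
@[simp] theorem RealExp.val_div (u v : RealExp) : (u / v).val σ = u.val σ / v.val σ := rfl
@[simp] theorem RealExp.val_log (u : RealExp) : (RealExp.log u).val σ = Real.log (u.val σ) := rfl

@[simp] theorem RealExp.defined_lit (n : ℕ) : (lit n).Defined σ := trivial
@[simp] theorem RealExp.defined_ofInt (u : IntExp) : (RealExp.ofInt u).Defined σ := trivial
@[simp] theorem RealExp.defined_var (x : ℕ) : (RealExp.var x).Defined σ := trivial
@[simp] theorem RealExp.defined_elem (a : ℕ) (u : IntExp) : (RealExp.elem a u).Defined σ := trivial
@[simp] theorem RealExp.defined_add (u v : RealExp) :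
    (u + v).Defined σ ↔ u.Defined σ ∧ v.Defined σ := Iff.rfl
@[simp] theorem RealExp.defined_sub (u v : RealExp) :
    (u - v).Defined σ ↔ u.Defined σ ∧ v.Defined σ := Iff.rfl
@[simp] theorem RealExp.defined_mul (u v : RealExp) :
    (u * v).Defined σ ↔ u.Defined σ ∧ v.Defined σ := Iff.rfl
@[simp] theorem RealExp.defined_div (u v : RealExp) :
    (u / v).Defined σ ↔ u.Defined σ ∧ v.Defined σ ∧ v.val σ ≠ 0 := Iff.rfl
@[simp] theorem RealExp.defined_log (u : RealExp) :
    (RealExp.log u).Defined σ ↔ u.Defined σ ∧ 0 < u.val σ := Iff.rfl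

@[simp] theorem Store.int_setInt (x n y : ℕ) :
    (σ.setInt x n).int y = if y = x then n else σ.int y := Function.update_apply _ _ _ _
@[simp] theorem Store.real_setInt (x n : ℕ) : (σ.setInt x n).real = σ.real := rfl
@[simp] theorem Store.arr_setInt (x n : ℕ) : (σ.setInt x n).arr = σ.arr := rfl
@[simp] theorem Store.int_setReal (x : ℕ) (r : ℝ) : (σ.setReal x r).int = σ.int := rfl
@[simp] theorem Store.real_setReal (x : ℕ) (r : ℝ) (y : ℕ) :
    (σ.setReal x r).real y = if y = x then r else σ.real y := Function.update_apply _ _ _ _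
@[simp] theorem Store.arr_setReal (x : ℕ) (r : ℝ) : (σ.setReal x r).arr = σ.arr := rfl
@[simp] theorem Store.int_setElem (a i : ℕ) (r : ℝ) : (σ.setElem a i r).int = σ.int := rfl
@[simp] theorem Store.real_setElem (a i : ℕ) (r : ℝ) : (σ.setElem a i r).real = σ.real := rfl
@[simp] theorem Store.arr_setElem (a i : ℕ) (r : ℝ) (b j : ℕ) :
    (σ.setElem a i r).arr b j = if b = a ∧ j = i then r else σ.arr b j := by
  unfold Store.setElem
  simp only [Function.update_apply]
  split_ifs <;> simp_all

@[simp] theorem Test.defined_intLe (u v : IntExp) : (Test.intLe u v).Defined σ := trivial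
@[simp] theorem Test.defined_realLe (u v : RealExp) :
    (Test.realLe u v).Defined σ ↔ u.Defined σ ∧ v.Defined σ := Iff.rfl
@[simp] theorem Test.defined_neg (b : Test) : (Test.neg b).Defined σ ↔ b.Defined σ := Iff.rfl
@[simp] theorem Test.defined_both (b c : Test) :
    (Test.both b c).Defined σ ↔ b.Defined σ ∧ c.Defined σ := Iff.rfl
@[simp] theorem Test.holds_intLe (u v : IntExp) :
    (Test.intLe u v).Holds σ ↔ u.val σ ≤ v.val σ := Iff.rfl
@[simp] theorem Test.holds_realLe (u v : RealExp) :
    (Test.realLe u v).Holds σ ↔ u.val σ ≤ v.val σ := Iff.rfl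
@[simp] theorem Test.holds_neg (b : Test) : (Test.neg b).Holds σ ↔ ¬ b.Holds σ := Iff.rfl
@[simp] theorem Test.holds_both (b c : Test) :
    (Test.both b c).Holds σ ↔ b.Holds σ ∧ c.Holds σ := Iff.rfl

end Evaluation

end RAM

/-! ### Evaluation of the objective -/

namespace RAM

infixr:60 " ⨾ " => Cmd.seq

/-- No input, parameter or table is overwritten. -/
def Cmd.keepsContext (c : Cmd) : Bool :=
  ([0, 1, 3, 4].all fun x => !c.writesInt x) && ([0, 2, 3, 4, 5].all fun x => !c.writesReal x)
    && ([0, 1, 4, 5].all fun x => !c.writesArr x)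

/-- The inputs, the numerical parameters and the table of entropies. -/
structure Context {d₁ dₒ : ℕ} (N : MAC (Fin d₁) (Fin 2) (Fin dₒ)) (ε : ℝ) (M T : ℕ) (σ : Store) :
    Prop where
  card₁ : σ.int 0 = d₁
  cardₒ : σ.int 1 = dₒ
  grid : σ.int 3 = M
  steps : σ.int 4 = T
  precision : σ.real 0 = ε
  cutoff : σ.real 2 = min ε 1
  log_two : σ.real 3 = Real.log 2
  slope : σ.real 4 = N.slope
  lam : σ.real 5 = 1 / M
  entry₀ : ∀ b z, b < d₁ → z < dₒ → σ.arr 0 (b * dₒ + z) = N.entry 0 b z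
  entry₁ : ∀ b z, b < d₁ → z < dₒ → σ.arr 1 (b * dₒ + z) = N.entry 1 b z
  entropy₀ : ∀ b, b < d₁ → σ.arr 4 b = N.entropyAt 0 b
  entropy₁ : ∀ b, b < d₁ → σ.arr 5 b = N.entropyAt 1 b

theorem Context.of_agree {d₁ dₒ : ℕ} {N : MAC (Fin d₁) (Fin 2) (Fin dₒ)} {ε : ℝ} {M T : ℕ}
    {σ σ' : Store} {c : Cmd} (h : Context N ε M T σ) (ha : Agree c σ σ')
    (hc : c.keepsContext = true) : Context N ε M T σ' := by
  simp only [Cmd.keepsContext, List.all_cons, List.all_nil, Bool.and_eq_true, Bool.and_true,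
    Bool.not_eq_true'] at hc
  obtain ⟨⟨⟨i0, i1, i3, i4⟩, r0, r2, r3, r4, r5⟩, a0, a1, a4, a5⟩ := hc
  constructor
  · rw [ha.int 0 i0, h.card₁]
  · rw [ha.int 1 i1, h.cardₒ]
  · rw [ha.int 3 i3, h.grid]
  · rw [ha.int 4 i4, h.steps]
  · rw [ha.real 0 r0, h.precision]
  · rw [ha.real 2 r2, h.cutoff]
  · rw [ha.real 3 r3, h.log_two]
  · rw [ha.real 4 r4, h.slope]
  · rw [ha.real 5 r5, h.lam]
  · rw [ha.arr 0 a0]; exact h.entry₀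
  · rw [ha.arr 1 a1]; exact h.entry₁
  · rw [ha.arr 4 a4]; exact h.entropy₀
  · rw [ha.arr 5 a5]; exact h.entropy₁

/-- The smoothed output probability, for the row at the given offset. -/
def outputExp (off : ℕ) : RealExp :=
  (lit 1 - .var 5) * (.var 6 * .elem 0 (.var off + .var 7)
    + (lit 1 - .var 6) * .elem 1 (.var off + .var 7)) + .var 5 / .ofInt (.var 1)

/-- The conditional entropy for the given first input. -/
def costExp (b : ℕ) : RealExp :=
  .var 6 * .elem 4 (.var b) + (lit 1 - .var 6) * .elem 5 (.var b)

/-- Reads the letter in integer variable 6, its row offset in integer variable 5 and the current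
distribution in array 8; the score goes to real variable 8. -/
def scoreBlock : Cmd :=
  .setReal 8 (lit 0 - costExp 6) ⨾
  forLoop 7 1 (.setReal 8 (.var 8 - outputExp 5 * .log (.elem 8 (.var 7)) / .var 3))

/-- The best letter and its row offset go to integer variables 8 and 9. Offsets are accumulated by
addition, since the machine cannot multiply integers. The test accepts letter 0 unconditionally, so
the unknown initial content of real variable 9 is harmless. -/
def argmaxBlock : Cmd :=
  .setInt 5 (.const 0) ⨾
  forLoop 6 0 (
    scoreBlock ⨾
    .ite (.neg (.both (.neg (.intLe (.var 6) (.const 0))) (.realLe (.var 8) (.var 9))))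
      (.setReal 9 (.var 8) ⨾ .setInt 8 (.var 6) ⨾ .setInt 9 (.var 5)) .skip ⨾
    .setInt 5 (.var 5 + .var 1))

/-- Integer variable 10 holds the iteration number k, and real variable 10 the accumulated
conditional entropy. -/
def updateBlock : Cmd :=
  .setReal 11 (lit 2 / (.ofInt (.var 10) + lit 2)) ⨾
  forLoop 7 1 (.setElem 8 (.var 7) ((lit 1 - .var 11) * .elem 8 (.var 7)
    + .var 11 * outputExp 9)) ⨾
  .setReal 10 ((lit 1 - .var 11) * .var 10 + .var 11 * costExp 8)

/-- Real variable 7 receives the approximate objective at the point in real variable 6. -/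
def objectiveBlock : Cmd :=
  forLoop 7 1 (.setElem 8 (.var 7) (lit 1 / .ofInt (.var 1))) ⨾
  .setReal 10 (lit 0) ⨾
  forLoop 10 4 (argmaxBlock ⨾ updateBlock) ⨾
  .setReal 7 (lit 0 - .var 10) ⨾
  forLoop 7 1 (.setReal 7 (.var 7 - .elem 8 (.var 7) * .log (.elem 8 (.var 7)) / .var 3))

section

variable {d₁ dₒ : ℕ} {N : MAC (Fin d₁) (Fin 2) (Fin dₒ)} {ε : ℝ} {M T W : ℕ} {σ : Store}

theorem Context.val_outputExp (h : Context N ε M T σ) {off b z : ℕ} (hoff : σ.int off = b * dₒ)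
    (hz : σ.int 7 = z) (hb : b < d₁) (hz' : z < dₒ) :
    (outputExp off).val σ = N.smoothOutput (1 / M) (σ.real 6) b z := by
  simp [outputExp, MAC.smoothOutput, hoff, hz, h.lam, h.cardₒ, h.entry₀ b z hb hz', h.entry₁ b z hb hz']

theorem Context.defined_outputExp (h : Context N ε M T σ) (hdₒ : 0 < dₒ) (off : ℕ) :
    (outputExp off).Defined σ := by
  simp [outputExp, h.cardₒ, hdₒ.ne']

theorem Context.val_costExp (h : Context N ε M T σ) {i b : ℕ} (hi : σ.int i = b) (hb : b < d₁) :
    (costExp i).val σ = N.inputCost (σ.real 6) b := by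
  simp [costExp, MAC.inputCost, hi, h.entropy₀ b hb, h.entropy₁ b hb]

theorem defined_costExp (i : ℕ) : (costExp i).Defined σ := by
  simp [costExp]

theorem scoreBlock_spec (h : Context N ε M T σ) (hdₒ : 0 < dₒ) (hW : dₒ ≤ W) {b : ℕ} (hb : b < d₁)
    (h6 : σ.int 6 = b) (h5 : σ.int 5 = b * dₒ) {P : ℕ → ℝ} (hP : ∀ z < dₒ, σ.arr 8 z = P z)
    (hP0 : ∀ z < dₒ, 0 < P z) :
    Runs W scoreBlock σ fun σ' => σ'.real 8 = N.score (1 / M) (σ.real 6) P b := by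
  have hl : Real.log 2 ≠ 0 := (Real.log_pos one_lt_two).ne'
  refine Runs.setReal_seq (by simp [defined_costExp]) ?_
  refine Runs.forLoop (fun k σ' => σ'.real 8 = -N.inputCost (σ.real 6) b
    - ∑ z ∈ Finset.range k, N.smoothOutput (1 / M) (σ.real 6) b z * Real.log (P z) / Real.log 2)
    (by simpa [h.cardₒ] using hW) rfl rfl (by decide) ?_ ?_ ?_
  · simp [h.val_costExp h6 hb]
  · intro k σ' hk ha h7 hI
    rw [Store.int_setReal, h.cardₒ] at hk
    have ha' := ((Exec.setReal σ 8 (lit 0 - costExp 6) (by simp [defined_costExp])).agree).seq ha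
    have hC := h.of_agree ha' rfl
    have e5 : σ'.int 5 = b * dₒ := (ha'.int 5 rfl).trans h5
    have e6 : σ'.real 6 = σ.real 6 := ha'.real 6 rfl
    have e8 : σ'.arr 8 k = P k := (congrFun (ha'.arr 8 rfl) k).trans (hP k hk)
    refine Runs.setReal ?_ ?_
    · simp [hC.defined_outputExp hdₒ, h7, e8, hP0 k hk, hC.log_two, hl]
    · simp [hI, hC.val_outputExp e5 h7 hb hk, e6, h7, e8, hC.log_two, Finset.sum_range_succ]
      ring
  · intro σ' hI
    simpa [h.cardₒ, MAC.score] using hI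

theorem argmaxBlock_spec (h : Context N ε M T σ) (hd₁ : 0 < d₁) (hdₒ : 0 < dₒ) (hW : dₒ ≤ W)
    (hW₁ : d₁ ≤ W) {P : ℕ → ℝ} (hP : ∀ z < dₒ, σ.arr 8 z = P z) (hP0 : ∀ z < dₒ, 0 < P z) :
    Runs W argmaxBlock σ fun σ' =>
      σ'.int 8 = firstArgmax (N.score (1 / M) (σ.real 6) P) d₁ ∧
      σ'.int 9 = firstArgmax (N.score (1 / M) (σ.real 6) P) d₁ * dₒ := by
  set v := N.score (1 / M) (σ.real 6) P with hv
  refine Runs.setInt_seq ?_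
  refine Runs.forLoop (fun k σ' => σ'.int 5 = k * dₒ ∧ (0 < k → σ'.int 8 = firstArgmax v k ∧
    σ'.int 9 = firstArgmax v k * dₒ ∧ σ'.real 9 = v (firstArgmax v k)))
    (by simpa [h.card₁] using hW₁) rfl rfl (by decide) (by simp) ?_ ?_
  · intro k σ' hk ha h6 hI
    have hk : k < d₁ := by simpa [h.card₁] using hk
    have ha' := ((Exec.setInt σ 5 (.const 0)).agree).seq ha
    have hC := h.of_agree ha' rfl
    refine (scoreBlock_spec (W := W) hC hdₒ hW hk h6 hI.1 (P := P)
      (fun z hz => (congrFun (ha'.arr 8 rfl) z).trans (hP z hz)) hP0).seq fun σ₁ ha₁ h8 => ?_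
    rw [ha'.real 6 rfl, ← hv] at h8
    have e6 : σ₁.int 6 = k := (ha₁.int 6 rfl).trans h6
    have e5 : σ₁.int 5 = k * dₒ := (ha₁.int 5 rfl).trans hI.1
    have e1 : σ₁.int 1 = dₒ := (ha₁.int 1 rfl).trans hC.cardₒ
    have hI2 : 0 < k → σ₁.int 8 = firstArgmax v k ∧
        σ₁.int 9 = firstArgmax v k * dₒ ∧ σ₁.real 9 = v (firstArgmax v k) := by
      rw [ha₁.int 8 rfl, ha₁.int 9 rfl, ha₁.real 9 rfl]
      exact hI.2
    refine Runs.seq (Q := fun σ₂ => σ₂.int 5 = k * dₒ ∧ σ₂.int 1 = dₒ ∧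
      σ₂.int 8 = firstArgmax v (k + 1) ∧ σ₂.int 9 = firstArgmax v (k + 1) * dₒ ∧
      σ₂.real 9 = v (firstArgmax v (k + 1))) (Runs.ite (by simp) ?_ ?_) ?_
    · intro hh
      have : firstArgmax v (k + 1) = k := by
        rw [firstArgmax]
        split_ifs with hlt
        · rfl
        · rcases Nat.eq_zero_or_pos k with rfl | hk0
          · rfl
          · simp [e6, h8, (hI2 hk0).2.2] at hh
            exact absurd (hh hk0.ne') hlt
      rw [this]
      refine Runs.setReal_seq trivial (Runs.setInt_seq (Runs.setInt ?_))
      simp [e5, e1, e6, h8]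
    · intro hh
      simp only [Test.holds_neg, Test.holds_both, Test.holds_intLe, Test.holds_realLe, not_not,
        IntExp.val_var, IntExp.val_const, RealExp.val_var, e6, h8] at hh
      have hk0 : 0 < k := by omega
      obtain ⟨a1, a2, a3⟩ := hI2 hk0
      have : firstArgmax v (k + 1) = firstArgmax v k := by
        rw [firstArgmax, if_neg]
        rw [a3] at hh
        exact not_lt.2 hh.2
      rw [this]
      exact Runs.skip ⟨e5, e1, a1, a2, a3⟩
    · rintro σ₂ - ⟨b5, b1, b8, b9, c9⟩
      refine Runs.setInt ?_
      simp [b5, b1, b8, b9, c9, Nat.succ_mul]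
  · intro σ' hI
    have e : (σ.setInt 5 ((IntExp.const 0).val σ)).int 0 = d₁ := by simp [h.card₁]
    rw [e] at hI
    exact ⟨(hI.2 hd₁).1, (hI.2 hd₁).2.1⟩

theorem updateBlock_spec (h : Context N ε M T σ) (hdₒ : 0 < dₒ) (hW : dₒ ≤ W) {k b : ℕ}
    (hb : b < d₁) (h10 : σ.int 10 = k) (h8 : σ.int 8 = b) (h9 : σ.int 9 = b * dₒ) {P : ℕ → ℝ}
    (hP : ∀ z < dₒ, σ.arr 8 z = P z) :
    Runs W updateBlock σ fun σ' =>
      (∀ z < dₒ, σ'.arr 8 z = (1 - 2 / ((k : ℝ) + 2)) * P z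
        + 2 / ((k : ℝ) + 2) * N.smoothOutput (1 / M) (σ.real 6) b z) ∧
      σ'.real 10 = (1 - 2 / ((k : ℝ) + 2)) * σ.real 10
        + 2 / ((k : ℝ) + 2) * N.inputCost (σ.real 6) b := by
  have hk2 : (k : ℝ) + 2 ≠ 0 := by positivity
  have hdef : (lit 2 / (.ofInt (.var 10) + lit 2) : RealExp).Defined σ := by
    simp [h10, hk2]
  refine Runs.setReal_seq hdef ?_
  -- The array is updated in place: entries below j are new, the others old. This is sound because
  -- each new entry depends only on the old entry at the same index.
  refine Runs.seq (Q := fun σ' => ∀ z < dₒ, σ'.arr 8 z = (1 - 2 / ((k : ℝ) + 2)) * P z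
        + 2 / ((k : ℝ) + 2) * N.smoothOutput (1 / M) (σ.real 6) b z)
    (Runs.forLoop (fun j σ' => ∀ z < dₒ, σ'.arr 8 z = if z < j then (1 - 2 / ((k : ℝ) + 2)) * P z
        + 2 / ((k : ℝ) + 2) * N.smoothOutput (1 / M) (σ.real 6) b z else P z)
      (by simpa [h.cardₒ] using hW) rfl rfl (by decide) ?_ ?_ ?_) ?_
  · intro z hz
    simp [hP z hz]
  · intro j σ' hj ha h7 hI
    have hj : j < dₒ := by simpa [h.cardₒ] using hj
    have ha' := ((Exec.setReal σ 11 _ hdef).agree).seq ha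
    have hC := h.of_agree ha' rfl
    have e9 : σ'.int 9 = b * dₒ := (ha'.int 9 rfl).trans h9
    have e6 : σ'.real 6 = σ.real 6 := ha'.real 6 rfl
    have e11 : σ'.real 11 = 2 / ((k : ℝ) + 2) := by
      rw [ha.real 11 rfl]; simp [h10]
    refine Runs.setElem (by simp [hC.defined_outputExp hdₒ]) fun z hz => ?_
    have hIj := hI j hj
    rw [if_neg (lt_irrefl j)] at hIj
    simp only [Store.arr_setInt, Store.arr_setElem, IntExp.val_var, h7, true_and,
      RealExp.val_add, RealExp.val_mul, RealExp.val_sub, RealExp.val_lit, RealExp.val_var, e11,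
      RealExp.val_elem, hIj, hC.val_outputExp e9 h7 hb hj, e6, Nat.cast_one]
    rcases lt_trichotomy z j with hzj | rfl | hzj
    · rw [if_neg hzj.ne, hI z hz, if_pos hzj, if_pos (by omega)]
    · rw [if_pos rfl, if_pos (by omega)]
    · rw [if_neg hzj.ne', hI z hz, if_neg (by omega), if_neg (by omega)]
  · intro σ' hI z hz
    have := hI z hz
    rwa [if_pos (by simpa [h.cardₒ] using hz)] at this
  · intro σ' ha hI
    have ha' := ((Exec.setReal σ 11 _ hdef).agree).seq ha
    have hC := h.of_agree ha' rfl
    have e8 : σ'.int 8 = b := (ha'.int 8 rfl).trans h8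
    have e6 : σ'.real 6 = σ.real 6 := ha'.real 6 rfl
    have e10 : σ'.real 10 = σ.real 10 := ha'.real 10 rfl
    have e11 : σ'.real 11 = 2 / ((k : ℝ) + 2) := by
      rw [ha.real 11 rfl]; simp [h10]
    refine Runs.setReal (by simp [defined_costExp]) ⟨hI, ?_⟩
    simp [hC.val_costExp e8 hb, e6, e10, e11]

theorem objectiveBlock_spec (h : Context N ε M T σ) (hd₁ : 0 < d₁) (hdₒ : 0 < dₒ) (hW : dₒ ≤ W)
    (hW₁ : d₁ ≤ W) (hWT : T ≤ W) (hM : 1 ≤ M) (hs : σ.real 6 ∈ Set.Icc (0 : ℝ) 1) :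
    Runs W objectiveBlock σ fun σ' => σ'.real 7 = N.approxObjective (1 / M) T (σ.real 6) := by
  have hl : Real.log 2 ≠ 0 := (Real.log_pos one_lt_two).ne'
  have hM' : (1 : ℝ) ≤ M := by exact_mod_cast hM
  have hlam : 1 / (M : ℝ) ≤ 1 := (div_le_one (by linarith)).2 hM'
  -- Smoothing keeps all entries positive, so every logarithm that is executed is defined.
  have hpos : ∀ k z, 0 < (N.frankWolfe (1 / M) (σ.real 6) k).1 z := fun k z =>
    lt_of_lt_of_le (by positivity) (N.div_le_frankWolfe hlam hs k z)
  refine Runs.seq (Q := fun σ' => ∀ z < dₒ, σ'.arr 8 z = 1 / (dₒ : ℝ))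
    (Runs.forLoop (fun k σ' => ∀ z < k, σ'.arr 8 z = 1 / (dₒ : ℝ))
      (by simpa [h.cardₒ] using hW) rfl rfl (by decide) (by simp) ?_ ?_) ?_
  · intro k σ' hk ha h7 hI
    have hC := h.of_agree ha rfl
    refine Runs.setElem (by simp [hC.cardₒ, hdₒ.ne']) fun z hz => ?_
    simp only [Store.arr_setInt, Store.arr_setElem, IntExp.val_var, h7, true_and]
    split_ifs with hzk
    · simp [hC.cardₒ]
    · exact hI z (by omega)
  · intro σ' hI
    simpa [h.cardₒ] using hI
  intro σ₁ ha₁ h8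
  have hC₁ := h.of_agree ha₁ rfl
  refine Runs.setReal_seq (by simp) ?_
  refine Runs.seq (Q := fun σ' => (∀ z < dₒ, σ'.arr 8 z = (N.frankWolfe (1 / M) (σ.real 6) T).1 z) ∧
      σ'.real 10 = (N.frankWolfe (1 / M) (σ.real 6) T).2)
    (Runs.forLoop (fun k σ' => (∀ z < dₒ, σ'.arr 8 z = (N.frankWolfe (1 / M) (σ.real 6) k).1 z) ∧
      σ'.real 10 = (N.frankWolfe (1 / M) (σ.real 6) k).2) (by simpa [hC₁.steps] using hWT)
      rfl rfl (by decide) ?_ ?_ ?_) ?_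
  · simpa [MAC.frankWolfe] using h8
  · rintro k σ' hk ha h10 ⟨hP, hc⟩
    have ha' := ((Exec.setReal σ₁ 10 (lit 0) (by simp)).agree).seq ha
    have hC := hC₁.of_agree ha' rfl
    have e6 : σ'.real 6 = σ.real 6 := (ha'.real 6 rfl).trans (ha₁.real 6 rfl)
    refine (argmaxBlock_spec hC hd₁ hdₒ hW hW₁ hP fun z _ => hpos k z).seq ?_
    rintro σ₂ ha₂ ⟨b8, b9⟩
    rw [e6] at b8 b9
    have hC₂ := hC.of_agree ha₂ rfl
    refine (updateBlock_spec hC₂ hdₒ hW (firstArgmax_lt _ hd₁) ((ha₂.int 10 rfl).trans h10) b8 b9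
      (fun z hz => (congrFun (ha₂.arr 8 rfl) z).trans (hP z hz))).imp ?_
    rintro σ₃ - ⟨c8, c10⟩
    rw [ha₂.real 6 rfl, e6] at c8 c10
    rw [ha₂.real 10 rfl, hc] at c10
    exact ⟨c8, c10⟩
  · intro σ' hI
    simpa [hC₁.steps] using hI
  rintro σ₂ ha₂ ⟨hP, hc⟩
  have hC₂ := (hC₁.of_agree (Exec.setReal σ₁ 10 (lit 0) (by simp)).agree rfl).of_agree ha₂ rfl
  refine Runs.setReal_seq (by simp) ?_
  refine Runs.forLoop (fun k σ' => σ'.real 7 = -(N.frankWolfe (1 / M) (σ.real 6) T).2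
      - ∑ z ∈ Finset.range k, (N.frankWolfe (1 / M) (σ.real 6) T).1 z
        * Real.log ((N.frankWolfe (1 / M) (σ.real 6) T).1 z) / Real.log 2)
    (by simpa [hC₂.cardₒ] using hW) rfl rfl (by decide) (by simp [hc]) ?_ ?_
  · intro k σ' hk ha h7 hI
    have hk : k < dₒ := by simpa [hC₂.cardₒ] using hk
    have ha' := ((Exec.setReal σ₂ 7 (lit 0 - .var 10) (by simp)).agree).seq ha
    have hC := hC₂.of_agree ha' rfl
    have e8 : σ'.arr 8 k = (N.frankWolfe (1 / M) (σ.real 6) T).1 k :=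
      (congrFun (ha'.arr 8 rfl) k).trans (hP k hk)
    refine Runs.setReal ?_ ?_
    · simp [h7, e8, hC.log_two, hl]
      simpa using hpos T k
    · simp only [Store.real_setInt, Store.real_setReal, if_true, RealExp.val_sub, RealExp.val_div,
        RealExp.val_mul, RealExp.val_log, RealExp.val_elem, RealExp.val_var, IntExp.val_var, hI, h7,
        e8, hC.log_two, Finset.sum_range_succ]
      ring
  · intro σ' hI
    have e : (σ₂.setReal 7 ((lit 0 - .var 10 : RealExp).val σ₂)).int 1 = dₒ := by simp [hC₂.cardₒ]
    rw [e] at hI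
    exact hI

end

end RAM

/-! ### Subadditivity of the modulus -/

theorem modifiedBinaryEntropy_nonneg {x : ℝ} (hx : 0 ≤ x) : 0 ≤ modifiedBinaryEntropy x := by
  have := modifiedBinaryEntropy_monotoneOn (Set.mem_Ici.2 le_rfl) (Set.mem_Ici.2 hx) hx
  rwa [modifiedBinaryEntropy_zero] at this

/-- A concave function vanishing at 0 is subadditive, which settles x + y ≤ 1/2. Beyond that the
left side is 1: either y ≥ 1/2 already gives 1, or x ≥ 1/2 - y and monotonicity reduces to the sum
1/2. -/
theorem modifiedBinaryEntropy_add_le {x y : ℝ} (hx : 0 ≤ x) (hy : 0 ≤ y) :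
    modifiedBinaryEntropy (x + y) ≤ modifiedBinaryEntropy x + modifiedBinaryEntropy y := by
  have hl : 0 < Real.log 2 := Real.log_pos one_lt_two
  have small : ∀ {x y : ℝ}, 0 ≤ x → 0 ≤ y → x + y ≤ 1 / 2 →
      modifiedBinaryEntropy (x + y) ≤ modifiedBinaryEntropy x + modifiedBinaryEntropy y := by
    intro x y hx hy hxy
    rcases (add_nonneg hx hy).eq_or_lt with h0 | h0
    · have h1 : x = 0 := by linarith
      have h2 : y = 0 := by linarith
      simp [h1, h2, modifiedBinaryEntropy_zero]
    have key : ∀ {u v : ℝ}, 0 ≤ u → 0 ≤ v → u + v = x + y →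
        u / (x + y) * Real.binEntropy (x + y) ≤ Real.binEntropy u := by
      intro u v hu hv huv
      have h := Real.strictConcave_binEntropy.concaveOn.2
        (Set.mem_Icc.2 ⟨h0.le, by linarith⟩ : x + y ∈ Set.Icc (0 : ℝ) 1)
        (Set.mem_Icc.2 ⟨le_rfl, zero_le_one⟩ : (0 : ℝ) ∈ Set.Icc (0 : ℝ) 1)
        (div_nonneg hu h0.le) (div_nonneg hv h0.le)
        (by rw [← add_div, huv, div_self h0.ne'])
      simp only [smul_eq_mul, mul_zero, add_zero, Real.binEntropy_zero] at h
      rwa [div_mul_cancel₀ _ h0.ne'] at h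
    have h1 := key hx hy rfl
    have h2 := key hy hx (add_comm y x)
    have h3 : x / (x + y) * Real.binEntropy (x + y) + y / (x + y) * Real.binEntropy (x + y)
        = Real.binEntropy (x + y) := by
      rw [← add_mul, ← add_div, div_self h0.ne', one_mul]
    rw [modifiedBinaryEntropy_eq, modifiedBinaryEntropy_eq, modifiedBinaryEntropy_eq, if_pos hxy,
      if_pos (by linarith), if_pos (by linarith), ← add_div]
    exact div_le_div_of_nonneg_right (by linarith) hl.le
  have big : ∀ z : ℝ, 1 / 2 ≤ z → modifiedBinaryEntropy z = 1 := by
    intro z hz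
    rw [modifiedBinaryEntropy_eq_min, min_eq_right (by linarith), Real.binEntropy_two_inv,
      div_self hl.ne']
  rcases le_total (x + y) (1 / 2) with h | h
  · exact small hx hy h
  rw [big _ h]
  have hx0 := modifiedBinaryEntropy_nonneg hx
  have hy0 := modifiedBinaryEntropy_nonneg hy
  rcases le_total (1 / 2) y with h2 | h2
  · rw [big y h2]; linarith
  · have h3 := small (by linarith : 0 ≤ 1 / 2 - y) hy (by linarith)
    rw [sub_add_cancel, big _ le_rfl] at h3
    have h4 := modifiedBinaryEntropy_monotoneOn (Set.mem_Ici.2 (by linarith : 0 ≤ 1 / 2 - y))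
      (Set.mem_Ici.2 hx) (by linarith)
    linarith

theorem MAC.modulus_add_le {B₁ B₂ Z : Type} [Fintype B₁] [Fintype B₂] [Fintype Z]
    (N : MAC B₁ B₂ Z) {x y : ℝ} (hx : 0 ≤ x) (hy : 0 ≤ y) :
    N.modulus (x + y) ≤ N.modulus x + N.modulus y := by
  have := modifiedBinaryEntropy_add_le (by positivity : 0 ≤ x / 2) (by positivity : 0 ≤ y / 2)
  rw [MAC.modulus_eq, MAC.modulus_eq, MAC.modulus_eq, add_div]
  linarith

/-! ### The loop body -/

namespace RAM

/-- Real variable 13 receives the modulus at twice the value of real variable 12. -/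
def modulusBlock : Cmd :=
  .setReal 13 (.var 4 * (lit 2 * .var 12)) ⨾
  .ite (.realLe (.var 12) (lit 0)) .skip
    (.ite (.realLe (.var 12) (lit 1 / lit 2))
      (.setReal 13 (.var 13 - .var 12 * .log (.var 12) / .var 3
        - (lit 1 - .var 12) * .log (lit 1 - .var 12) / .var 3))
      (.setReal 13 (.var 13 + lit 1)))

/-- Evaluate the two bounding functions of interval number `int 12` at the grid point number
`int 13`. -/
def candidateBlock : Cmd :=
  .setReal 17 (.elem 6 (.var 12) + (.elem 6 (.var 12 + .const 1) - .elem 6 (.var 12))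
    * .ofInt (.var 13) / .ofInt (.var 3)) ⨾
  .setReal 12 (.var 17 - .elem 6 (.var 12)) ⨾
  modulusBlock ⨾
  .setReal 15 (.elem 7 (.var 12) + .var 13) ⨾
  .setReal 12 (.elem 6 (.var 12 + .const 1) - .var 17) ⨾
  modulusBlock ⨾
  .setReal 16 (.elem 7 (.var 12 + .const 1) + .var 13)

/-- Find an approximate root in interval number `int 12`. -/
def rootBlock : Cmd :=
  .setInt 13 (.const 0) ⨾
  candidateBlock ⨾
  .loop (.neg (.realLe (.var 16 - .var 2 / lit 8) (.var 15)))
    (.setInt 13 (.var 13 + .const 1) ⨾ candidateBlock)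

/-- Find the best interval. -/
def bestBlock : Cmd :=
  forLoop 12 11 (
    rootBlock ⨾
    .ite (.neg (.both (.neg (.intLe (.var 12) (.const 0))) (.realLe (.var 15) (.var 18))))
      (.setReal 18 (.var 15) ⨾ .setReal 19 (.var 17) ⨾ .setInt 14 (.var 12)) .skip)

/-- Insert the new point into the sorted arrays. -/
def insertBlock : Cmd :=
  .setInt 16 (.var 11 - .var 14) ⨾
  forLoop 15 16 (
    .setElem 6 (.var 11 + .const 1 - .var 15) (.elem 6 (.var 11 - .var 15)) ⨾
    .setElem 7 (.var 11 + .const 1 - .var 15) (.elem 7 (.var 11 - .var 15))) ⨾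
  .setElem 6 (.var 14 + .const 1) (.var 19) ⨾
  .setElem 7 (.var 14 + .const 1) (.var 7)

section

variable {d₁ dₒ : ℕ} {N : MAC (Fin d₁) (Fin 2) (Fin dₒ)} {ε : ℝ} {M T W : ℕ} {σ : Store}

theorem modulusBlock_spec (h : Context N ε M T σ) (hu : 0 ≤ σ.real 12) :
    Runs W modulusBlock σ fun σ' => σ'.real 13 = N.modulus (2 * σ.real 12) := by
  have hl : Real.log 2 ≠ 0 := (Real.log_pos one_lt_two).ne'
  rw [MAC.modulus_eq, mul_div_cancel_left₀ _ (two_ne_zero' ℝ)]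
  refine Runs.setReal_seq (by simp) (Runs.ite (by simp) (fun h1 => ?_) fun h1 =>
    Runs.ite (by simp) (fun h2 => ?_) fun h2 => ?_)
  -- Zero is treated separately because the machine has no logarithm of 0.
  · have h1 : σ.real 12 ≤ 0 := by simpa using h1
    refine Runs.skip ?_
    simp [le_antisymm h1 hu, modifiedBinaryEntropy_zero]
  · have h1 : 0 < σ.real 12 := by simpa using h1
    have h2 : σ.real 12 ≤ 1 / 2 := by simpa using h2
    have h3 : σ.real 12 < 1 := by linarith
    refine Runs.setReal ?_ ?_
    · simp [h.log_two, hl, h1, h3]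
    · rw [modifiedBinaryEntropy, if_pos h2]
      simp only [Store.real_setReal, if_true, RealExp.val_sub, RealExp.val_div, RealExp.val_mul,
        RealExp.val_log, RealExp.val_var, RealExp.val_lit, Real.logb]
      norm_num [h.log_two, h.slope]
      ring
  · have h2 : ¬ σ.real 12 ≤ 1 / 2 := by simpa using h2
    refine Runs.setReal (by simp) ?_
    rw [modifiedBinaryEntropy, if_neg h2]
    simp [h.slope, Real.logb, hl]

/-- The grid point number `j` in the interval from `a` to `b`. -/
noncomputable def gridPoint (M : ℕ) (a b : ℝ) (j : ℕ) : ℝ := a + (b - a) * j / M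

theorem gridPoint_mem {a b : ℝ} (hab : a ≤ b) (hM : 1 ≤ M) {j : ℕ} (hj : j ≤ M) :
    gridPoint M a b j ∈ Set.Icc a b := by
  have hM' : (0 : ℝ) < M := by exact_mod_cast hM
  have hj' : (j : ℝ) ≤ M := by exact_mod_cast hj
  have h0 : 0 ≤ (b - a) * j / M :=
    div_nonneg (mul_nonneg (by linarith) (Nat.cast_nonneg _)) hM'.le
  have h1 : (b - a) * j / M ≤ b - a := by
    rw [div_le_iff₀ hM']
    exact mul_le_mul_of_nonneg_left hj' (by linarith)
  unfold gridPoint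
  constructor <;> linarith

theorem candidateBlock_spec (h : Context N ε M T σ) (hM : 1 ≤ M) {i j : ℕ} (hi : σ.int 12 = i)
    (hj : σ.int 13 = j) (hjM : j ≤ M) {f : ℝ → ℝ} {a b : ℝ} (hab : a ≤ b) (ha : σ.arr 6 i = a)
    (hb : σ.arr 6 (i + 1) = b) (hfa : σ.arr 7 i = f a) (hfb : σ.arr 7 (i + 1) = f b) :
    Runs W candidateBlock σ fun σ' =>
      σ'.real 17 = gridPoint M a b j ∧
      σ'.real 15 = boundingFn f N.modulus a (gridPoint M a b j) ∧
      σ'.real 16 = boundingFn f N.modulus b (gridPoint M a b j) := by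
  have hM' : (M : ℝ) ≠ 0 := by exact_mod_cast (by omega : M ≠ 0)
  obtain ⟨hr1, hr2⟩ := gridPoint_mem hab hM hjM
  have hd : (.elem 6 (.var 12) + (.elem 6 (.var 12 + .const 1) - .elem 6 (.var 12))
    * .ofInt (.var 13) / .ofInt (.var 3) : RealExp).Defined σ := by simp [h.grid]; omega
  refine Runs.seq (Q := fun σ' => σ'.real 17 = gridPoint M a b j)
    (Runs.setReal hd (by simp [gridPoint, hi, hj, ha, hb, h.grid])) fun σ₁ h₁ e17 => ?_
  have hC₁ := h.of_agree h₁ rfl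
  refine Runs.seq (Q := fun σ' => σ'.real 12 = gridPoint M a b j - a)
    (Runs.setReal (by simp) (by simp [e17, h₁.int 12 rfl, h₁.arr 6 rfl, hi, ha])) fun σ₂ h₂ e12 => ?_
  have hC₂ := hC₁.of_agree h₂ rfl
  refine (modulusBlock_spec hC₂ (by rw [e12]; linarith)).seq fun σ₃ h₃ e13 => ?_
  have hC₃ := hC₂.of_agree h₃ rfl
  refine Runs.seq (Q := fun σ' => σ'.real 15 = boundingFn f N.modulus a (gridPoint M a b j))
    (Runs.setReal (by simp) ?_) fun σ₄ h₄ e15 => ?_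
  · rw [boundingFn, abs_of_nonneg (by linarith), ← e12, ← e13, ← hfa]
    simp [h₃.int 12 rfl, h₂.int 12 rfl, h₁.int 12 rfl, h₃.arr 7 rfl, h₂.arr 7 rfl, h₁.arr 7 rfl, hi]
  have hC₄ := hC₃.of_agree h₄ rfl
  refine Runs.seq (Q := fun σ' => σ'.real 12 = b - gridPoint M a b j)
    (Runs.setReal (by simp) ?_) fun σ₅ h₅ e12' => ?_
  · simp [h₄.int 12 rfl, h₃.int 12 rfl, h₂.int 12 rfl, h₁.int 12 rfl, h₄.arr 6 rfl, h₃.arr 6 rfl,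
      h₂.arr 6 rfl, h₁.arr 6 rfl, hi, hb, h₄.real 17 rfl, h₃.real 17 rfl, h₂.real 17 rfl, e17]
  have hC₅ := hC₄.of_agree h₅ rfl
  refine (modulusBlock_spec hC₅ (by rw [e12']; linarith)).seq fun σ₆ h₆ e13' => ?_
  refine Runs.setReal (by simp) ⟨?_, ?_, ?_⟩
  · simp [h₆.real 17 rfl, h₅.real 17 rfl, h₄.real 17 rfl, h₃.real 17 rfl, h₂.real 17 rfl, e17]
  · simp [h₆.real 15 rfl, h₅.real 15 rfl, e15]
  · rw [boundingFn, abs_sub_comm, abs_of_nonneg (by linarith), ← e12', ← e13', ← hfb]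
    simp [h₆.int 12 rfl, h₅.int 12 rfl, h₄.int 12 rfl, h₃.int 12 rfl, h₂.int 12 rfl, h₁.int 12 rfl,
      h₆.arr 7 rfl, h₅.arr 7 rfl, h₄.arr 7 rfl, h₃.arr 7 rfl, h₂.arr 7 rfl, h₁.arr 7 rfl, hi]

/-- One grid step moves the point by at most 1/M, so by subadditivity F_a rises and F_b falls by at
most η each. -/
theorem boundingFn_gridPoint_succ_sub_le (hdₒ : 2 ≤ dₒ) (hd₁ : 0 < d₁) (hM : 1 ≤ M) {η : ℝ}
    (hη : N.modulus (2 * (1 / M)) ≤ η) {f : ℝ → ℝ} {a b : ℝ} (hab : a ≤ b) (hba : b ≤ a + 1)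
    {j : ℕ} (hj : j + 1 ≤ M) :
    boundingFn f N.modulus a (gridPoint M a b (j + 1))
      - boundingFn f N.modulus b (gridPoint M a b (j + 1))
      ≤ boundingFn f N.modulus a (gridPoint M a b j)
        - boundingFn f N.modulus b (gridPoint M a b j) + 2 * η := by
  have : Nonempty (Fin d₁) := ⟨⟨0, hd₁⟩⟩
  have hM' : (0 : ℝ) < M := by exact_mod_cast hM
  obtain ⟨h1, h2⟩ := gridPoint_mem hab hM (by omega : j ≤ M)
  obtain ⟨h3, h4⟩ := gridPoint_mem hab hM hj
  set r := gridPoint M a b j with hr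
  set r' := gridPoint M a b (j + 1) with hr'
  have hd : r' - r = (b - a) / M := by
    rw [hr, hr', gridPoint, gridPoint]; push_cast; ring
  have hd0 : 0 ≤ r' - r := by rw [hd]; exact div_nonneg (by linarith) hM'.le
  have hd1 : r' - r ≤ 1 / M := by
    rw [hd]; exact div_le_div_of_nonneg_right (by linarith) hM'.le
  have hmod : N.modulus (2 * (r' - r)) ≤ η :=
    (N.modulus_monotoneOn (by simpa using hdₒ) (Set.mem_Ici.2 (by linarith))
      (Set.mem_Ici.2 (by positivity)) (by linarith)).trans hη
  have e1 := N.modulus_add_le (by linarith : 0 ≤ 2 * (r - a)) (by linarith : 0 ≤ 2 * (r' - r))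
  have e2 := N.modulus_add_le (by linarith : 0 ≤ 2 * (b - r')) (by linarith : 0 ≤ 2 * (r' - r))
  rw [show 2 * (r - a) + 2 * (r' - r) = 2 * (r' - a) by ring] at e1
  rw [show 2 * (b - r') + 2 * (r' - r) = 2 * (b - r) by ring] at e2
  simp only [boundingFn]
  rw [abs_sub_comm r' b, abs_sub_comm r b, abs_of_nonneg (by linarith : 0 ≤ r' - a),
    abs_of_nonneg (by linarith : 0 ≤ r - a), abs_of_nonneg (by linarith : 0 ≤ b - r'),
    abs_of_nonneg (by linarith : 0 ≤ b - r)]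
  linarith

/-- A discrete intermediate value theorem with η = min ε 1 / 8. The difference F_a - F_b is at most
η at a, at least -η at b, and grows by at most 2η per step; the first grid point where it reaches -η
thus finds it in [-η, η]. The slack in the last two hypotheses allows for an inexact objective. -/
theorem rootBlock_spec (h : Context N ε M T σ) (hd₁ : 0 < d₁) (hdₒ : 2 ≤ dₒ) (hM : 1 ≤ M)
    (hW : M ≤ W) (hη : N.modulus (2 * (1 / M)) ≤ min ε 1 / 8) {i : ℕ} (hi : σ.int 12 = i)
    {f : ℝ → ℝ} {a b : ℝ} (hab : a ≤ b) (hba : b ≤ a + 1) (ha : σ.arr 6 i = a)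
    (hb : σ.arr 6 (i + 1) = b) (hfa : σ.arr 7 i = f a) (hfb : σ.arr 7 (i + 1) = f b)
    (hab' : f a ≤ f b + N.modulus (2 * |a - b|) + min ε 1 / 8)
    (hba' : f b ≤ f a + N.modulus (2 * |b - a|) + min ε 1 / 8) :
    Runs W rootBlock σ fun σ' => ∃ r ∈ Set.Icc a b,
      |boundingFn f N.modulus a r - boundingFn f N.modulus b r| ≤ min ε 1 / 8 ∧
      σ'.real 17 = r ∧ σ'.real 15 = boundingFn f N.modulus a r := by
  have hM' : (M : ℝ) ≠ 0 := by exact_mod_cast (by omega : M ≠ 0)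
  have g0 : gridPoint M a b 0 = a := by simp [gridPoint]
  have gM : gridPoint M a b M = b := by simp [gridPoint, hM']
  refine Runs.setInt_seq ?_
  have hag := (Exec.setInt σ 13 (.const 0)).agree
  refine (candidateBlock_spec (h.of_agree hag rfl) hM (i := i) (j := 0) (by simpa using hi)
    (by simp) (Nat.zero_le _) (f := f) hab ha hb hfa hfb).seq ?_
  rintro σ₁ h₁ ⟨e17, e15, e16⟩
  have e13 : σ₁.int 13 = 0 := (h₁.int 13 rfl).trans (by simp)
  have h₁ := hag.seq h₁
  have hC₁ := h.of_agree h₁ rfl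
  refine Runs.loop (fun k σ' => k ≤ M ∧ σ'.int 13 = k ∧ σ'.real 17 = gridPoint M a b k ∧
    σ'.real 15 = boundingFn f N.modulus a (gridPoint M a b k) ∧
    σ'.real 16 = boundingFn f N.modulus b (gridPoint M a b k) ∧
    boundingFn f N.modulus a (gridPoint M a b k)
      ≤ boundingFn f N.modulus b (gridPoint M a b k) + min ε 1 / 8) ?_ ?_ ?_
  · refine ⟨Nat.zero_le _, e13, e17, e15, e16, ?_⟩
    rw [g0]
    simp only [boundingFn, sub_self, abs_zero, mul_zero, N.modulus_zero]
    linarith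
  · rintro k σ' h₂ ⟨hk, b13, b17, b15, b16, hle⟩
    have hC₂ := hC₁.of_agree h₂ rfl
    refine ⟨by simp, fun hh => ?_⟩
    have hh : boundingFn f N.modulus a (gridPoint M a b k)
        + min ε 1 / 8 < boundingFn f N.modulus b (gridPoint M a b k) := by
      simpa [b15, b16, hC₂.cutoff] using hh
    have hlt : k < M := by
      -- At the last grid point, b itself, the search must have stopped.
      refine lt_of_le_of_ne hk fun he => ?_
      rw [he, gM] at hh
      simp only [boundingFn, sub_self, abs_zero, mul_zero, N.modulus_zero] at hh
      linarith
    refine ⟨hlt.trans_le hW, Runs.setInt_seq ?_⟩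
    have h₃ := (Exec.setInt σ' 13 (.var 13 + .const 1)).agree
    refine (candidateBlock_spec (hC₂.of_agree h₃ rfl) hM (i := i) (j := k + 1) ?_ ?_ hlt
      (f := f) hab ?_ ?_ ?_ ?_).imp ?_
    · rw [h₃.int 12 rfl, h₂.int 12 rfl, h₁.int 12 rfl, hi]
    · simp [b13]
    · rw [h₃.arr 6 rfl, h₂.arr 6 rfl, h₁.arr 6 rfl, ha]
    · rw [h₃.arr 6 rfl, h₂.arr 6 rfl, h₁.arr 6 rfl, hb]
    · rw [h₃.arr 7 rfl, h₂.arr 7 rfl, h₁.arr 7 rfl, hfa]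
    · rw [h₃.arr 7 rfl, h₂.arr 7 rfl, h₁.arr 7 rfl, hfb]
    · rintro σ'' h₄ ⟨c17, c15, c16⟩
      refine ⟨hlt, ?_, c17, c15, c16, ?_⟩
      · rw [h₄.int 13 rfl]; simp [b13]
      · have := boundingFn_gridPoint_succ_sub_le hdₒ hd₁ hM hη (f := f) hab hba hlt
        linarith
  · rintro k σ' h₂ ⟨hk, b13, b17, b15, b16, hle⟩ hh
    have hC₂ := hC₁.of_agree h₂ rfl
    have hh : boundingFn f N.modulus b (gridPoint M a b k) - min ε 1 / 8
        ≤ boundingFn f N.modulus a (gridPoint M a b k) := by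
      simpa [b15, b16, hC₂.cutoff] using hh
    exact ⟨_, gridPoint_mem hab hM hk, abs_le.2 ⟨by linarith, by linarith⟩, b17, b15⟩

/-- Only the best root stays in memory, so the invariant rebuilds the whole family of roots,
extending it by `Function.update` at each interval. Interval 0 is always accepted, whatever real
variable 18 held before. -/
theorem bestBlock_spec (h : Context N ε M T σ) (hd₁ : 0 < d₁) (hdₒ : 2 ≤ dₒ) (hM : 1 ≤ M)
    (hW : M ≤ W) (hη : N.modulus (2 * (1 / M)) ≤ min ε 1 / 8) {f : ℝ → ℝ} {n : ℕ} {X : ℕ → ℝ}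
    (h11 : σ.int 11 = n + 1) (hnW : n + 1 ≤ W) (hX : ∀ i ≤ n + 1, σ.arr 6 i = X i)
    (hF : ∀ i ≤ n + 1, σ.arr 7 i = f (X i)) (hsort : ∀ i ≤ n, X i ≤ X (i + 1))
    (h01 : ∀ i ≤ n + 1, X i ∈ Set.Icc (0 : ℝ) 1)
    (hf : ∀ s ∈ Set.Icc (0 : ℝ) 1, ∀ t ∈ Set.Icc (0 : ℝ) 1,
      f s ≤ f t + N.modulus (2 * |s - t|) + min ε 1 / 8) :
    Runs W bestBlock σ fun σ' => ∃ (root : ℕ → ℝ) (m : ℕ), m ≤ n ∧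
      (∀ i ≤ n, root i ∈ Set.Icc (X i) (X (i + 1)) ∧
        |boundingFn f N.modulus (X i) (root i) - boundingFn f N.modulus (X (i + 1)) (root i)|
          ≤ min ε 1 / 8 ∧
        boundingFn f N.modulus (X i) (root i) ≤ boundingFn f N.modulus (X m) (root m)) ∧
      σ'.int 14 = m ∧ σ'.real 19 = root m ∧
      σ'.real 18 = boundingFn f N.modulus (X m) (root m) := by
  refine Runs.forLoop (fun k σ' => ∃ root : ℕ → ℝ,
    (∀ i < k, root i ∈ Set.Icc (X i) (X (i + 1)) ∧
      |boundingFn f N.modulus (X i) (root i) - boundingFn f N.modulus (X (i + 1)) (root i)|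
        ≤ min ε 1 / 8 ∧ boundingFn f N.modulus (X i) (root i) ≤ σ'.real 18) ∧
    (0 < k → ∃ m < k, σ'.int 14 = m ∧ σ'.real 19 = root m ∧
      σ'.real 18 = boundingFn f N.modulus (X m) (root m))) (by omega) rfl rfl (by decide)
    ⟨fun _ => 0, by simp, by simp⟩ ?_ ?_
  · rintro k σ₀ hk ha h12 ⟨root, hroot, hm⟩
    have hk : k ≤ n := by omega
    have hC := h.of_agree ha rfl
    refine (rootBlock_spec hC hd₁ hdₒ hM hW hη h12 (f := f) (hsort k hk)
      (by linarith [(h01 k (by omega)).1, (h01 (k + 1) (by omega)).2])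
      ((congrFun (ha.arr 6 rfl) k).trans (hX k (by omega)))
      ((congrFun (ha.arr 6 rfl) (k + 1)).trans (hX (k + 1) (by omega)))
      ((congrFun (ha.arr 7 rfl) k).trans (hF k (by omega)))
      ((congrFun (ha.arr 7 rfl) (k + 1)).trans (hF (k + 1) (by omega)))
      (hf _ (h01 k (by omega)) _ (h01 (k + 1) (by omega)))
      (hf _ (h01 (k + 1) (by omega)) _ (h01 k (by omega)))).seq ?_
    rintro σ₁ h₁ ⟨r, hr, hres, e17, e15⟩
    have e12 : σ₁.int 12 = k := (h₁.int 12 rfl).trans h12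
    have hold : ∀ i < k, Function.update root k r i = root i := fun i hi =>
      Function.update_of_ne hi.ne _ _
    have hnew : Function.update root k r k = r := Function.update_self _ _ _
    refine Runs.ite (by simp) (fun hh => ?_) fun hh => ?_
    · refine Runs.setReal_seq trivial (Runs.setReal_seq trivial (Runs.setInt ?_))
      refine ⟨Function.update root k r, fun i hi => ?_, fun _ => ⟨k, Nat.lt_succ_self k, ?_⟩⟩
      · rcases Nat.lt_succ_iff_lt_or_eq.1 hi with hi | rfl
        · rw [hold i hi]
          obtain ⟨a1, a2, a3⟩ := hroot i hi
          refine ⟨a1, a2, ?_⟩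
          have hk0 : k ≠ 0 := by omega
          have : σ₁.real 18 < σ₁.real 15 := by simpa [e12, hk0] using hh
          rw [h₁.real 18 rfl] at this
          simp only [Store.real_setInt, Store.real_setReal]
          norm_num
          linarith
        · rw [hnew]
          refine ⟨hr, hres, ?_⟩
          simp [e15]
      · rw [hnew]
        simp [e12, e17, e15]
    · simp only [Test.holds_neg, Test.holds_both, Test.holds_intLe, Test.holds_realLe, not_not,
        IntExp.val_var, IntExp.val_const, RealExp.val_var, e12] at hh
      obtain ⟨m, hmk, b14, b19, b18⟩ := hm (by omega)
      refine Runs.skip ⟨Function.update root k r, fun i hi => ?_, fun _ => ⟨m, by omega, ?_⟩⟩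
      · rcases Nat.lt_succ_iff_lt_or_eq.1 hi with hi | rfl
        · rw [hold i hi]
          obtain ⟨a1, a2, a3⟩ := hroot i hi
          refine ⟨a1, a2, ?_⟩
          simpa [h₁.real 18 rfl] using a3
        · rw [hnew]
          refine ⟨hr, hres, ?_⟩
          rw [← e15]
          simpa using hh.2
      · rw [hold m hmk]
        simp [h₁.int 14 rfl, h₁.real 18 rfl, h₁.real 19 rfl, b14, b19, b18]
  · rintro σ' ⟨root, hroot, hm⟩
    rw [h11] at hroot hm
    obtain ⟨m, hmk, b14, b19, b18⟩ := hm (by omega)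
    refine ⟨root, m, by omega, fun i hi => ?_, b14, b19, b18⟩
    rw [← b18]
    exact hroot i (by omega)

theorem insertBlock_spec {n m : ℕ} (hm : m ≤ n) (h11 : σ.int 11 = n + 1) (h14 : σ.int 14 = m)
    (hW : n + 1 ≤ W) {f : ℝ → ℝ} {X : ℕ → ℝ} {r : ℝ} (hr : σ.real 19 = r) (hfr : σ.real 7 = f r)
    (hX : ∀ i ≤ n + 1, σ.arr 6 i = X i) (hF : ∀ i ≤ n + 1, σ.arr 7 i = f (X i)) :
    Runs W insertBlock σ fun σ' => ∀ i ≤ n + 2,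
      (σ'.arr 6 i = if i ≤ m then X i else if i = m + 1 then r else X (i - 1)) ∧
      (σ'.arr 7 i = f (if i ≤ m then X i else if i = m + 1 then r else X (i - 1))) := by
  refine Runs.setInt_seq ?_
  have hag := (Exec.setInt σ 16 (.var 11 - .var 14)).agree
  have e16 : (σ.setInt 16 ((IntExp.var 11 - .var 14).val σ)).int 16 = n + 1 - m := by
    simp [h11, h14]
  -- Entries are shifted from the top down, so none is lost. After k shifts slot n + 2 - k is free
  -- and left unspecified; at the end it is slot m + 1, where the new point goes.
  refine Runs.seq (Q := fun σ' => ∀ i ≤ n + 2, i ≠ m + 1 →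
      (σ'.arr 6 i = if i ≤ m then X i else X (i - 1)) ∧
      (σ'.arr 7 i = f (if i ≤ m then X i else X (i - 1))))
    (Runs.forLoop (fun k σ' => (∀ i, i ≤ n + 1 - k → σ'.arr 6 i = X i ∧ σ'.arr 7 i = f (X i)) ∧
      ∀ i, n + 2 - k < i → i ≤ n + 2 → σ'.arr 6 i = X (i - 1) ∧ σ'.arr 7 i = f (X (i - 1)))
      (by rw [e16]; omega) rfl rfl (by decide) ?_ ?_ ?_) ?_
  · refine ⟨fun i hi => ⟨hX i (by omega), hF i (by omega)⟩, fun i h1 h2 => by omega⟩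
  · rintro k σ' hk ha h15 ⟨hlow, hhigh⟩
    rw [e16] at hk
    have e11 : σ'.int 11 = n + 1 := (ha.int 11 rfl).trans h11
    refine Runs.setElem_seq trivial (Runs.setElem trivial ?_)
    simp only [Store.arr_setInt, Store.arr_setElem, Store.int_setElem, IntExp.val_sub,
      IntExp.val_add, IntExp.val_var, IntExp.val_const, RealExp.val_elem, e11, h15]
    obtain ⟨a6, a7⟩ := hlow (n + 1 - k) le_rfl
    refine ⟨fun i hi => ?_, fun i h1 h2 => ?_⟩
    · have hne : i ≠ n + 1 + 1 - k := by omega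
      simp [hne, hlow i (by omega)]
    · by_cases he : i = n + 1 + 1 - k
      · have e : i - 1 = n + 1 - k := by omega
        rw [e]
        simp [he, a6, a7]
      · simp [he, hhigh i (by omega) h2]
  · rintro σ' ⟨hlow, hhigh⟩ i hi hne
    rw [e16] at hlow hhigh
    split_ifs with h
    · exact hlow i (by omega)
    · exact hhigh i (by omega) hi
  · intro σ' ha hI
    have ha' := hag.seq ha
    refine Runs.setElem_seq trivial (Runs.setElem trivial ?_)
    intro i hi
    simp only [Store.arr_setElem, Store.int_setElem, Store.real_setElem, IntExp.val_add,
      IntExp.val_var, IntExp.val_const, RealExp.val_var, ha'.int 14 rfl, h14, ha'.real 19 rfl, hr,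
      ha'.real 7 rfl, hfr]
    by_cases he : i = m + 1
    · have : ¬ i ≤ m := by omega
      simp [he]
    · simp [he, hI i hi he]

end

end RAM

/-! ### Preparation of the parameters and tables -/

namespace RAM

/-- Integer variable `x` receives the least natural number that is at least `u`. -/
def ceilBlock (x : ℕ) (u : RealExp) : Cmd :=
  .setInt x (.const 0) ⨾
  .loop (.neg (.realLe u (.ofInt (.var x)))) (.setInt x (.var x + .const 1))

/-- Add to real variable `r` the contribution of an entry of array `a` to the entropy. -/
def entropyTermBlock (a r : ℕ) : Cmd :=
  .ite (.realLe (.elem a (.var 5 + .var 7)) (lit 0)) .skip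
    (.setReal r (.var r - .elem a (.var 5 + .var 7) * .log (.elem a (.var 5 + .var 7)) / .var 3))

def maxBlock (r : ℕ) : Cmd :=
  .ite (.realLe (.var r) (.var 4)) .skip (.setReal 4 (.var r))

/-- Tabulate the entropies, and compute their maximum. -/
def entropyBlock : Cmd :=
  .setInt 5 (.const 0) ⨾
  .setReal 4 (lit 0) ⨾
  forLoop 6 0 (
    .setReal 8 (lit 0) ⨾
    .setReal 9 (lit 0) ⨾
    forLoop 7 1 (entropyTermBlock 0 8 ⨾ entropyTermBlock 1 9) ⨾
    .setElem 4 (.var 6) (.var 8) ⨾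
    .setElem 5 (.var 6) (.var 9) ⨾
    maxBlock 8 ⨾
    maxBlock 9 ⨾
    .setInt 5 (.var 5 + .var 1))

def gridExp : RealExp :=
  lit 128 * .ofInt (.var 1) / .var 2 * (lit 128 * .ofInt (.var 1) / .var 2)

def stepsExp : RealExp := lit 256 * .ofInt (.var 1) * .ofInt (.var 3) / .var 2

/-- Real variable 4 first holds the maximal output entropy and is turned into the slope by the last
command. -/
def prepareBlock : Cmd :=
  .setReal 3 (.log (lit 2)) ⨾
  .ite (.realLe (.var 0) (lit 1)) (.setReal 2 (.var 0)) (.setReal 2 (lit 1)) ⨾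
  ceilBlock 3 gridExp ⨾
  ceilBlock 4 stepsExp ⨾
  .setReal 5 (lit 1 / .ofInt (.var 3)) ⨾
  entropyBlock ⨾
  .setReal 4 (lit 1 / lit 2 * (.log (.ofInt (.var 1) - lit 1) / .var 3) + .var 4)

section

variable {d₁ dₒ : ℕ} {N : MAC (Fin d₁) (Fin 2) (Fin dₒ)} {ε : ℝ} {M T W : ℕ} {σ : Store}

/-- The machine cannot round, so the ceiling is found by counting up, which is affordable as it is
at most W. -/
theorem ceilBlock_spec {x : ℕ} {u : RealExp} {v : ℝ} (hW : ⌈v⌉₊ ≤ W)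
    (hu : ∀ σ' : Store, (∀ y ≠ x, σ'.int y = σ.int y) → σ'.real = σ.real →
      u.Defined σ' ∧ u.val σ' = v) :
    Runs W (ceilBlock x u) σ fun σ' => σ'.int x = ⌈v⌉₊ := by
  refine Runs.setInt_seq (Runs.loop (fun k σ' => σ'.int x = k ∧ k ≤ ⌈v⌉₊) (by simp) ?_ ?_)
  · rintro k σ' ha ⟨hx, hk⟩
    obtain ⟨hd, hv⟩ := hu σ' (fun y hy => by
      rw [ha.int y (by simp [Cmd.writesInt, hy.symm])]; simp [hy]) (funext fun y => ha.real y rfl)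
    refine ⟨by simp [hd], fun hh => ?_⟩
    have hlt : k < ⌈v⌉₊ := Nat.lt_ceil.2 (by simpa [hv, hx] using hh)
    exact ⟨hlt.trans_le hW, Runs.setInt ⟨by simp [hx], hlt⟩⟩
  · rintro k σ' ha ⟨hx, hk⟩ hh
    obtain ⟨hd, hv⟩ := hu σ' (fun y hy => by
      rw [ha.int y (by simp [Cmd.writesInt, hy.symm])]; simp [hy]) (funext fun y => ha.real y rfl)
    have : v ≤ k := by simpa [hv, hx] using hh
    rw [hx]
    exact le_antisymm hk (Nat.ceil_le.2 this)

theorem entropyTermBlock_spec {a r : ℕ} (h3 : σ.real 3 = Real.log 2) {p : ℝ} (hp : 0 ≤ p)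
    (ha : σ.arr a (σ.int 5 + σ.int 7) = p) :
    Runs W (entropyTermBlock a r) σ fun σ' =>
      σ'.real r = σ.real r + Real.negMulLog p / Real.log 2 := by
  have hl : Real.log 2 ≠ 0 := (Real.log_pos one_lt_two).ne'
  refine Runs.ite (by simp) (fun hh => Runs.skip ?_) fun hh => Runs.setReal ?_ ?_
  · have : p ≤ 0 := by simpa [ha] using hh
    simp [le_antisymm this hp]
  · have : 0 < p := by simpa [ha] using hh
    simp [ha, h3, this, hl]
  · simp [ha, h3, Real.negMulLog]
    ring

theorem maxBlock_spec {r : ℕ} :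
    Runs W (maxBlock r) σ fun σ' => σ'.real 4 = max (σ.real 4) (σ.real r) := by
  refine Runs.ite (by simp) (fun hh => Runs.skip ?_) fun hh => Runs.setReal trivial ?_
  · rw [max_eq_left (by simpa using hh)]
  · have : σ.real 4 < σ.real r := by simpa using hh
    rw [max_eq_right this.le]
    simp

theorem _root_.MAC.sum_entry_eq (N : MAC (Fin d₁) (Fin 2) (Fin dₒ)) (i : Fin 2) {b : ℕ}
    (hb : b < d₁) :
    ∑ z ∈ Finset.range dₒ, Real.negMulLog (N.entry i b z) / Real.log 2 = N.entropyAt i b := by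
  have h := N.entropyAt_fin i ⟨b, hb⟩
  rw [Finset.sum_range (fun z => Real.negMulLog (N.entry i b z) / Real.log 2)]
  simp only at h
  rw [h, shannonEntropy_eq_div, ← Finset.sum_div]
  congr 1
  exact Finset.sum_congr rfl fun z _ => by rw [← N.entry_fin i ⟨b, hb⟩ z]

theorem entropyBlock_spec (hd₁ : 0 < d₁) (hW : dₒ ≤ W) (hW₁ : d₁ ≤ W) (h0 : σ.int 0 = d₁)
    (h1 : σ.int 1 = dₒ) (h3 : σ.real 3 = Real.log 2)
    (he₀ : ∀ b z, b < d₁ → z < dₒ → σ.arr 0 (b * dₒ + z) = N.entry 0 b z)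
    (he₁ : ∀ b z, b < d₁ → z < dₒ → σ.arr 1 (b * dₒ + z) = N.entry 1 b z) :
    Runs W entropyBlock σ fun σ' => (∀ b < d₁, σ'.arr 4 b = N.entropyAt 0 b) ∧
      (∀ b < d₁, σ'.arr 5 b = N.entropyAt 1 b) ∧ σ'.real 4 = N.maxOutputEntropy := by
  have : Nonempty (Fin d₁) := ⟨⟨0, hd₁⟩⟩
  have hle : ∀ (i : Fin 2) b, b < d₁ → N.entropyAt i b ≤ N.maxOutputEntropy := fun i b hb => by
    have := N.entropy_le_max ⟨b, hb⟩ i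
    rwa [← N.entropyAt_fin] at this
  refine Runs.setInt_seq (Runs.setReal_seq (by simp) ?_)
  have hag := ((Exec.setInt σ 5 (.const 0)).agree).seq
    (Exec.setReal (σ.setInt 5 0) 4 (lit 0) (by simp)).agree
  -- The running maximum is bracketed: above all entropies seen, below the true maximum. Starting at
  -- 0 is safe since entropies are nonnegative.
  refine Runs.forLoop (fun k σ' => σ'.int 5 = k * dₒ ∧ (∀ b < k, σ'.arr 4 b = N.entropyAt 0 b) ∧
    (∀ b < k, σ'.arr 5 b = N.entropyAt 1 b) ∧
    (∀ b < k, N.entropyAt 0 b ≤ σ'.real 4 ∧ N.entropyAt 1 b ≤ σ'.real 4) ∧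
    σ'.real 4 ≤ N.maxOutputEntropy) (by simpa [h0] using hW₁) rfl rfl (by decide)
    (by simp [N.maxOutputEntropy_nonneg]) ?_ ?_
  · rintro k σ' hk ha h6 ⟨h5, i4, i5, imax, ile⟩
    have hk : k < d₁ := by simpa [h0] using hk
    have ha := hag.seq ha
    have e1 : σ'.int 1 = dₒ := (ha.int 1 rfl).trans h1
    refine Runs.setReal_seq (by simp) (Runs.setReal_seq (by simp) ?_)
    have hag' := ((Exec.setReal σ' 8 (lit 0) (by simp)).agree).seq
      (Exec.setReal (σ'.setReal 8 ((lit 0).val σ')) 9 (lit 0) (by simp)).agree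
    refine Runs.seq (Q := fun σ₁ => σ₁.real 8 = N.entropyAt 0 k ∧ σ₁.real 9 = N.entropyAt 1 k)
      (Runs.forLoop (fun j σ₁ =>
        σ₁.real 8 = ∑ z ∈ Finset.range j, Real.negMulLog (N.entry 0 k z) / Real.log 2 ∧
        σ₁.real 9 = ∑ z ∈ Finset.range j, Real.negMulLog (N.entry 1 k z) / Real.log 2)
        (by simpa [e1] using hW) rfl rfl (by decide) (by simp) ?_ ?_) ?_
    · rintro j σ₁ hj hb h7 ⟨a8, a9⟩
      have hj : j < dₒ := by simpa [e1] using hj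
      have hb := hag'.seq hb
      have b5 : σ₁.int 5 = k * dₒ := (hb.int 5 rfl).trans h5
      have b3 : σ₁.real 3 = Real.log 2 := by rw [hb.real 3 rfl, ha.real 3 rfl, h3]
      refine (entropyTermBlock_spec b3 (N.entry_nonneg 0 k j) (by
        rw [b5, h7, hb.arr 0 rfl, ha.arr 0 rfl]; exact he₀ k j hk hj)).seq fun σ₂ hc c8 => ?_
      refine (entropyTermBlock_spec ((hc.real 3 rfl).trans b3) (N.entry_nonneg 1 k j) (by
        rw [hc.int 5 rfl, hc.int 7 rfl, b5, h7, hc.arr 1 rfl, hb.arr 1 rfl, ha.arr 1 rfl]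
        exact he₁ k j hk hj)).imp fun σ₃ hd c9 => ?_
      refine ⟨?_, ?_⟩
      · rw [Finset.sum_range_succ, ← a8, ← c8]
        exact hd.real 8 rfl
      · rw [Finset.sum_range_succ, ← a9]
        exact c9.trans (by rw [hc.real 9 rfl])
    · rintro σ₁ ⟨a8, a9⟩
      have e : ((σ'.setReal 8 ((lit 0).val σ')).setReal 9
        ((lit 0).val (σ'.setReal 8 ((lit 0).val σ')))).int 1 = dₒ := by simp [e1]
      rw [e] at a8 a9
      exact ⟨a8.trans (N.sum_entry_eq 0 hk), a9.trans (N.sum_entry_eq 1 hk)⟩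
    · rintro σ₁ hb ⟨a8, a9⟩
      have hb := hag'.seq hb
      refine Runs.setElem_seq trivial (Runs.setElem_seq trivial ?_)
      have b6 : σ₁.int 6 = k := (hb.int 6 rfl).trans h6
      refine maxBlock_spec.seq fun σ₂ hc c4 => maxBlock_spec.seq fun σ₃ hd d4 => Runs.setInt ?_
      have c4 : σ₂.real 4 = max (σ'.real 4) (N.entropyAt 0 k) := by
        rw [c4]; simp [a8, hb.real 4 rfl]
      have c9 : σ₂.real 9 = N.entropyAt 1 k := by rw [hc.real 9 rfl]; simp [a9]
      rw [c4, c9] at d4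
      refine ⟨?_, fun b hb' => ?_, fun b hb' => ?_, fun b hb' => ?_, ?_⟩
      · simp [hd.int 5 rfl, hc.int 5 rfl, hd.int 1 rfl, hc.int 1 rfl, hb.int 5 rfl, hb.int 1 rfl,
          h5, e1, Nat.succ_mul]
      · simp only [Store.arr_setInt, hd.arr 4 rfl, hc.arr 4 rfl, Store.arr_setElem]
        simp only [IntExp.val_var, Store.int_setElem, b6, RealExp.val_var, a8, hb.arr 4 rfl]
        rcases Nat.lt_succ_iff_lt_or_eq.1 hb' with h | rfl
        · simpa [h.ne] using i4 b h
        · simp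
      · simp only [Store.arr_setInt, hd.arr 5 rfl, hc.arr 5 rfl, Store.arr_setElem]
        simp only [IntExp.val_var, Store.int_setElem, b6, RealExp.val_var, Store.real_setElem, a9,
          hb.arr 5 rfl]
        rcases Nat.lt_succ_iff_lt_or_eq.1 hb' with h | rfl
        · simpa [h.ne] using i5 b h
        · simp
      · simp only [Store.real_setInt, d4]
        rcases Nat.lt_succ_iff_lt_or_eq.1 hb' with h | rfl
        · exact ⟨(imax b h).1.trans ((le_max_left _ _).trans (le_max_left _ _)),
            (imax b h).2.trans ((le_max_left _ _).trans (le_max_left _ _))⟩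
        · exact ⟨(le_max_right _ _).trans (le_max_left _ _), le_max_right _ _⟩
      · simp only [Store.real_setInt, d4]
        exact max_le (max_le ile (hle 0 k hk)) (hle 1 k hk)
  · rintro σ' ⟨-, i4, i5, imax, ile⟩
    have e : ((σ.setInt 5 ((IntExp.const 0).val σ)).setReal 4
      ((lit 0).val (σ.setInt 5 ((IntExp.const 0).val σ)))).int 0 = d₁ := by simp [h0]
    rw [e] at i4 i5 imax
    refine ⟨i4, i5, le_antisymm ile (ciSup_le ?_)⟩
    rintro ⟨b, i⟩
    have := imax b b.2
    rw [← N.entropyAt_fin i b]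
    fin_cases i
    · exact this.1
    · exact this.2

/-- The number of grid points used for root finding. -/
noncomputable def gridSize (dₒ : ℕ) (ε : ℝ) : ℕ :=
  ⌈128 * (dₒ : ℝ) / min ε 1 * (128 * dₒ / min ε 1)⌉₊

/-- The number of iterations of the Frank–Wolfe method. -/
noncomputable def stepCount (dₒ : ℕ) (ε : ℝ) : ℕ :=
  ⌈256 * (dₒ : ℝ) * gridSize dₒ ε / min ε 1⌉₊

theorem prepareBlock_spec (hd₁ : 0 < d₁) (hdₒ : 2 ≤ dₒ) (hε : 0 < ε) (h : Encodes N ε σ)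
    (hW : dₒ ≤ W) (hW₁ : d₁ ≤ W) (hWM : gridSize dₒ ε ≤ W) (hWT : stepCount dₒ ε ≤ W)
    (hM : 1 ≤ gridSize dₒ ε) :
    Runs W prepareBlock σ fun σ' => Context N ε (gridSize dₒ ε) (stepCount dₒ ε) σ' := by
  obtain ⟨h0, h1, h2, h3⟩ := h
  have he : min ε 1 ≠ 0 := (lt_min hε one_pos).ne'
  have hl : Real.log 2 ≠ 0 := (Real.log_pos one_lt_two).ne'
  refine Runs.seq (Q := fun σ' => σ'.real 3 = Real.log 2)
    (Runs.setReal (by simp) (by simp)) fun σ₁ a₁ b3 => ?_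
  refine Runs.seq (Q := fun σ' => σ'.real 2 = min ε 1)
    (Runs.ite (by simp) (fun hh => Runs.setReal trivial ?_) fun hh => Runs.setReal trivial ?_)
    fun σ₂ a₂ b2 => ?_
  · have : ε ≤ 1 := by simpa [a₁.real 0 rfl, h2] using hh
    simp [a₁.real 0 rfl, h2, this]
  · have : 1 < ε := by simpa [a₁.real 0 rfl, h2] using hh
    simp [this.le]
  have A₂ := a₁.seq a₂
  refine (ceilBlock_spec (v := 128 * (dₒ : ℝ) / min ε 1 * (128 * dₒ / min ε 1)) hWM
    fun σ' hi hr => ?_).seq fun σ₃ a₃ c3 => ?_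
  · simp [gridExp, hi 1 (by decide), hr, A₂.int 1 rfl, h1, b2, he]
  have A₃ := A₂.seq a₃
  have c3 : σ₃.int 3 = gridSize dₒ ε := c3
  have c2 : σ₃.real 2 = min ε 1 := (a₃.real 2 rfl).trans b2
  refine (ceilBlock_spec (v := 256 * (dₒ : ℝ) * gridSize dₒ ε / min ε 1) hWT
    fun σ' hi hr => ?_).seq fun σ₄ a₄ c4 => ?_
  · simp [stepsExp, hi 1 (by decide), hi 3 (by decide), hr, A₃.int 1 rfl, h1, c2, c3, he]
  have c4 : σ₄.int 4 = stepCount dₒ ε := c4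
  have d3 : σ₄.int 3 = gridSize dₒ ε := (a₄.int 3 rfl).trans c3
  have d2 : σ₄.real 2 = min ε 1 := (a₄.real 2 rfl).trans c2
  have A₄ := A₃.seq a₄
  refine Runs.seq (Q := fun σ' => σ'.real 5 = 1 / (gridSize dₒ ε : ℝ))
    (Runs.setReal (by simp [d3]; omega) (by simp [d3])) fun σ₅ a₅ e5 => ?_
  have e3 : σ₅.int 3 = gridSize dₒ ε := (a₅.int 3 rfl).trans d3
  have e4 : σ₅.int 4 = stepCount dₒ ε := (a₅.int 4 rfl).trans c4
  have e2 : σ₅.real 2 = min ε 1 := (a₅.real 2 rfl).trans d2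
  have f3 : σ₅.real 3 = Real.log 2 := by
    rw [a₅.real 3 rfl, a₄.real 3 rfl, a₃.real 3 rfl, a₂.real 3 rfl, b3]
  have A₅ := A₄.seq a₅
  have h3' : ∀ (i : Fin 2) (b z : ℕ), b < d₁ → z < dₒ → σ.arr i (b * dₒ + z) = N.entry i b z := by
    intro i b z hb hz
    rw [MAC.entry, dif_pos ⟨hb, hz⟩]
    exact h3 ⟨b, hb⟩ i ⟨z, hz⟩
  have g₀ : ∀ b z, b < d₁ → z < dₒ → σ₅.arr 0 (b * dₒ + z) = N.entry 0 b z := by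
    rw [A₅.arr 0 rfl]; exact h3' 0
  have g₁ : ∀ b z, b < d₁ → z < dₒ → σ₅.arr 1 (b * dₒ + z) = N.entry 1 b z := by
    rw [A₅.arr 1 rfl]; exact h3' 1
  refine (entropyBlock_spec hd₁ hW hW₁ ((A₅.int 0 rfl).trans h0) ((A₅.int 1 rfl).trans h1) f3
    g₀ g₁).seq ?_
  rintro σ₆ a₆ ⟨i4, i5, imax⟩
  have hd : (1 : ℝ) < dₒ := by exact_mod_cast hdₒ
  have j1 : σ₆.int 1 = dₒ := by rw [a₆.int 1 rfl, A₅.int 1 rfl, h1]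
  have j3 : σ₆.real 3 = Real.log 2 := (a₆.real 3 rfl).trans f3
  refine (Runs.setReal (Q := fun σ' => σ'.real 4 = N.slope) ?_ ?_).imp fun σ₇ a₇ k4 => ?_
  · simp [j1, j3, hl, hd]
  · simp [j1, j3, imax, MAC.slope, Real.logb]
  have A₇ := a₆.seq a₇
  exact {
    card₁ := by rw [A₇.int 0 rfl, A₅.int 0 rfl, h0]
    cardₒ := by rw [A₇.int 1 rfl, A₅.int 1 rfl, h1]
    grid := by rw [A₇.int 3 rfl, e3]
    steps := by rw [A₇.int 4 rfl, e4]
    precision := by rw [A₇.real 0 rfl, A₅.real 0 rfl, h2]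
    cutoff := by rw [A₇.real 2 rfl, e2]
    log_two := by rw [A₇.real 3 rfl, f3]
    slope := k4
    lam := by rw [A₇.real 5 rfl, e5]
    entry₀ := by rw [A₇.arr 0 rfl]; exact g₀
    entry₁ := by rw [A₇.arr 1 rfl]; exact g₁
    entropy₀ := by rw [a₇.arr 4 rfl]; exact i4
    entropy₁ := by rw [a₇.arr 5 rfl]; exact i5 }

end

end RAM

/-! ### The whole program -/

namespace RAM

/-- Arrays 2 and 3 keep points and values in chronological order, arrays 6 and 7 in ascending order
of the points. Real variables 20 and 1 hold the two sides of the loop test, F(s*) and f(s*); integer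
variable 11 counts the intervals. -/
def initBlock : Cmd :=
  .setReal 6 (lit 0) ⨾
  objectiveBlock ⨾
  .setElem 2 (.const 0) (lit 0) ⨾
  .setElem 3 (.const 0) (.var 7) ⨾
  .setElem 6 (.const 0) (lit 0) ⨾
  .setElem 7 (.const 0) (.var 7) ⨾
  .setReal 12 (lit 1) ⨾
  modulusBlock ⨾
  .setReal 20 (.var 7 + .var 13) ⨾
  .setReal 6 (lit 1) ⨾
  objectiveBlock ⨾
  .setElem 2 (.const 1) (lit 1) ⨾
  .setElem 3 (.const 1) (.var 7) ⨾
  .setElem 6 (.const 1) (lit 1) ⨾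
  .setElem 7 (.const 1) (.var 7) ⨾
  .setReal 1 (.var 7) ⨾
  .setInt 2 (.const 0) ⨾
  .setInt 11 (.const 1)

def bodyBlock : Cmd :=
  bestBlock ⨾
  .setReal 6 (.var 19) ⨾
  objectiveBlock ⨾
  insertBlock ⨾
  .setElem 2 (.var 11 + .const 1) (.var 19) ⨾
  .setElem 3 (.var 11 + .const 1) (.var 7) ⨾
  .setInt 2 (.var 2 + .const 1) ⨾
  .setInt 11 (.var 11 + .const 1) ⨾
  .setReal 20 (.var 18) ⨾
  .setReal 1 (.var 7)

/-- The modified Piyavskii–Shubert algorithm. -/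
def piyavskiiShubert : Cmd :=
  prepareBlock ⨾
  initBlock ⨾
  .loop (.neg (.realLe (.var 20 - .var 1) (.var 0 / lit 2))) bodyBlock

/-- The store represents the state of the algorithm after `n` iterations of its loop. -/
structure Represents {d₁ dₒ : ℕ} (N : MAC (Fin d₁) (Fin 2) (Fin dₒ)) (ε : ℝ) (M T : ℕ)
    (n : ℕ) (st : PSState) (σ : Store) : Prop where
  context : Context N ε M T σ
  reaches : PSReaches (N.approxObjective (1 / M) T) N.modulus (min ε 1 / 8) (ε / 2) n st
  count : σ.int 2 = n
  intervals : σ.int 11 = n + 1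
  length : st.pts.length = n + 2
  output : ∀ (i : ℕ) (hi : i < st.pts.length), σ.arr 2 i = st.pts[i] ∧
    σ.arr 3 i = N.approxObjective (1 / M) T st.pts[i]
  sorted : ∃ x : List ℝ, x.Perm st.pts ∧ x.Pairwise (· ≤ ·) ∧
    ∀ (i : ℕ) (hi : i < x.length), σ.arr 6 i = x[i] ∧
      σ.arr 7 i = N.approxObjective (1 / M) T x[i]
  bound : σ.real 20 = st.bound st.cur
  value : σ.real 1 = N.approxObjective (1 / M) T st.cur

section

variable {d₁ dₒ : ℕ} {N : MAC (Fin d₁) (Fin 2) (Fin dₒ)} {ε : ℝ} {M T W : ℕ} {σ : Store}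

theorem initBlock_spec (h : Context N ε M T σ) (hd₁ : 0 < d₁) (hdₒ : 0 < dₒ) (hW : dₒ ≤ W)
    (hW₁ : d₁ ≤ W) (hWT : T ≤ W) (hM : 1 ≤ M) :
    Runs W initBlock σ fun σ' => Represents N ε M T 0
      (PSState.init (N.approxObjective (1 / M) T) N.modulus) σ' := by
  set f := N.approxObjective (1 / M) T with hf
  refine Runs.seq (Q := fun σ' => σ'.real 6 = 0) (Runs.setReal (by simp) (by simp))
    fun σ₁ a₁ b6 => ?_
  have C₁ := h.of_agree a₁ rfl
  refine (objectiveBlock_spec C₁ hd₁ hdₒ hW hW₁ hWT hM (by simp [b6])).seq fun σ₂ a₂ b7 => ?_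
  rw [b6, ← hf] at b7
  have C₂ := C₁.of_agree a₂ rfl
  refine Runs.seq (Q := fun σ' => σ'.arr 2 0 = 0) (Runs.setElem (by simp) (by simp))
    fun σ₃ a₃ b2 => ?_
  refine Runs.seq (Q := fun σ' => σ'.arr 3 0 = f 0)
    (Runs.setElem (by simp) (by simp [a₃.real 7 rfl, b7])) fun σ₄ a₄ b3 => ?_
  refine Runs.seq (Q := fun σ' => σ'.arr 6 0 = 0) (Runs.setElem (by simp) (by simp))
    fun σ₅ a₅ c6 => ?_
  have A₅ := (a₃.seq a₄).seq a₅
  refine Runs.seq (Q := fun σ' => σ'.arr 7 0 = f 0)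
    (Runs.setElem (by simp) (by simp [A₅.real 7 rfl, b7])) fun σ₆ a₆ c7 => ?_
  have A₆ := A₅.seq a₆
  refine Runs.seq (Q := fun σ' => σ'.real 12 = 1) (Runs.setReal (by simp) (by simp))
    fun σ₇ a₇ c12 => ?_
  have A₇ := A₆.seq a₇
  have C₇ := C₂.of_agree A₇ rfl
  refine (modulusBlock_spec C₇ (by rw [c12]; exact zero_le_one)).seq fun σ₈ a₈ c13 => ?_
  have A₈ := A₇.seq a₈
  refine Runs.seq (Q := fun σ' => σ'.real 20 = boundingFn f N.modulus 0 1)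
    (Runs.setReal (by simp) (by simp [A₈.real 7 rfl, b7, c13, c12, boundingFn]))
    fun σ₉ a₉ c20 => ?_
  refine Runs.seq (Q := fun σ' => σ'.real 6 = 1) (Runs.setReal (by simp) (by simp))
    fun σ₁₀ a₁₀ d6 => ?_
  have A₁₀ := (A₈.seq a₉).seq a₁₀
  have C₁₀ := C₂.of_agree A₁₀ rfl
  refine (objectiveBlock_spec C₁₀ hd₁ hdₒ hW hW₁ hWT hM (by simp [d6])).seq fun σ₁₁ a₁₁ d7 => ?_
  rw [d6, ← hf] at d7
  have C₁₁ := C₁₀.of_agree a₁₁ rfl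
  have B := (((((((a₅.seq a₆).seq a₇).seq a₈).seq a₉).seq a₁₀).seq a₁₁))
  have e2 : σ₁₁.arr 2 0 = 0 := by rw [B.arr 2 rfl, a₄.arr 2 rfl, b2]
  have e3 : σ₁₁.arr 3 0 = f 0 := by rw [B.arr 3 rfl, b3]
  have B' := ((((a₇.seq a₈).seq a₉).seq a₁₀).seq a₁₁)
  have e6 : σ₁₁.arr 6 0 = 0 := by rw [B'.arr 6 rfl, a₆.arr 6 rfl, c6]
  have e7 : σ₁₁.arr 7 0 = f 0 := by rw [B'.arr 7 rfl, c7]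
  have e20 : σ₁₁.real 20 = boundingFn f N.modulus 0 1 := by
    rw [a₁₁.real 20 rfl, a₁₀.real 20 rfl, c20]
  refine Runs.imp (Q := fun σ' => (σ'.arr 2 0 = 0 ∧ σ'.arr 2 1 = 1) ∧
      (σ'.arr 3 0 = f 0 ∧ σ'.arr 3 1 = f 1) ∧ (σ'.arr 6 0 = 0 ∧ σ'.arr 6 1 = 1) ∧
      (σ'.arr 7 0 = f 0 ∧ σ'.arr 7 1 = f 1) ∧ σ'.real 1 = f 1 ∧
      σ'.real 20 = boundingFn f N.modulus 0 1 ∧ σ'.int 2 = 0 ∧ σ'.int 11 = 1)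
    (Runs.setElem_seq (by simp) (Runs.setElem_seq trivial (Runs.setElem_seq (by simp)
      (Runs.setElem_seq trivial (Runs.setReal_seq trivial (Runs.setInt_seq (Runs.setInt ?_)))))))
    ?_
  · simp [e2, e3, e6, e7, d7, e20]
  rintro σ' ha ⟨⟨g20, g21⟩, ⟨g30, g31⟩, ⟨g60, g61⟩, ⟨g70, g71⟩, g1, g20', g2, g11⟩
  refine ⟨C₁₁.of_agree ha rfl, .init, g2, g11, rfl, ?_,
    ⟨[0, 1], List.Perm.refl _, by simp, ?_⟩, g20', g1⟩
  · intro i hi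
    have hi : i < 2 := hi
    interval_cases i
    · exact ⟨g20, g30⟩
    · exact ⟨g21, g31⟩
  · intro i hi
    have hi : i < 2 := hi
    interval_cases i
    · exact ⟨g60, g70⟩
    · exact ⟨g61, g71⟩

theorem _root_.List.pairwise_le_insertIdx {x : List ℝ} {m : ℕ} {r : ℝ} (hm : m + 1 < x.length)
    (hx : x.Pairwise (· ≤ ·)) (hr : r ∈ Set.Icc x[m] x[m + 1]) :
    (x.insertIdx (m + 1) r).Pairwise (· ≤ ·) := by
  have hsorted : ∀ (i j : ℕ) (hj : j < x.length) (hij : i ≤ j),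
      x[i]'(hij.trans_lt hj) ≤ x[j] := by
    intro i j hj hij
    rcases hij.eq_or_lt with rfl | hij
    · exact le_rfl
    · exact List.pairwise_iff_getElem.1 hx i j _ _ hij
  rw [List.pairwise_iff_getElem]
  intro i j hi hj hij
  have hlen : (x.insertIdx (m + 1) r).length = x.length + 1 :=
    List.length_insertIdx_of_le_length hm.le _
  rw [List.getElem_insertIdx, List.getElem_insertIdx]
  split_ifs with h1 h2 h3 h4 h5
  · exact hsorted _ _ _ hij.le
  · exact (hsorted i m _ (by omega)).trans hr.1
  · exact hsorted _ _ _ (by omega)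
  · omega
  · omega
  · exact hr.2.trans (hsorted (m + 1) (j - 1) _ (by omega))
  · omega
  · omega
  · exact hsorted _ _ _ (by omega)

/-- The ascending arrays provide the list x demanded by `PSStep`. Inserting the root directly after
index m keeps them ascending, since it lies between x[m] and x[m + 1]. -/
theorem bodyBlock_spec {n : ℕ} {st : PSState} (h : Represents N ε M T n st σ) (hd₁ : 0 < d₁)
    (hdₒ : 2 ≤ dₒ) (hM : 1 ≤ M) (hW : dₒ ≤ W) (hW₁ : d₁ ≤ W) (hWT : T ≤ W) (hWM : M ≤ W)
    (hnW : n + 1 ≤ W) (hη : N.modulus (2 * (1 / M)) ≤ min ε 1 / 8)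
    (h01 : ∀ s ∈ st.pts, s ∈ Set.Icc (0 : ℝ) 1)
    (hf : ∀ s ∈ Set.Icc (0 : ℝ) 1, ∀ t ∈ Set.Icc (0 : ℝ) 1, N.approxObjective (1 / M) T s
      ≤ N.approxObjective (1 / M) T t + N.modulus (2 * |s - t|) + min ε 1 / 8)
    (hrun : st.Running (N.approxObjective (1 / M) T) (ε / 2)) :
    Runs W bodyBlock σ fun σ' => ∃ st', Represents N ε M T (n + 1) st' σ' := by
  obtain ⟨x, hperm, hsort, hx⟩ := h.sorted
  have hlen : x.length = n + 2 := by rw [hperm.length_eq, h.length]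
  have hout := h.output
  have hC := h.context
  set f := N.approxObjective (1 / M) T with hfdef
  have hX : ∀ (i : ℕ) (hi : i < x.length), x.getD i 0 = x[i] := fun i hi => by
    simp [List.getD_eq_getElem?_getD, hi]
  have hx01 : ∀ (i : ℕ) (hi : i < x.length), x[i] ∈ Set.Icc (0 : ℝ) 1 := fun i hi =>
    h01 _ (hperm.mem_iff.1 (List.getElem_mem hi))
  refine (bestBlock_spec hC hd₁ hdₒ hM hWM hη (f := f) (X := fun i => x.getD i 0)
    h.intervals hnW (fun i hi => ?_) (fun i hi => ?_) (fun i hi => ?_) (fun i hi => ?_) hf).seq ?_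
  · rw [hX i (by omega)]; exact (hx i (by omega)).1
  · rw [hX i (by omega)]; exact (hx i (by omega)).2
  · rw [hX i (by omega), hX (i + 1) (by omega)]
    exact List.pairwise_iff_getElem.1 hsort i (i + 1) _ _ (Nat.lt_succ_self i)
  · rw [hX i (by omega)]; exact hx01 i (by omega)
  rintro σ₁ a₁ ⟨root, m, hmn, hroot, b14, b19, b18⟩
  have hm : m + 1 < x.length := by omega
  have hroot' : ∀ (i : ℕ) (hi : i + 1 < x.length), root i ∈ Set.Icc x[i] x[i + 1] ∧
      |boundingFn f N.modulus x[i] (root i) - boundingFn f N.modulus x[i + 1] (root i)|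
        ≤ min ε 1 / 8 := by
    intro i hi
    have := hroot i (by omega)
    rw [hX i (by omega), hX (i + 1) hi] at this
    exact ⟨this.1, this.2.1⟩
  have hmax : ∀ (i : ℕ) (hi : i + 1 < x.length),
      boundingFn f N.modulus x[i] (root i) ≤ boundingFn f N.modulus x[m] (root m) := by
    intro i hi
    have := (hroot i (by omega)).2.2
    rwa [hX i (by omega), hX m (by omega)] at this
  rw [hX m (by omega)] at b18
  have hr01 : root m ∈ Set.Icc (0 : ℝ) 1 :=
    ⟨(hx01 m (by omega)).1.trans (hroot' m hm).1.1, (hroot' m hm).1.2.trans (hx01 (m + 1) hm).2⟩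
  have C₁ := hC.of_agree a₁ rfl
  refine Runs.seq (Q := fun σ' => σ'.real 6 = root m) (Runs.setReal trivial (by simp [b19]))
    fun σ₂ a₂ c6 => ?_
  have C₂ := C₁.of_agree a₂ rfl
  refine (objectiveBlock_spec C₂ hd₁ (by omega) hW hW₁ hWT hM (by rw [c6]; exact hr01)).seq
    fun σ₃ a₃ c7 => ?_
  rw [c6, ← hfdef] at c7
  have A₃ := a₂.seq a₃
  have A₃' := a₁.seq A₃
  refine (insertBlock_spec (σ := σ₃) (f := f) (X := fun i => x.getD i 0) (r := root m) hmn ?_ ?_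
    hnW ?_ c7 (fun i hi => ?_) (fun i hi => ?_)).seq fun σ₄ a₄ hins => ?_
  · rw [A₃'.int 11 rfl, h.intervals]
  · rw [A₃.int 14 rfl, b14]
  · rw [A₃.real 19 rfl, b19]
  · rw [A₃'.arr 6 rfl, hX i (by omega)]; exact (hx i (by omega)).1
  · rw [A₃'.arr 7 rfl, hX i (by omega)]; exact (hx i (by omega)).2
  have A₄ := A₃'.seq a₄
  have B₄ := A₃.seq a₄
  have d11 : σ₄.int 11 = n + 1 := (A₄.int 11 rfl).trans h.intervals
  have d2 : σ₄.int 2 = n := (A₄.int 2 rfl).trans h.count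
  have d19 : σ₄.real 19 = root m := (B₄.real 19 rfl).trans b19
  have d18 : σ₄.real 18 = boundingFn f N.modulus x[m] (root m) := (B₄.real 18 rfl).trans b18
  have d7 : σ₄.real 7 = f (root m) := (a₄.real 7 rfl).trans c7
  have g2 : σ₄.arr 2 = σ.arr 2 := A₄.arr 2 rfl
  have g3 : σ₄.arr 3 = σ.arr 3 := A₄.arr 3 rfl
  refine Runs.imp
    (Q := fun σ' => (∀ i, σ'.arr 2 i = if i = n + 2 then root m else σ.arr 2 i) ∧
      (∀ i, σ'.arr 3 i = if i = n + 2 then f (root m) else σ.arr 3 i) ∧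
      σ'.int 2 = n + 1 ∧ σ'.int 11 = n + 1 + 1 ∧
      σ'.real 20 = boundingFn f N.modulus x[m] (root m) ∧ σ'.real 1 = f (root m))
    (Runs.setElem_seq trivial (Runs.setElem_seq trivial (Runs.setInt_seq (Runs.setInt_seq
      (Runs.setReal_seq trivial (Runs.setReal trivial ?_)))))) ?_
  · simp [d2, d11, d18, d19, d7, g2, g3]
  rintro σ' ha ⟨k2, k3, ki2, ki11, k20, k1⟩
  have C' := (hC.of_agree A₄ rfl).of_agree ha rfl
  refine ⟨{ pts := st.pts ++ [root m], bound := boundingFn f N.modulus x[m], cur := root m },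
    ⟨C', h.reaches.step ⟨hrun, x, root, m, hm, hperm, hsort, hroot', hmax, rfl⟩, ki2, ki11,
      by simp [h.length], ?_, ⟨x.insertIdx (m + 1) (root m), ?_,
        List.pairwise_le_insertIdx hm hsort (hroot' m hm).1, ?_⟩, k20, k1⟩⟩
  · intro i hi
    rw [k2, k3]
    rcases Nat.lt_or_ge i st.pts.length with h1 | h1
    · have : i ≠ n + 2 := by rw [h.length] at h1; omega
      simp only [if_neg this, List.getElem_append_left h1]
      exact hout i h1
    · have hi' : i = n + 2 := by
        simp [h.length] at hi h1; omega
      simp [hi', List.getElem_append_right, h.length, hfdef]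
  · exact (List.perm_insertIdx _ _ hm.le).trans ((hperm.cons _).trans
      (List.perm_append_singleton _ _).symm)
  · intro i hi
    have hl : (x.insertIdx (m + 1) (root m)).length = x.length + 1 :=
      List.length_insertIdx_of_le_length hm.le _
    have e6 : σ'.arr 6 = σ₄.arr 6 := ha.arr 6 rfl
    have e7 : σ'.arr 7 = σ₄.arr 7 := ha.arr 7 rfl
    obtain ⟨h6, h7⟩ := hins i (by omega)
    rw [e6, e7, h6, h7, List.getElem_insertIdx]
    have key : (if i ≤ m then x.getD i 0 else if i = m + 1 then root m else x.getD (i - 1) 0)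
        = if h₁ : i < m + 1 then x[i] else if h₂ : i = m + 1 then root m else x[i - 1] := by
      split_ifs <;> first | omega | rfl | exact hX _ _
    rw [key]
    exact ⟨rfl, rfl⟩

/-- Error budget with e = min ε 1: τ = e/16 and η = e/8, so τ + η = 3e/16 fits into the half of ε
not used by the threshold. -/
theorem piyavskiiShubert_spec (hd₁ : 2 ≤ d₁) (hdₒ : 2 ≤ dₒ) (hε : 0 < ε) (h : Encodes N ε σ)
    (hW : d₁ + dₒ + gridSize dₒ ε + stepCount dₒ ε + 2 ≤ W) :
    Runs W piyavskiiShubert σ fun σ' => OutputsRun N ε σ' ∧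
      |σ'.real 1 - N.sumCapacity| ≤ ε := by
  have : Nonempty (Fin d₁) := ⟨⟨0, by omega⟩⟩
  have hZ : 2 ≤ Fintype.card (Fin dₒ) := by simpa using hdₒ
  have he0 : 0 < min ε 1 := lt_min hε one_pos
  have he1 : min ε 1 ≤ 1 := min_le_right _ _
  have heε : min ε 1 ≤ ε := min_le_left _ _
  set M := gridSize dₒ ε with hMdef
  set T := stepCount dₒ ε with hTdef
  have hMle : (128 * dₒ / min ε 1) ^ 2 ≤ (M : ℝ) := by
    rw [pow_two]; exact Nat.le_ceil _
  have hTle : 256 * dₒ * M / min ε 1 ≤ (T : ℝ) := Nat.le_ceil _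
  obtain ⟨hM0, -, hη, -⟩ := N.modulus_resolution (by omega) hdₒ he0 he1 hMle
  have hM : 1 ≤ M := by exact_mod_cast hM0
  have hfg : ∀ s ∈ Set.Icc (0 : ℝ) 1,
      |N.approxObjective (1 / M) T s - N.objective s| ≤ min ε 1 / 16 := fun s hs =>
    N.abs_approxObjective_sub_le_of_le (by omega) hdₒ he0 he1 hMle hTle hs
  have hmod := fun s hs t ht => N.objective_le_add_modulus hZ (s := s) (t := t) hs ht
  have hη0 : 0 ≤ min ε 1 / 8 := by positivity
  -- The approximate objective inherits the modulus up to 2τ = e/8, precisely the slack that root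
  -- finding permits.
  have hf : ∀ s ∈ Set.Icc (0 : ℝ) 1, ∀ t ∈ Set.Icc (0 : ℝ) 1, N.approxObjective (1 / M) T s
      ≤ N.approxObjective (1 / M) T t + N.modulus (2 * |s - t|) + min ε 1 / 8 := by
    intro s hs t ht
    have h1 := abs_le.1 (hfg s hs)
    have h2 := abs_le.1 (hfg t ht)
    have h3 := hmod s hs t ht
    linarith [h1.1, h1.2, h2.1, h2.2]
  -- 2(e/8) + 2(e/16) + e/8 = e/2, so δ = 1/M is admissible and at most M outer iterations occur.
  have hδ : 2 * N.modulus (2 * (1 / M)) + 2 * (min ε 1 / 16) + min ε 1 / 8 ≤ ε / 2 := by linarith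
  have hn : ∀ {n st}, PSReaches (N.approxObjective (1 / M) T) N.modulus (min ε 1 / 8) (ε / 2) n st →
      n ≤ M := by
    intro n st hr
    have := hr.mul_le_one (N.modulus_monotoneOn hZ) hfg hmod hη0 hδ
    rw [mul_one_div, div_le_one hM0] at this
    exact_mod_cast this
  refine (prepareBlock_spec (W := W) (by omega) hdₒ hε h (by omega) (by omega) (by omega) (by omega)
    hM).seq fun σ₁ _ C₁ => ?_
  refine (initBlock_spec (W := W) C₁ (by omega) (by omega) (by omega) (by omega) (by omega) hM).seq
    fun σ₂ _ hR => ?_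
  refine Runs.loop (fun n σ' => ∃ st, Represents N ε M T n st σ') ⟨_, hR⟩ ?_ ?_
  · rintro n σ' - ⟨st, hst⟩
    refine ⟨by simp, fun hh => ?_⟩
    have hrun : st.Running (N.approxObjective (1 / M) T) (ε / 2) := by
      have : ε / 2 < st.bound st.cur - N.approxObjective (1 / M) T st.cur := by
        simpa only [Test.holds_neg, Test.holds_realLe, RealExp.val_sub, RealExp.val_var,
          RealExp.val_div, RealExp.val_lit, hst.bound, hst.value, hst.context.precision, not_le,
          Nat.cast_ofNat] using hh
      exact this
    have hnM := hn hst.reaches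
    have hinv := hst.reaches.invariant (N.modulus_monotoneOn hZ) hfg hmod hη0 hδ
    exact ⟨by omega, bodyBlock_spec hst (by omega) hdₒ hM (by omega) (by omega) (by omega)
      (by omega) (by omega) hη hinv.2.1 hf hrun⟩
  · rintro n σ' - ⟨st, hst⟩ hh
    have hrun : ¬ st.Running (N.approxObjective (1 / M) T) (ε / 2) := by
      have : st.bound st.cur - N.approxObjective (1 / M) T st.cur ≤ ε / 2 := by
        simpa only [Test.holds_neg, Test.holds_realLe, RealExp.val_sub, RealExp.val_var,
          RealExp.val_div, RealExp.val_lit, hst.bound, hst.value, hst.context.precision, not_not,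
          Nat.cast_ofNat] using hh
      exact not_lt.2 this
    refine ⟨⟨N.approxObjective (1 / M) T, min ε 1 / 16, min ε 1 / 8, st, by positivity, hη0,
      by linarith, hfg, ?_, hrun, hst.output, hst.value⟩, ?_⟩
    · rw [hst.count]; exact hst.reaches
    · rw [hst.value]
      have := N.abs_sub_sumCapacity_le hZ hfg hη0 (by linarith) hst.reaches hrun
      linarith

/-- The estimate 1/min(ε, 1) ≤ 1 + 1/ε makes the bound polynomial in 1/ε; 16384 = 128². -/
theorem gridSize_le (hε : 0 < ε) :
    (gridSize dₒ ε : ℝ) ≤ 16384 * (dₒ * (1 + 1 / ε)) ^ 2 + 1 := by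
  have he0 : 0 < min ε 1 := lt_min hε one_pos
  have hinv : (dₒ : ℝ) / min ε 1 ≤ dₒ * (1 + 1 / ε) := by
    rw [div_eq_mul_one_div]
    refine mul_le_mul_of_nonneg_left ?_ (Nat.cast_nonneg _)
    have : 0 < 1 / ε := by positivity
    rcases min_choice ε 1 with h | h <;> rw [h]
    · linarith
    · linarith
  have h0 : (0 : ℝ) ≤ dₒ / min ε 1 := by positivity
  have h2 : 128 * (dₒ : ℝ) / min ε 1 * (128 * dₒ / min ε 1) = 16384 * (dₒ / min ε 1) ^ 2 := by ring
  refine (Nat.ceil_lt_add_one (by rw [h2]; positivity)).le.trans ?_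
  rw [h2]
  have := pow_le_pow_left₀ h0 hinv 2
  linarith

theorem stepCount_le (hε : 0 < ε) : (stepCount dₒ ε : ℝ) ≤
    256 * (dₒ * (1 + 1 / ε)) * (16384 * (dₒ * (1 + 1 / ε)) ^ 2 + 1) + 1 := by
  have he0 : 0 < min ε 1 := lt_min hε one_pos
  have hinv : (dₒ : ℝ) / min ε 1 ≤ dₒ * (1 + 1 / ε) := by
    rw [div_eq_mul_one_div]
    refine mul_le_mul_of_nonneg_left ?_ (Nat.cast_nonneg _)
    have : 0 < 1 / ε := by positivity
    rcases min_choice ε 1 with h | h <;> rw [h]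
    · linarith
    · linarith
  have h0 : (0 : ℝ) ≤ dₒ / min ε 1 := by positivity
  have h2 : 256 * (dₒ : ℝ) * gridSize dₒ ε / min ε 1 = 256 * (dₒ / min ε 1) * gridSize dₒ ε := by
    ring
  refine (Nat.ceil_lt_add_one (by positivity)).le.trans ?_
  rw [h2]
  have := mul_le_mul hinv (gridSize_le (dₒ := dₒ) hε) (Nat.cast_nonneg _) (h0.trans hinv)
  linarith

end

open MvPolynomial in
theorem piyavskiiShubert_polynomial :
    ∃ (prog : Cmd) (P : MvPolynomial (Fin 3) ℝ),
      ∀ (d₁ dₒ : ℕ), 2 ≤ d₁ → 2 ≤ dₒ →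
      ∀ (N : MAC (Fin d₁) (Fin 2) (Fin dₒ)) (ε : ℝ), 0 < ε →
      ∀ σ : Store, Encodes N ε σ →
        ∃ (t : ℕ) (σ' : Store), Exec prog σ t σ' ∧
          (t : ℝ) ≤ MvPolynomial.eval ![(d₁ : ℝ), (dₒ : ℝ), 1 / ε] P ∧
          OutputsRun N ε σ' ∧
          |σ'.real 1 - N.sumCapacity| ≤ ε := by
  obtain ⟨A, k, hA⟩ := Cmd.exists_costBound_le piyavskiiShubert
  set Y : MvPolynomial (Fin 3) ℝ := X 1 * (1 + X 2) with hY
  -- The base of the power majorizes W + 1 for the W of `piyavskiiShubert_spec`, whence the constant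
  -- 3 = 2 + 1.
  refine ⟨piyavskiiShubert, C (A : ℝ) * (X 0 + X 1 + (C 16384 * Y ^ 2 + 1)
    + (C 256 * Y * (C 16384 * Y ^ 2 + 1) + 1) + C 3) ^ k, ?_⟩
  intro d₁ dₒ hd₁ hdₒ N ε hε σ hσ
  obtain ⟨t, σ', hexec, ht, hout, hS⟩ := piyavskiiShubert_spec hd₁ hdₒ hε hσ le_rfl
  refine ⟨t, σ', hexec, ?_, hout, hS⟩
  have h1 : (t : ℝ) ≤ ((A * (d₁ + dₒ + gridSize dₒ ε + stepCount dₒ ε + 2 + 1) ^ k : ℕ) : ℝ) := by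
    exact_mod_cast ht.trans (hA _)
  refine h1.trans ?_
  simp only [hY, map_mul, map_add, map_pow, eval_C, eval_X, map_one]
  simp only [Matrix.cons_val_zero, Matrix.cons_val_one, Matrix.cons_val]
  push_cast
  have h2 := gridSize_le (dₒ := dₒ) hε
  have h3 := stepCount_le (dₒ := dₒ) hε
  refine mul_le_mul_of_nonneg_left (pow_le_pow_left₀ (by positivity) ?_ k) (Nat.cast_nonneg _)
  linarith

end RAM

theorem mainTheorem5 :
    -- Every execution of the algorithm makes at most `iterationBound ε dₒ` iterations of the
    -- while loop, never gets stuck, and returns the sum capacity up to `ε` when it halts.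
    (∀ (d₁ dₒ : ℕ), 2 ≤ d₁ → 2 ≤ dₒ →
      ∀ (N : MAC (Fin d₁) (Fin 2) (Fin dₒ)) (ε : ℝ), 0 < ε → ε ≤ 3 * Real.logb 2 dₒ →
      ∀ (n : ℕ) (st : PSState), PSReaches N.objective N.modulus 0 ε n st →
        n ≤ iterationBound ε dₒ ∧
        (st.Running N.objective ε → ∃ st' : PSState, PSStep N.objective N.modulus 0 ε st st') ∧
        (¬ st.Running N.objective ε → |N.objective st.cur - N.sumCapacity| ≤ ε)) ∧
    -- The bound is `O(log dₒ / ε)`, with an absolute constant, for each fixed `ε` and large `dₒ`.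
    (∃ C : ℝ, ∀ ε : ℝ, 0 < ε → ε ≤ 3 → ∃ D : ℕ, ∀ dₒ : ℕ, D ≤ dₒ →
      (iterationBound ε dₒ : ℝ) ≤ C * (Real.logb 2 dₒ / ε)) ∧
    -- One program carries out the algorithm, with numerical evaluation of the objective, sorting
    -- and root finding, at a total cost that is polynomial in `d₁`, `dₒ` and `1 / ε`.
    (∃ (prog : RAM.Cmd) (P : MvPolynomial (Fin 3) ℝ),
      ∀ (d₁ dₒ : ℕ), 2 ≤ d₁ → 2 ≤ dₒ →
      ∀ (N : MAC (Fin d₁) (Fin 2) (Fin dₒ)) (ε : ℝ), 0 < ε →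
      ∀ σ : RAM.Store, RAM.Encodes N ε σ →
        ∃ (t : ℕ) (σ' : RAM.Store), RAM.Exec prog σ t σ' ∧
          (t : ℝ) ≤ MvPolynomial.eval ![(d₁ : ℝ), (dₒ : ℝ), 1 / ε] P ∧
          RAM.OutputsRun N ε σ' ∧
          |σ'.real 1 - N.sumCapacity| ≤ ε) :=
  ⟨fun d₁ dₒ h₁ hₒ N ε hε hε' n st h => exact_algorithm_correct d₁ dₒ h₁ hₒ N ε hε hε' n st h,
    iterationBound_le, RAM.piyavskiiShubert_polynomial⟩
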